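/- Let $\mathrm{Set}_0$ be the category of finite sets, $\mathbf{Set}=\mathrm{Ind}(\mathrm{Pro}(\mathrm{Set}_0))$, $\mathrm{Vect}$ the category of complex vector spaces, and $\mathbb{V}\mathrm{ect}=\mathrm{Pro}(\mathrm{Vect})$ the category of pro-vector spaces. For $\mathbb X\in\mathrm{Pro}(\mathbf{Set})$ and $\mathbb V,\mathbb W\in\mathbb V\mathrm{ect}$, the set of action maps $\mathbb X\times\mathbb V\to\mathbb W$ is defined as follows. If $X\in\mathrm{Set}_0$ and $V,W$ are finite-dimensional, it is the set of maps $X\to\mathrm{Hom}(V,W)$. If $\mathbf X=\text{“}\varinjlim_j\text{”}\,\text{“}\varprojlim_i\text{”}\,X_{ji}\in\mathbf{Set}$ with $X_{ji}\in\mathrm{Set}_0$, and $\mathbf V=\varinjlim_m V_m$, $\mathbf W=\varinjlim_n W_n$ are vector spaces with $V_m,W_n$ finite-dimensional, it is $\varprojlim_{j,m}\varinjlim_{i,n}\mathrm{Map}(X_{ji},\mathrm{Hom}(V_m,W_n))$. Finally, if $\mathbb X=\text{“}\varprojlim_l\text{”}\,\mathbf X_l$ with $\mathbf X_l\in\mathbf{Set}$,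 $\mathbb V=\text{“}\varprojlim_m\text{”}\,\mathbf V_m$ and $\mathbb W=\text{“}\varprojlim_n\text{”}\,\mathbf W_n$, it is $\varprojlim_n\varinjlim_{l,m}$ of the sets of action maps $\mathbf X_l\times\mathbf V_m\to\mathbf W_n$. For a group object $\mathbb H$ of $\mathrm{Pro}(\mathbf{Set})$, let $\mathrm{Rep}(\mathbb H,\mathbb V\mathrm{ect})$ be the category of pro-vector spaces $\mathbb V$ with an action map $\mathbb H\times\mathbb V\to\mathbb V$ that is associative and unital; morphisms are the maps of pro-vector spaces compatible with the actions. The functor of coinvariants $\mathrm{Coinv}_{\mathbb H}:\mathrm{Rep}(\mathbb H,\mathbb V\mathrm{ect})\to\mathbb V\mathrm{ect}$ is the left adjoint of the functor that endows a pro-vector space with the trivial action of $\mathbb H$. A group object of $\mathbf{Set}$ is called quasi-unipotent if it can be presented as a filtered $\text{“}\varinjlim\text{”}\,\mathbf H_i$, where the $\mathbf H_i$ are group objects of $\mathrm{Pro}(\mathrm{Set}_0)$ and the transition maps are homomorphisms. A map $\mathbf X\to\mathbf Y$ in $\mathbf{Set}$ is called weakly surjective if, for every finite set $A$, the map $\mathrm{Hom}(\mathbf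 Y,A)\to\mathrm{Hom}(\mathbf X,A)$ is injective. A group object $\mathbb H$ of $\mathrm{Pro}(\mathbf{Set})$ is called quasi pro-unipotent if it can be presented as a cofiltered $\text{“}\varprojlim\text{”}\,\mathbf H^l$, where the $\mathbf H^l$ are quasi-unipotent group objects of $\mathbf{Set}$ and the transition maps are weakly surjective homomorphisms. **Proposition.** Let $\mathbb H$ be a quasi pro-unipotent group object of $\mathrm{Pro}(\mathbf{Set})$. Then the functor $\mathrm{Coinv}_{\mathbb H}:\mathrm{Rep}(\mathbb H,\mathbb V\mathrm{ect})\to\mathbb V\mathrm{ect}$ admits a left adjoint (called inflation, $\mathrm{Inf}^{\mathbb H}$); moreover $\mathrm{Coinv}_{\mathbb H}$ is exact, i.e. it preserves finite limits and finite colimits. -/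

import Mathlib

open CategoryTheory CategoryTheory.Limits

noncomputable section

open MonoidalCategory CartesianMonoidalCategory MonObj

/-! ### Pro-objects -/

universe v u

/-- The category `Pro(C)` of pro-objects of `C`, i.e. of formal small cofiltered limits of objects
of `C`: the opposite of the category of ind-objects of the opposite category. -/
def Pro (C : Type u) [Category.{v} C] : Type (max u (v + 1)) := (Ind Cᵒᵖ)ᵒᵖ

namespace Pro

variable {C : Type u} [Category.{v} C]

instance : Category.{v} (Pro C) := inferInstanceAs (Category.{v} (Ind Cᵒᵖ)ᵒᵖ)

/-- The canonical full embedding of `C` into its category of pro-objects. -/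
def const : C ⥤ Pro C := (Ind.yoneda (C := Cᵒᵖ)).rightOp

instance : (const (C := C)).Full := inferInstanceAs (Ind.yoneda (C := Cᵒᵖ)).rightOp.Full

instance : (const (C := C)).Faithful := inferInstanceAs (Ind.yoneda (C := Cᵒᵖ)).rightOp.Faithful

instance [HasFiniteLimits C] : HasFiniteLimits (Pro C) :=
  inferInstanceAs (HasFiniteLimits (Ind Cᵒᵖ)ᵒᵖ)

instance : PreservesFiniteLimits (const (C := C)) :=
  preservesFiniteLimits_rightOp (Ind.yoneda (C := Cᵒᵖ))

instance [HasFiniteLimits C] : RepresentablyFlat (const (C := C)) :=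
  flat_of_preservesFiniteLimits _

instance [HasFiniteLimits C] : CartesianMonoidalCategory (Pro C) :=
  CartesianMonoidalCategory.ofHasFiniteProducts

end Pro

namespace Pro
variable {C : Type u} [Category.{v} C]

/-- An ind-object `Z`, seen as the presheaf `d ↦ Hom(d, Z)` on `D`. -/
def indNerve (D : Type u) [Category.{v} D] : Ind D ⥤ Dᵒᵖ ⥤ Type v :=
  CategoryTheory.yoneda ⋙ (Functor.whiskeringLeft _ _ _).obj Ind.yoneda.op

/-- The presheaf `d ↦ Hom(d, Z)` is the one underlying `Z`. -/
def indNerveIso (D : Type u) [Category.{v} D] : indNerve D ≅ Ind.inclusion D :=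
  NatIso.ofComponents (fun Z => NatIso.ofComponents (fun d =>
    ((Ind.inclusion.fullyFaithful.homEquiv (X := Ind.yoneda.obj d.unop) (Y := Z)).trans
      ((((Ind.yonedaCompInclusion (C := D)).app d.unop).homCongr (Iso.refl _)).trans
        yonedaEquiv)).toIso) (by
        intro d d' f
        ext z
        change Ind.yoneda.obj d.unop ⟶ Z at z
        have h := (Ind.yonedaCompInclusion (C := D)).inv.naturality f.unop
        have h2 := congrArg (fun t => t ≫ (Ind.inclusion D).map z) h
        change yonedaEquiv (Ind.yonedaCompInclusion.inv.app d'.unop ≫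
          (Ind.inclusion D).map (Ind.yoneda.map f.unop ≫ z) ≫ 𝟙 _) =
          ((Ind.inclusion D).obj Z).map f (yonedaEquiv (Ind.yonedaCompInclusion.inv.app d.unop ≫
          (Ind.inclusion D).map z ≫ 𝟙 _))
        rw [yonedaEquiv_naturality']
        simp)) (by
    intro Z Z' f
    ext d z
    change Ind.yoneda.obj d.unop ⟶ Z at z
    change yonedaEquiv (Ind.yonedaCompInclusion.inv.app d.unop ≫
          (Ind.inclusion D).map (z ≫ f) ≫ 𝟙 _) =
          ((Ind.inclusion D).map f).app d (yonedaEquiv (Ind.yonedaCompInclusion.inv.app d.unop ≫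
          (Ind.inclusion D).map z ≫ 𝟙 _))
    rw [← yonedaEquiv_comp]
    simp)

/-- An ind-object is determined by the maps into it from objects of `D`. -/
def indNerveFullyFaithful (D : Type u) [Category.{v} D] : (indNerve D).FullyFaithful :=
  Ind.inclusion.fullyFaithful.ofIso (indNerveIso D).symm

/-- If the maps `ψ : V ⟶ U` with the property `p` form a cofiltered system with a small initial
subsystem, then there is a universal `V ⟶ Y` all of whose components have the property `p`. -/
theorem exists_initial_quotient (V : Pro C) (p : ∀ U : C, (V ⟶ const.obj U) → Prop)
    (hp : ∀ U U' (ψ : V ⟶ const.obj U) (g : U ⟶ U'), p U ψ → p U' (ψ ≫ const.map g))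
    (h₁ : ∃ U ψ, p U ψ)
    (h₂ : ∀ U₁ ψ₁ U₂ ψ₂, p U₁ ψ₁ → p U₂ ψ₂ → ∃ U ψ, p U ψ ∧
      ∃ (g₁ : U ⟶ U₁) (g₂ : U ⟶ U₂), ψ ≫ const.map g₁ = ψ₁ ∧ ψ ≫ const.map g₂ = ψ₂)
    (h₃ : ∀ U U' ψ (g g' : U ⟶ U'), p U ψ → ψ ≫ const.map g = ψ ≫ const.map g' →
      ∃ U₀ ψ₀, p U₀ ψ₀ ∧ ∃ f : U₀ ⟶ U, ψ₀ ≫ const.map f = ψ ∧ f ≫ g = f ≫ g')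
    (h₄ : ∃ (I : Type v) (U₀ : I → C) (ψ₀ : ∀ i, V ⟶ const.obj (U₀ i)), (∀ i, p _ (ψ₀ i)) ∧
      ∀ U ψ, p U ψ → ∃ i, ∃ g : U₀ i ⟶ U, ψ₀ i ≫ const.map g = ψ) :
    ∃ (Y : Pro C) (u : V ⟶ Y), (∀ U (q : Y ⟶ const.obj U), p U (u ≫ q)) ∧
      ∀ W (f : V ⟶ W), (∀ U (q : W ⟶ const.obj U), p U (f ≫ q)) → ∃! g : Y ⟶ W, u ≫ g = f := by
  let N := indNerve Cᵒᵖ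
  let F : Cᵒᵖᵒᵖ ⥤ Type v :=
    { obj := fun d => {z : (N.obj V.unop).obj d // p d.unop.unop (Quiver.Hom.op z)}
      map := fun {d d'} f => ↾fun z => ⟨(N.obj V.unop).map f z.1, hp _ _ _ f.unop.unop z.2⟩
      map_id := fun d => by ext z; exact ConcreteCategory.congr_hom ((N.obj V.unop).map_id d) z.1
      map_comp := fun f g => by ext z; exact ConcreteCategory.congr_hom ((N.obj V.unop).map_comp f g) z.1 }
  let j : F ⟶ N.obj V.unop := { app := fun d => ↾fun z => z.1, naturality := fun _ _ _ => rfl }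
  -- the elements of `F`
  let el : ∀ U (ψ : V ⟶ const.obj U), p U ψ → CostructuredArrow CategoryTheory.yoneda F :=
    fun U ψ h => CostructuredArrow.mk (Y := Opposite.op U)
      (yonedaEquiv.symm (show F.obj (.op (.op U)) from ⟨ψ.unop, h⟩))
  have el_surj : ∀ A : CostructuredArrow CategoryTheory.yoneda F, ∃ U ψ h, A = el U ψ h := by
    intro A
    refine ⟨A.left.unop, (yonedaEquiv A.hom).1.op, (yonedaEquiv A.hom).2, ?_⟩
    change A = CostructuredArrow.mk (yonedaEquiv.symm (yonedaEquiv A.hom))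
    rw [Equiv.symm_apply_apply]
    rfl
  have el_hom : ∀ U ψ h U' ψ' h' (g : U' ⟶ U), ψ' ≫ const.map g = ψ →
      ∃ t : el U ψ h ⟶ el U' ψ' h', t.left = g.op := by
    intro U ψ h U' ψ' h' g hg
    refine ⟨CostructuredArrow.homMk g.op ?_, rfl⟩
    change CategoryTheory.yoneda.map g.op ≫ yonedaEquiv.symm _ = yonedaEquiv.symm _
    apply yonedaEquiv.injective
    rw [← yonedaEquiv_naturality, Equiv.apply_symm_apply, Equiv.apply_symm_apply]
    exact Subtype.ext (congrArg Quiver.Hom.unop hg)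
  have hom_el : ∀ U ψ h U' ψ' h' (t : el U ψ h ⟶ el U' ψ' h'), ψ' ≫ const.map t.left.unop = ψ := by
    intro U ψ h U' ψ' h' t
    have := congrArg yonedaEquiv (CostructuredArrow.w t)
    change yonedaEquiv (CategoryTheory.yoneda.map t.left ≫ yonedaEquiv.symm _) =
      yonedaEquiv (yonedaEquiv.symm _) at this
    rw [← yonedaEquiv_naturality, Equiv.apply_symm_apply, Equiv.apply_symm_apply] at this
    exact congrArg Quiver.Hom.op (congrArg Subtype.val this)
  have hne : Nonempty (CostructuredArrow CategoryTheory.yoneda F) := by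
    obtain ⟨U, ψ, h⟩ := h₁
    exact ⟨el U ψ h⟩
  have hfilt : IsFilteredOrEmpty (CostructuredArrow CategoryTheory.yoneda F) := by
    refine ⟨fun A B => ?_, fun A B t t' => ?_⟩
    · obtain ⟨U₁, ψ₁, k₁, rfl⟩ := el_surj A
      obtain ⟨U₂, ψ₂, k₂, rfl⟩ := el_surj B
      obtain ⟨U, ψ, h, g₁, g₂, e₁, e₂⟩ := h₂ _ _ _ _ k₁ k₂
      obtain ⟨t₁, -⟩ := el_hom _ _ k₁ _ _ h g₁ e₁
      obtain ⟨t₂, -⟩ := el_hom _ _ k₂ _ _ h g₂ e₂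
      exact ⟨el U ψ h, t₁, t₂, trivial⟩
    · obtain ⟨U₁, ψ₁, k₁, rfl⟩ := el_surj A
      obtain ⟨U₂, ψ₂, k₂, rfl⟩ := el_surj B
      have e₁ := hom_el _ _ _ _ _ _ t
      have e₂ := hom_el _ _ _ _ _ _ t'
      obtain ⟨U, ψ, h, f, hf, hf'⟩ := h₃ _ _ _ _ _ k₂ (e₁.trans e₂.symm)
      obtain ⟨r, hr⟩ := el_hom _ _ k₂ _ _ h f hf
      refine ⟨el U ψ h, r, CostructuredArrow.hom_ext _ _ ?_⟩
      simp only [CostructuredArrow.comp_left, hr]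
      exact congrArg Quiver.Hom.op hf'
  have hfilt' : IsFiltered (CostructuredArrow CategoryTheory.yoneda F) := { }
  have hsmall : FinallySmall.{v} (CostructuredArrow CategoryTheory.yoneda F) := by
    obtain ⟨I, U₀, ψ₀, k₀, hI⟩ := h₄
    refine finallySmall_of_small_weakly_terminal_set
      (Set.range fun i => el (U₀ i) (ψ₀ i) (k₀ i)) fun A => ?_
    obtain ⟨U, ψ, h, rfl⟩ := el_surj A
    obtain ⟨i, g, hg⟩ := hI U ψ h
    exact ⟨_, ⟨i, rfl⟩, ⟨(el_hom _ _ h _ _ (k₀ i) g hg).choose⟩⟩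
  have hF : IsIndObject F := isIndObject_of_isFiltered_of_finallySmall F
  let Y₀ : Ind Cᵒᵖ := (Ind.equivalence _).inverse.obj ⟨F, hF⟩
  let e : N.obj Y₀ ≅ F := (indNerveIso Cᵒᵖ).app Y₀ ≪≫
    (ObjectProperty.ι _).mapIso ((Ind.equivalence _).counitIso.app ⟨F, hF⟩)
  let u₀ : Y₀ ⟶ V.unop := (indNerveFullyFaithful Cᵒᵖ).preimage (e.hom ≫ j)
  have hu₀ : N.map u₀ = e.hom ≫ j := (indNerveFullyFaithful Cᵒᵖ).map_preimage _
  have hj : ∀ {A : Cᵒᵖᵒᵖ ⥤ Type v} (a b : A ⟶ F), a ≫ j = b ≫ j → a = b := by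
    intro A a b hab
    ext d z
    exact ConcreteCategory.congr_hom (NatTrans.congr_app hab d) z
  refine ⟨.op Y₀, Quiver.Hom.op u₀, ?_, ?_⟩
  · intro U q
    have h := ConcreteCategory.congr_hom (NatTrans.congr_app hu₀ (.op (.op U))) q.unop
    have h' : q.unop ≫ u₀ = (e.hom.app (.op (.op U)) q.unop).1 := h
    have := (e.hom.app (.op (.op U)) q.unop).2
    rw [← h'] at this
    exact this
  · intro W f hf
    have lift_mem : ∀ (d : Cᵒᵖᵒᵖ) (z : Ind.yoneda.obj d.unop ⟶ W.unop),
        p d.unop.unop (Quiver.Hom.op (z ≫ f.unop)) := fun d z => hf d.unop.unop (Quiver.Hom.op z)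
    let θ : N.obj W.unop ⟶ F :=
      { app := fun d => ↾fun z => ⟨(N.map f.unop).app d z, lift_mem d z⟩
        naturality := fun d d' t => 
          ConcreteCategory.hom_ext _ _ fun z => Subtype.ext
            (ConcreteCategory.congr_hom ((N.map f.unop).naturality t) z) }
    have hθ : θ ≫ j = N.map f.unop := rfl
    refine ⟨Quiver.Hom.op ((indNerveFullyFaithful Cᵒᵖ).preimage (θ ≫ e.inv)), ?_, ?_⟩
    · refine congrArg Quiver.Hom.op (a₁ := _ ≫ u₀) (a₂ := f.unop)
        ((indNerveFullyFaithful Cᵒᵖ).map_injective ?_)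
      change N.map (_ ≫ u₀) = N.map f.unop
      rw [Functor.map_comp, hu₀, ← hθ]
      erw [(indNerveFullyFaithful Cᵒᵖ).map_preimage]
      simp
    · intro g hg
      refine congrArg Quiver.Hom.op (a₁ := g.unop)
        ((indNerveFullyFaithful Cᵒᵖ).map_injective ?_)
      rw [Functor.FullyFaithful.map_preimage]
      change N.map g.unop = _
      rw [← cancel_mono e.hom, Category.assoc, e.inv_hom_id, Category.comp_id]
      apply hj
      rw [hθ, Category.assoc, ← hu₀, ← Functor.map_comp]
      exact congrArg N.map (congrArg Quiver.Hom.unop hg)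


theorem ind_exists_small_family {D : Type u} [Category.{v} D] (Z : Ind D) :
    ∃ (I : Type v) (d : I → D) (z : ∀ i, Ind.yoneda.obj (d i) ⟶ Z),
      ∀ d' (z' : Ind.yoneda.obj d' ⟶ Z), ∃ i, ∃ g : d' ⟶ d i, Ind.yoneda.map g ≫ z i = z' := by
  have := (Ind.isIndObject_inclusion_obj Z).finallySmall
  obtain ⟨s, hs, h⟩ := FinallySmall.exists_small_weakly_terminal_set.{v}
    (CostructuredArrow CategoryTheory.yoneda ((Ind.inclusion D).obj Z))
  let I := Shrink.{v} s
  let A (i : I) := ((equivShrink s).symm i).1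
  refine ⟨I, fun i => (A i).left, fun i => Ind.inclusion.fullyFaithful.preimage
    (Ind.yonedaCompInclusion.hom.app (A i).left ≫ (A i).hom), fun d' z' => ?_⟩
  obtain ⟨B, hB, ⟨t⟩⟩ := h (CostructuredArrow.mk (Y := d')
    (Ind.yonedaCompInclusion.inv.app d' ≫ (Ind.inclusion D).map z'))
  obtain ⟨i, rfl⟩ : ∃ i : I, A i = B := ⟨equivShrink s ⟨B, hB⟩, by simp [A]⟩
  refine ⟨i, t.left, Ind.inclusion.fullyFaithful.map_injective ?_⟩
  have h1 := CostructuredArrow.w t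
  have h2 := (Ind.yonedaCompInclusion (C := D)).hom.naturality t.left
  simp only [Functor.comp_map] at h2
  rw [Functor.map_comp, Functor.FullyFaithful.map_preimage, ← Category.assoc, h2, Category.assoc, h1]
  simp

theorem exists_small_family (V : Pro C) : ∃ (I : Type v) (U₀ : I → C)
    (ψ₀ : ∀ i, V ⟶ const.obj (U₀ i)), ∀ U (ψ : V ⟶ const.obj U),
      ∃ i, ∃ g : U₀ i ⟶ U, ψ₀ i ≫ const.map g = ψ := by
  obtain ⟨I, d, z, h⟩ := ind_exists_small_family (D := Cᵒᵖ) (Opposite.unop V)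
  refine ⟨I, fun i => (d i).unop, fun i => Quiver.Hom.op (z i), fun U ψ => ?_⟩
  obtain ⟨i, g, hg⟩ := h (.op U) (Quiver.Hom.unop ψ)
  exact ⟨i, g.unop, congrArg Quiver.Hom.op hg⟩

section Cofiltered

variable [HasFiniteLimits C] {T : Pro C} {S S' R : C}

theorem const_inf (a : T ⟶ const.obj S) (a' : T ⟶ const.obj S') :
    ∃ (Q : C) (c : T ⟶ const.obj Q) (t : Q ⟶ S) (t' : Q ⟶ S'),
      c ≫ const.map t = a ∧ c ≫ const.map t' = a' := by
  obtain ⟨Q, t, t', -⟩ :=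
    IsCofilteredOrEmpty.cone_objs (StructuredArrow.mk a) (StructuredArrow.mk a')
  exact ⟨Q.right, Q.hom, t.right, t'.right, StructuredArrow.w t, StructuredArrow.w t'⟩

theorem const_eq (a : T ⟶ const.obj S) (s s' : S ⟶ R) (h : a ≫ const.map s = a ≫ const.map s') :
    ∃ (Q : C) (c : T ⟶ const.obj Q) (t : Q ⟶ S), c ≫ const.map t = a ∧ t ≫ s = t ≫ s' := by
  obtain ⟨Q, t, e⟩ := IsCofilteredOrEmpty.cone_maps
    (StructuredArrow.homMk s rfl : StructuredArrow.mk a ⟶ StructuredArrow.mk (a ≫ const.map s))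
    (StructuredArrow.homMk s' h.symm)
  exact ⟨Q.right, Q.hom, t.right, StructuredArrow.w t, congrArg CommaMorphism.right e⟩

theorem const_cospan (a : T ⟶ const.obj S) (a' : T ⟶ const.obj S') (s : S ⟶ R) (s' : S' ⟶ R)
    (h : a ≫ const.map s = a' ≫ const.map s') :
    ∃ (Q : C) (c : T ⟶ const.obj Q) (t : Q ⟶ S) (t' : Q ⟶ S'),
      c ≫ const.map t = a ∧ c ≫ const.map t' = a' ∧ t ≫ s = t' ≫ s' := by
  obtain ⟨Q, c, t, t', rfl, rfl⟩ := const_inf a a'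
  obtain ⟨Q', c', r, rfl, e⟩ := const_eq c (t ≫ s) (t' ≫ s') (by simpa using h)
  exact ⟨Q', c', r ≫ t, r ≫ t', by simp, by simp, by simpa using e⟩

end Cofiltered

end Pro

/-! ### The categories of sets `Pro(Set₀) ⊂ Ind(Pro(Set₀)) ⊂ Pro(Ind(Pro(Set₀)))` -/

/-- `Pro(Set₀)`, where `Set₀` is the category of finite sets. -/
abbrev ProFin : Type 1 := Pro FintypeCat.{0}

/-- `Ind(Pro(Set₀))`. -/
abbrev IndProFin : Type 1 := Ind ProFin

/-- `Pro(Ind(Pro(Set₀)))`. -/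
abbrev ProIndProFin : Type 1 := Pro IndProFin

instance : CartesianMonoidalCategory IndProFin :=
  CartesianMonoidalCategory.ofHasFiniteProducts

/-- The embedding `Pro(Set₀) ⥤ Ind(Pro(Set₀))` preserves finite products, hence group objects. -/
instance : (Ind.yoneda (C := ProFin)).Monoidal :=
  Functor.Monoidal.ofChosenFiniteProducts _

/-- The embedding `Ind(Pro(Set₀)) ⥤ Pro(Ind(Pro(Set₀)))` preserves finite products, hence group
objects. -/
instance : (Pro.const (C := IndProFin)).Monoidal :=
  Functor.Monoidal.ofChosenFiniteProducts _


/-- The one-point set. -/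
abbrev onePoint : ProFin := Pro.const.obj (FintypeCat.of PUnit)

/-- The set of points of an object of `Ind(Pro(Set₀))`. -/
abbrev IndProFin.Pt (S : IndProFin) : Type := Ind.yoneda.obj onePoint ⟶ S

/-- The set of points of an object of `Pro(Set₀)`. -/
abbrev ProFin.Pt (P : ProFin) : Type := onePoint ⟶ P

instance (F : FintypeCat.{0}) : Finite (ProFin.Pt (Pro.const.obj F)) := by
  have : Finite (FintypeCat.of PUnit ⟶ F) :=
    Finite.of_injective (fun f => f PUnit.unit) (by
      intro f g h
      ext x
      exact h)
  exact Finite.of_equiv _ (Functor.FullyFaithful.ofFullyFaithful Pro.const).homEquiv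

/-- A function on the points of `P = lim P_i`, `P_i` finite, is locally constant if it comes from a
function on one of the `P_i`; these functions form the filtered colimit of the sets of functions on
the `P_i`. -/
def ProFin.IsLocConst {P : ProFin} {A : Type} (f : P.Pt → A) : Prop :=
  ∃ (F : FintypeCat.{0}) (q : P ⟶ Pro.const.obj F) (g : ProFin.Pt (Pro.const.obj F) → A),
    ∀ x, f x = g (x ≫ q)

/-- A function on the points of `S = colim S_j`, `S_j ∈ Pro(Set₀)`, is locally constant if its
restriction to each `S_j` is; these functions form the limit of the sets of locally constant
functions on the `S_j`. -/
def IndProFin.IsLocConst {S : IndProFin} {A : Type} (f : S.Pt → A) : Prop :=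
  ∀ (P : ProFin) (p : Ind.yoneda.obj P ⟶ S),
    ProFin.IsLocConst fun x : P.Pt => f (Ind.yoneda.map x ≫ p)

theorem ProFin.IsLocConst.bind {P : ProFin} {A B : Type} {f : P.Pt → A} (hf : IsLocConst f)
    {h : A → P.Pt → B} (hh : ∀ a, IsLocConst (h a)) : IsLocConst fun x => h (f x) x := by
  classical
  obtain ⟨F, q, g, hg⟩ := hf
  choose F' q' g' hg' using fun y : ProFin.Pt (Pro.const.obj F) => hh (g y)
  have := Fintype.ofFinite (ProFin.Pt (Pro.const.obj F))
  obtain ⟨X, hX⟩ := IsCofiltered.inf_objs_exists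
    (insert (StructuredArrow.mk q) (Finset.univ.image fun y => StructuredArrow.mk (q' y)))
  obtain ⟨r⟩ := hX (Finset.mem_insert_self _ _)
  have r' := fun y => (hX (Finset.mem_insert_of_mem
    (Finset.mem_image_of_mem (fun y => StructuredArrow.mk (q' y)) (Finset.mem_univ y)))).some
  refine ⟨X.right, X.hom, fun z =>
    g' (z ≫ Pro.const.map r.right) (z ≫ Pro.const.map (r' (z ≫ Pro.const.map r.right)).right),
    fun x => ?_⟩
  have e1 := StructuredArrow.w r
  have e2 := fun y => StructuredArrow.w (r' y)
  simp only [StructuredArrow.mk_hom_eq_self] at e1 e2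
  dsimp only
  have e3 : f x = g ((x ≫ X.hom) ≫ Pro.const.map r.right) := by rw [Category.assoc, e1, hg]
  generalize (x ≫ X.hom) ≫ Pro.const.map r.right = y at *
  rw [Category.assoc, e2]
  rw [← hg', ← e3]

variable (k : Type) [Field k]

/-- The category of pro-vector spaces `Pro(Vect)`. -/
abbrev ProVect : Type 1 := Pro (ModuleCat.{0} k)

variable {k}

/-! ### Action maps `T × V → W` -/

/-- For `S ∈ Ind(Pro(Set₀))` and vector spaces `V`, `W`: the set of action maps `S × V → W`.
Such a map is a family of linear maps `V → W` indexed by the points of `S` which, applied to any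
fixed vector, is locally constant on `S`. If `S = colim_j lim_i S_{ji}` with `S_{ji}` finite and
`V = colim V_m`, `W = colim W_n` with `V_m`, `W_n` finite-dimensional, these families form the set
`lim_{j,m} colim_{i,n} Map(S_{ji}, Hom(V_m, W_n))`. -/
@[ext]
structure LinFamily (S : IndProFin) (V W : ModuleCat.{0} k) where
  toFun : S.Pt → (V ⟶ W)
  locConst : ∀ v : V, IndProFin.IsLocConst fun x => (toFun x).hom v

namespace LinFamily

/-- The constant family. -/
def ofHom (S : IndProFin) {V W : ModuleCat.{0} k} (f : V ⟶ W) : LinFamily S V W where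
  toFun _ := f
  locConst v _ _ := ⟨⊤_ _, (Limits.terminal.from _) ≫ inv (terminalComparison Pro.const),
    fun _ => f.hom v, fun _ => rfl⟩

variable {S S' : IndProFin} {V V' W W' U : ModuleCat.{0} k}

/-- Functoriality: reindexing, and composition with linear maps on both sides. -/
def change (φ : LinFamily S V W) (s : S' ⟶ S) (f : V' ⟶ V) (g : W ⟶ W') : LinFamily S' V' W' where
  toFun x := f ≫ φ.toFun (x ≫ s) ≫ g
  locConst v P p := by
    obtain ⟨F, q, h, hh⟩ := φ.locConst (f.hom v) P (p ≫ s)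
    exact ⟨F, q, fun y => g.hom (h y), fun x => by simp [← hh]⟩

/-- The pointwise composition `(s, v) ↦ φ(s, ψ(s, v))`. -/
def comp (φ : LinFamily S W U) (ψ : LinFamily S V W) : LinFamily S V U where
  toFun x := ψ.toFun x ≫ φ.toFun x
  locConst v P p := (ψ.locConst v P p).bind (h := fun w x => (φ.toFun (Ind.yoneda.map x ≫ p)).hom w)
    fun w => φ.locConst w P p

@[simp] theorem change_toFun (φ : LinFamily S V W) (s : S' ⟶ S) (f : V' ⟶ V) (g : W ⟶ W') (x) :
    (φ.change s f g).toFun x = f ≫ φ.toFun (x ≫ s) ≫ g := rfl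

@[simp] theorem comp_toFun (φ : LinFamily S W U) (ψ : LinFamily S V W) (x) :
    (φ.comp ψ).toFun x = ψ.toFun x ≫ φ.toFun x := rfl

@[simp] theorem ofHom_toFun (f : V ⟶ W) (x) : (ofHom S f).toFun x = f := rfl

end LinFamily


section Act

open Functor

variable {T T' T'' : ProIndProFin} {V V' V'' : ProVect k} {W W' W'' U : ModuleCat.{0} k}

/-- For `T ∈ Pro(Ind(Pro(Set₀)))`, a pro-vector space `V` and a vector space `W`: an action map
`S × X → W` together with maps `T → S` and `V → X`, where `S ∈ Ind(Pro(Set₀))` and `X` is a vector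
space. -/
structure ActRep (T : ProIndProFin) (V : ProVect k) (W : ModuleCat.{0} k) where
  S : IndProFin
  a : T ⟶ Pro.const.obj S
  X : ModuleCat.{0} k
  b : V ⟶ Pro.const.obj X
  φ : LinFamily S X W

/-- `p` is the pullback of `q` along maps `p.S → q.S` and `p.X → q.X` under `T` and `V`. -/
def ActRep.Refines (p q : ActRep T V W) : Prop :=
  ∃ (s : p.S ⟶ q.S) (f : p.X ⟶ q.X), p.a ≫ Pro.const.map s = q.a ∧
    p.b ≫ Pro.const.map f = q.b ∧ p.φ = q.φ.change s f (𝟙 W)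

/-- For `T ∈ Pro(Ind(Pro(Set₀)))`, a pro-vector space `V` and a vector space `W`: the set of action
maps `T × V → W`. It is the filtered colimit of the sets of action maps `S × X → W` over all
`T → S` and `V → X`; if `T = lim T_l` and `V = lim V_m` formally, this is
`colim_{l,m} LinFamily T_l V_m W`. -/
def Act₀ (T : ProIndProFin) (V : ProVect k) (W : ModuleCat.{0} k) : Type 1 :=
  Quot (ActRep.Refines (T := T) (V := V) (W := W))

namespace Act₀

/-- The action map `T × V → S × X → W`. -/
def mk (S : IndProFin) (a : T ⟶ Pro.const.obj S) (X : ModuleCat.{0} k)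
    (b : V ⟶ Pro.const.obj X) (φ : LinFamily S X W) : Act₀ T V W :=
  Quot.mk _ ⟨S, a, X, b, φ⟩

theorem ind {p : Act₀ T V W → Prop} (h : ∀ S a X b φ, p (mk S a X b φ)) (α : Act₀ T V W) : p α :=
  Quot.ind (fun r => h r.S r.a r.X r.b r.φ) α

theorem sound {S S' : IndProFin} {a : T ⟶ Pro.const.obj S} {a' : T ⟶ Pro.const.obj S'}
    {X X' : ModuleCat.{0} k} {b : V ⟶ Pro.const.obj X} {b' : V ⟶ Pro.const.obj X'}
    {φ : LinFamily S X W} {φ' : LinFamily S' X' W} (s : S ⟶ S') (f : X ⟶ X')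
    (hs : a ≫ Pro.const.map s = a') (hf : b ≫ Pro.const.map f = b')
    (h : ∀ x, φ.toFun x = f ≫ φ'.toFun (x ≫ s)) : mk S a X b φ = mk S' a' X' b' φ' :=
  Quot.sound ⟨s, f, hs, hf, LinFamily.ext (funext fun x => by simp [h])⟩

/-- Functoriality in all three variables. -/
def change (α : Act₀ T V W) (t : T' ⟶ T) (f : V' ⟶ V) (g : W ⟶ W') : Act₀ T' V' W' :=
  Quot.map (fun r => ⟨r.S, t ≫ r.a, r.X, f ≫ r.b, r.φ.change (𝟙 _) (𝟙 _) g⟩)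
    (by
      rintro p q ⟨s, e, hs, he, h⟩
      refine ⟨s, e, by simp [hs], by simp [he], LinFamily.ext (funext fun x => ?_)⟩
      simp [h]) α

@[simp] theorem change_mk (S a X b) (φ : LinFamily S X W) (t : T' ⟶ T) (f : V' ⟶ V) (g : W ⟶ W') :
    (mk S a X b φ).change t f g = mk S (t ≫ a) X (f ≫ b) (φ.change (𝟙 _) (𝟙 _) g) := rfl

@[simp] theorem change_id (α : Act₀ T V W) : α.change (𝟙 _) (𝟙 _) (𝟙 _) = α := by
  induction α using ind with
  | h S a X b φ => exact sound (𝟙 _) (𝟙 _) (by simp) (by simp) (by simp)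

@[simp] theorem change_change (α : Act₀ T V W) (t : T' ⟶ T) (f : V' ⟶ V) (g : W ⟶ W')
    (t' : T'' ⟶ T') (f' : V'' ⟶ V') (g' : W' ⟶ W'') :
    (α.change t f g).change t' f' g' = α.change (t' ≫ t) (f' ≫ f) (g ≫ g') := by
  induction α using ind with
  | h S a X b φ => exact sound (𝟙 _) (𝟙 _) (by simp) (by simp) (by simp)

/-- The action map `T × V → V → W` given by the projection and `f`. -/
def ofHom (T : ProIndProFin) (f : V ⟶ Pro.const.obj W) : Act₀ T V W :=
  mk (𝟙_ _) (toUnit T ≫ LaxMonoidal.ε Pro.const) W f (.ofHom _ (𝟙 W))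

theorem mk_ofHom (S a X) (b : V ⟶ Pro.const.obj X) (f : X ⟶ W) :
    mk S a X b (.ofHom S f) = ofHom T (b ≫ Pro.const.map f) :=
  sound (toUnit _) f (by
    rw [← Functor.Monoidal.toUnit_ε, ← Category.assoc]; congr 1; exact toUnit_unique _ _)
    rfl (by simp)

@[simp] theorem change_ofHom (f : V ⟶ Pro.const.obj W) (t : T' ⟶ T) (f' : V' ⟶ V) (g : W ⟶ W') :
    (ofHom T f).change t f' g = ofHom T' (f' ≫ f ≫ Pro.const.map g) := by
  rw [← Category.assoc, ← mk_ofHom _ (toUnit T' ≫ LaxMonoidal.ε Pro.const)]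
  refine sound (𝟙 _) (𝟙 _) ?_ (by simp) (by simp)
  rw [← Category.assoc, toUnit_unique (t ≫ toUnit T) (toUnit T')]
  simp

theorem exists_common_refinement {p q : ActRep T V W}
    (h : (Quot.mk _ p : Act₀ T V W) = Quot.mk _ q) :
    ∃ (S : IndProFin) (a : T ⟶ Pro.const.obj S) (X : ModuleCat.{0} k) (b : V ⟶ Pro.const.obj X)
      (s₁ : S ⟶ p.S) (s₂ : S ⟶ q.S) (f₁ : X ⟶ p.X) (f₂ : X ⟶ q.X),
      a ≫ Pro.const.map s₁ = p.a ∧ a ≫ Pro.const.map s₂ = q.a ∧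
      b ≫ Pro.const.map f₁ = p.b ∧ b ≫ Pro.const.map f₂ = q.b ∧
      ∀ x, f₁ ≫ p.φ.toFun (x ≫ s₁) = f₂ ≫ q.φ.toFun (x ≫ s₂) := by
  replace h := Quot.eqvGen_exact h
  induction h with
  | rel p q h =>
    obtain ⟨s, f, hs, hf, e⟩ := h
    exact ⟨p.S, p.a, p.X, p.b, 𝟙 _, s, 𝟙 _, f, by simp, hs, by simp, hf, by simp [e]⟩
  | refl p => exact ⟨p.S, p.a, p.X, p.b, 𝟙 _, 𝟙 _, 𝟙 _, 𝟙 _, by simp⟩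
  | symm p q _ ih =>
    obtain ⟨S, a, X, b, s₁, s₂, f₁, f₂, e₁, e₂, e₃, e₄, e⟩ := ih
    exact ⟨S, a, X, b, s₂, s₁, f₂, f₁, e₂, e₁, e₄, e₃, fun x => (e x).symm⟩
  | trans p q r _ _ ih₁ ih₂ =>
    obtain ⟨S, a, X, b, s₁, s₂, f₁, f₂, e₁, e₂, e₃, e₄, e⟩ := ih₁
    obtain ⟨S', a', X', b', s₁', s₂', f₁', f₂', e₁', e₂', e₃', e₄', e'⟩ := ih₂
    obtain ⟨R, c, t, t', rfl, rfl, w⟩ := Pro.const_cospan a a' s₂ s₁' (e₂.trans e₁'.symm)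
    obtain ⟨Z, d, g, g', rfl, rfl, w'⟩ := Pro.const_cospan b b' f₂ f₁' (e₄.trans e₃'.symm)
    refine ⟨R, c, Z, d, t ≫ s₁, t' ≫ s₂', g ≫ f₁, g' ≫ f₂', by simpa using e₁, by simpa using e₂',
      by simpa using e₃, by simpa using e₄', fun x => ?_⟩
    have i₁ := e (x ≫ t)
    have i₂ := e' (x ≫ t')
    simp only [Category.assoc] at i₁ i₂ ⊢
    rw [i₁, ← i₂, ← Category.assoc, w', w, Category.assoc]

theorem mk_eq_mk {S : IndProFin} {a : T ⟶ Pro.const.obj S} {X : ModuleCat.{0} k}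
    {b : V ⟶ Pro.const.obj X} {φ ψ : LinFamily S X W} (h : mk S a X b φ = mk S a X b ψ) :
    ∃ (S' : IndProFin) (a' : T ⟶ Pro.const.obj S') (X' : ModuleCat.{0} k)
      (b' : V ⟶ Pro.const.obj X') (s : S' ⟶ S) (f : X' ⟶ X), a' ≫ Pro.const.map s = a ∧
      b' ≫ Pro.const.map f = b ∧ ∀ x, f ≫ φ.toFun (x ≫ s) = f ≫ ψ.toFun (x ≫ s) := by
  obtain ⟨S₁, a₁, X₁, b₁, s₁, s₂, f₁, f₂, e₁, e₂, e₃, e₄, e⟩ := exists_common_refinement h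
  obtain ⟨S', a', s, rfl, w⟩ := Pro.const_eq a₁ s₁ s₂ (e₁.trans e₂.symm)
  obtain ⟨X', b', f, rfl, w'⟩ := Pro.const_eq b₁ f₁ f₂ (e₃.trans e₄.symm)
  refine ⟨S', a', X', b', s ≫ s₁, f ≫ f₁, by simpa using e₁, by simpa using e₃, fun x => ?_⟩
  have i := e (x ≫ s)
  simp only [Category.assoc] at i ⊢
  rw [i, ← Category.assoc, ← w', w, Category.assoc]

/-- Triviality can be detected by a jointly injective pair of maps. -/
theorem eq_ofHom_of_jointly_mono {U U₁ U₂ : ModuleCat.{0} k} (g₁ : U ⟶ U₁) (g₂ : U ⟶ U₂)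
    (hg : ∀ (X : ModuleCat.{0} k) (f f' : X ⟶ U), f ≫ g₁ = f' ≫ g₁ → f ≫ g₂ = f' ≫ g₂ → f = f')
    (α : Act₀ T V U) (ψ : V ⟶ Pro.const.obj U)
    (h₁ : α.change (𝟙 T) (𝟙 V) g₁ = ofHom T (ψ ≫ Pro.const.map g₁))
    (h₂ : α.change (𝟙 T) (𝟙 V) g₂ = ofHom T (ψ ≫ Pro.const.map g₂)) : α = ofHom T ψ := by
  induction α using ind with
  | h S a X b φ =>
    obtain ⟨Z, c, r, t, rfl, rfl⟩ := Pro.const_inf b ψ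
    have key : ∀ (U' : ModuleCat.{0} k) (g : U ⟶ U'),
        (mk S a X (c ≫ Pro.const.map r) φ).change (𝟙 T) (𝟙 V) g =
          ofHom T ((c ≫ Pro.const.map t) ≫ Pro.const.map g) →
        mk S a Z c (φ.change (𝟙 _) r g) = mk S a Z c (.ofHom S (t ≫ g)) := by
      intro U' g h
      rw [mk_ofHom, Functor.map_comp, ← Category.assoc, ← h, change_mk]
      exact sound (𝟙 _) r (by simp) (by simp) (by simp)
    obtain ⟨S₁, a₁, X₁, b₁, s₁, f₁, e₁, e₁', i₁⟩ := mk_eq_mk (key _ _ h₁)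
    obtain ⟨S₂, a₂, X₂, b₂, s₂, f₂, e₂, e₂', i₂⟩ := mk_eq_mk (key _ _ h₂)
    obtain ⟨Q, a', t₁, t₂, rfl, rfl, w⟩ := Pro.const_cospan a₁ a₂ s₁ s₂ (e₁.trans e₂.symm)
    obtain ⟨Y, b', u₁, u₂, rfl, rfl, w'⟩ := Pro.const_cospan b₁ b₂ f₁ f₂ (e₁'.trans e₂'.symm)
    have e : ∀ x, u₁ ≫ f₁ ≫ r ≫ φ.toFun (x ≫ t₁ ≫ s₁) = u₁ ≫ f₁ ≫ t := by
      intro x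
      apply hg
      · have := i₁ (x ≫ t₁)
        simp at this
        simp [this]
      · have := i₂ (x ≫ t₂)
        simp at this
        simp [reassoc_of% w', w, this]
    rw [← mk_ofHom S a]
    trans mk Q a' Y b' (.ofHom Q (u₁ ≫ f₁ ≫ t))
    · exact (sound (t₁ ≫ s₁) (u₁ ≫ f₁ ≫ r) (by simpa using e₁)
        (by simp [← e₁']) (by simpa using fun x => (e x).symm)).symm
    · exact sound (t₁ ≫ s₁) (u₁ ≫ f₁) (by simpa using e₁)
        (by simp [← e₁']) (by simp)

/-- The map `T → S × S'` with the given components. -/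
def constLift {S S' : IndProFin} (a : T ⟶ Pro.const.obj S) (a' : T ⟶ Pro.const.obj S') :
    T ⟶ Pro.const.obj (S ⊗ S') :=
  lift a a' ≫ LaxMonoidal.μ Pro.const S S'

@[simp]
theorem constLift_fst {S S' : IndProFin} (a : T ⟶ Pro.const.obj S) (a' : T ⟶ Pro.const.obj S') :
    constLift a a' ≫ Pro.const.map (fst S S') = a := by simp [constLift]

@[simp]
theorem constLift_snd {S S' : IndProFin} (a : T ⟶ Pro.const.obj S) (a' : T ⟶ Pro.const.obj S') :
    constLift a a' ≫ Pro.const.map (snd S S') = a' := by simp [constLift]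

theorem const_hom_ext {S S' : IndProFin} {a b : T ⟶ Pro.const.obj (S ⊗ S')}
    (h : a ≫ Pro.const.map (fst S S') = b ≫ Pro.const.map (fst S S'))
    (h' : a ≫ Pro.const.map (snd S S') = b ≫ Pro.const.map (snd S S')) : a = b := by
  rw [← cancel_mono (OplaxMonoidal.δ Pro.const S S')]
  ext <;> simpa

@[simp]
theorem constLift_whiskerLeft {S S' R : IndProFin} (a : T ⟶ Pro.const.obj S)
    (a' : T ⟶ Pro.const.obj S') (s : S' ⟶ R) :
    constLift a a' ≫ Pro.const.map (S ◁ s) = constLift a (a' ≫ Pro.const.map s) := by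
  apply const_hom_ext
  · rw [Category.assoc, ← Functor.map_comp, whiskerLeft_fst]; simp
  · rw [Category.assoc, ← Functor.map_comp, whiskerLeft_snd, Functor.map_comp, ← Category.assoc]; simp

@[simp]
theorem constLift_whiskerRight {S S' R : IndProFin} (a : T ⟶ Pro.const.obj S)
    (a' : T ⟶ Pro.const.obj S') (s : S ⟶ R) :
    constLift a a' ≫ Pro.const.map (s ▷ S') = constLift (a ≫ Pro.const.map s) a' := by
  apply const_hom_ext
  · rw [Category.assoc, ← Functor.map_comp, whiskerRight_fst, Functor.map_comp, ← Category.assoc]; simp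
  · rw [Category.assoc, ← Functor.map_comp, whiskerRight_snd]; simp

@[simp]
theorem comp_constLift {S S' : IndProFin} (a : T ⟶ Pro.const.obj S) (a' : T ⟶ Pro.const.obj S')
    (t : T' ⟶ T) : t ≫ constLift a a' = constLift (t ≫ a) (t ≫ a') := by
  apply const_hom_ext <;> simp

/-- For `φ : S × W → U`, `a : T → S` and `β : T × V → W`: the action map
`(t, v) ↦ φ(a(t), β(t, v))`. -/
def compRep {S : IndProFin} (a : T ⟶ Pro.const.obj S) (φ : LinFamily S W U)
    (β : Act₀ T V W) : Act₀ T V U :=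
  Quot.map (fun r => ⟨S ⊗ r.S, constLift a r.a, r.X, r.b,
      (φ.change (fst _ _) (𝟙 _) (𝟙 _)).comp (r.φ.change (snd _ _) (𝟙 _) (𝟙 _))⟩)
    (by
      rintro p q ⟨s, e, hs, he, h⟩
      refine ⟨S ◁ s, e, ?_, he, LinFamily.ext (funext fun x => ?_)⟩
      · simp [hs]
      · simp [h]) β

@[simp] theorem compRep_mk {S : IndProFin} (a : T ⟶ Pro.const.obj S) (φ : LinFamily S W U)
    (S' a' X' b') (ψ : LinFamily S' X' W) :
    compRep a φ (mk S' a' X' b' ψ : Act₀ T V W) = mk (S ⊗ S') (constLift a a') X' b'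
      ((φ.change (fst _ _) (𝟙 _) (𝟙 _)).comp (ψ.change (snd _ _) (𝟙 _) (𝟙 _))) := rfl

end Act₀

/-- For `T ∈ Pro(Ind(Pro(Set₀)))` and pro-vector spaces `V`, `W`: the set of action maps
`T × V → W`. If `W = lim W_n` formally, this is the limit of the sets of action maps `T × V → W_n`,
i.e. a compatible system of action maps `T × V → U` for all maps from `W` to vector spaces `U`. -/
@[ext]
structure Act (T : ProIndProFin) (V W : ProVect k) where
  toFun : ∀ U : ModuleCat.{0} k, (W ⟶ Pro.const.obj U) → Act₀ T V U
  naturality : ∀ (U U' : ModuleCat.{0} k) (q : W ⟶ Pro.const.obj U) (g : U ⟶ U'),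
    toFun U' (q ≫ Pro.const.map g) = (toFun U q).change (𝟙 T) (𝟙 V) g

namespace Act

variable {W W' Y : ProVect k}

/-- Functoriality in all three variables. -/
def change (α : Act T V W) (t : T' ⟶ T) (f : V' ⟶ V) (g : W ⟶ W') : Act T' V' W' where
  toFun U q := (α.toFun U (g ≫ q)).change t f (𝟙 U)
  naturality U U' q h := by simp [← Category.assoc, α.naturality]

@[simp] theorem change_toFun (α : Act T V W) (t : T' ⟶ T) (f : V' ⟶ V) (g : W ⟶ W') (U q) :
    (α.change t f g).toFun U q = (α.toFun U (g ≫ q)).change t f (𝟙 U) := rfl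

/-- The action map `T × V → V → W` given by the projection and `f`. -/
def ofHom (T : ProIndProFin) (f : V ⟶ W) : Act T V W where
  toFun _ q := .ofHom T (f ≫ q)
  naturality _ _ _ _ := by simp

@[simp] theorem ofHom_toFun (f : V ⟶ W) (U q) :
    (ofHom T f).toFun U q = .ofHom T (f ≫ q) := rfl

/-- The action map `(t, v) ↦ α(t, β(t, v))`, with values in a vector space. -/
def comp₀ {U : ModuleCat.{0} k} (α : Act₀ T W U) (β : Act T V W) : Act₀ T V U :=
  Quot.lift (fun r => Act₀.compRep r.a r.φ (β.toFun r.X r.b))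
    (by
      rintro p q ⟨s, e, hs, he, h⟩
      rw [← he, β.naturality]
      induction β.toFun p.X p.b using Act₀.ind with
      | h S a X b φ =>
        rw [Act₀.change_mk, Act₀.compRep_mk, Act₀.compRep_mk]
        refine Act₀.sound (s ▷ S) (𝟙 _) ?_ (by simp) fun x => ?_
        · simp [hs]
        · simp [h]) α

@[simp] theorem comp₀_mk {U : ModuleCat.{0} k} (S a X b) (φ : LinFamily S X U) (β : Act T V W) :
    comp₀ (Act₀.mk S a X b φ) β = Act₀.compRep a φ (β.toFun X b) := rfl

theorem comp₀_change {U U' : ModuleCat.{0} k} (α : Act₀ T W U) (β : Act T V W) (g : U ⟶ U') :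
    comp₀ (α.change (𝟙 T) (𝟙 W) g) β = (comp₀ α β).change (𝟙 T) (𝟙 V) g := by
  induction α using Act₀.ind with
  | h S a X b φ =>
    simp only [Act₀.change_mk, comp₀_mk, Category.id_comp]
    induction β.toFun X b using Act₀.ind with
    | h S' a' X' b' φ' =>
      simp only [Act₀.compRep_mk, Act₀.change_mk]
      exact Act₀.sound (𝟙 _) (𝟙 _) (by simp) (by simp) (by simp)

/-- The action map `(t, v) ↦ α(t, β(t, v))`. -/
def comp (α : Act T W Y) (β : Act T V W) : Act T V Y where
  toFun U q := comp₀ (α.toFun U q) β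
  naturality U U' q g := by rw [α.naturality, comp₀_change]

theorem ofHom_comp_ofHom (f : V ⟶ W) (g : W ⟶ Y) :
    (ofHom T g).comp (ofHom T f) = ofHom T (f ≫ g) := by
  ext U q
  dsimp only [comp, ofHom_toFun]
  rw [Act₀.ofHom, comp₀_mk, ofHom_toFun, Act₀.ofHom, Act₀.compRep_mk, Category.assoc]
  exact Act₀.sound (fst _ _) (𝟙 _) (by simp) (by simp) (by simp)

end Act

/-! ### Representations on pro-vector spaces and coinvariants -/

/-- A representation of the group object `H` on a pro-vector space `V`: an action map
`ρ : H × V → V` such that `ρ(1, v) = v` (as action maps `1 × V → V`) and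
`ρ(gh, v) = ρ(g, ρ(h, v))` (as action maps `(H × H) × V → V`). -/
structure ProRep (k : Type) [Field k] (H : Grp ProIndProFin) where
  V : ProVect k
  ρ : Act H.X V V
  one_act : ρ.change η[H.X] (𝟙 V) (𝟙 V) = Act.ofHom (𝟙_ _) (𝟙 V)
  mul_act : ρ.change μ[H.X] (𝟙 V) (𝟙 V) =
    (ρ.change (fst H.X H.X) (𝟙 V) (𝟙 V)).comp (ρ.change (snd H.X H.X) (𝟙 V) (𝟙 V))

namespace ProRep

variable {H : Grp ProIndProFin}

/-- Morphisms of representations: maps `f` of pro-vector spaces with `f(ρ(h, v)) = ρ(h, f(v))`, as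
action maps `H × V → W`. -/
@[ext]
structure Hom (M N : ProRep k H) where
  hom : M.V ⟶ N.V
  comm : M.ρ.change (𝟙 _) (𝟙 _) hom = N.ρ.change (𝟙 _) hom (𝟙 _)

instance : Category (ProRep k H) where
  Hom := Hom
  id M := ⟨𝟙 _, rfl⟩
  comp {M N L} f g := ⟨f.hom ≫ g.hom, by
    have h1 := f.comm
    have h2 := g.comm
    apply Act.ext
    funext U q
    have e1 := congrFun (congrFun (congrArg Act.toFun h1) U) (g.hom ≫ q)
    have e2 := congrArg (fun α => Act₀.change α (𝟙 _) f.hom (𝟙 _)) (congrFun (congrFun (congrArg Act.toFun h2) U) q)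
    simp at e1 e2 ⊢
    rw [e1, e2]⟩

variable (k H) in
/-- The functor sending a pro-vector space to itself with the trivial action of `H`. -/
def triv : ProVect k ⥤ ProRep k H where
  obj V := ⟨V, Act.ofHom _ (𝟙 V), by ext; simp, by
    have (T : ProIndProFin) (t : T ⟶ H.X) :
        (Act.ofHom H.X (𝟙 V)).change t (𝟙 V) (𝟙 V) = Act.ofHom T (𝟙 V) := by ext; simp
    simp only [this, Act.ofHom_comp_ofHom, Category.comp_id]⟩
  map f := ⟨f, by ext; simp⟩

/-- Every representation `M` has a universal `H`-invariant map to a pro-vector space. -/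
theorem exists_coinvariants (M : ProRep k H) :
    ∃ (Y : ProVect k) (u : M ⟶ (triv k H).obj Y),
      ∀ W (f : M ⟶ (triv k H).obj W), ∃! g : Y ⟶ W, u ≫ (triv k H).map g = f := by
  have comm_iff : ∀ {W : ProVect k} (f : M.V ⟶ W),
      M.ρ.change (𝟙 _) (𝟙 _) f = (Act.ofHom H.X (𝟙 W)).change (𝟙 _) f (𝟙 _) ↔
      ∀ U (q : W ⟶ Pro.const.obj U), M.ρ.toFun U (f ≫ q) = Act₀.ofHom H.X (f ≫ q) := by
    intro W f
    rw [Act.ext_iff, funext_iff]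
    refine forall_congr' fun U => ?_
    rw [funext_iff]
    refine forall_congr' fun q => ?_
    simp
  have mono_mem : ∀ {U U₁ U₂ : ModuleCat.{0} k} (g₁ : U ⟶ U₁) (g₂ : U ⟶ U₂)
      (_ : ∀ (X : ModuleCat.{0} k) (f f' : X ⟶ U), f ≫ g₁ = f' ≫ g₁ → f ≫ g₂ = f' ≫ g₂ → f = f')
      (ψ : M.V ⟶ Pro.const.obj U),
      M.ρ.toFun _ (ψ ≫ Pro.const.map g₁) = .ofHom H.X (ψ ≫ Pro.const.map g₁) →
      M.ρ.toFun _ (ψ ≫ Pro.const.map g₂) = .ofHom H.X (ψ ≫ Pro.const.map g₂) →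
      M.ρ.toFun _ ψ = .ofHom H.X ψ := fun g₁ g₂ hg ψ h₁ h₂ =>
    Act₀.eq_ofHom_of_jointly_mono g₁ g₂ hg _ _ (by rw [← M.ρ.naturality, h₁])
      (by rw [← M.ρ.naturality, h₂])
  refine Exists.elim (Pro.exists_initial_quotient M.V
    (fun U ψ => M.ρ.toFun U ψ = Act₀.ofHom H.X ψ)
    (fun U U' ψ g h => by rw [M.ρ.naturality, h]; simp) ?_ ?_ ?_ ?_) ?_
  · obtain ⟨A⟩ := IsCofiltered.nonempty (C := StructuredArrow M.V Pro.const)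
    let b : M.V ⟶ Pro.const.obj A.right := A.hom
    refine ⟨A.right, b ≫ Pro.const.map 0, ?_⟩
    rw [M.ρ.naturality]
    induction M.ρ.toFun _ b using Act₀.ind with
    | h S a X b' φ =>
      obtain ⟨Z, c, t, t', h, h'⟩ := Pro.const_inf b b'
      have e : b' ≫ Pro.const.map (0 : X ⟶ A.right) = b ≫ Pro.const.map 0 := by
        rw [← h, ← h', Category.assoc, Category.assoc, ← Functor.map_comp, ← Functor.map_comp,
          comp_zero, comp_zero]
      rw [← e, ← Act₀.mk_ofHom S a]
      exact Act₀.sound (𝟙 _) (𝟙 _) (by simp) (by simp) (by simp)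
  · intro U₁ ψ₁ U₂ ψ₂ h₁ h₂
    obtain ⟨X, c, t₁, t₂, rfl, rfl⟩ := Pro.const_inf ψ₁ ψ₂
    have e₁ : (c ≫ Pro.const.map (prod.lift t₁ t₂)) ≫ Pro.const.map prod.fst =
      c ≫ Pro.const.map t₁ := by rw [Category.assoc, ← Functor.map_comp, prod.lift_fst]
    have e₂ : (c ≫ Pro.const.map (prod.lift t₁ t₂)) ≫ Pro.const.map prod.snd =
      c ≫ Pro.const.map t₂ := by rw [Category.assoc, ← Functor.map_comp, prod.lift_snd]
    exact ⟨U₁ ⨯ U₂, c ≫ Pro.const.map (prod.lift t₁ t₂),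
      mono_mem prod.fst prod.snd (fun _ _ _ a b => Limits.prod.hom_ext a b) _
        (by rw [e₁, h₁]) (by rw [e₂, h₂]), prod.fst, prod.snd, e₁, e₂⟩
  · intro U U' ψ g g' h e
    obtain ⟨X, c, t, rfl, w⟩ := Pro.const_eq ψ g g' e
    have e₁ : (c ≫ Pro.const.map (equalizer.lift t w)) ≫ Pro.const.map (equalizer.ι g g') =
      c ≫ Pro.const.map t := by rw [Category.assoc, ← Functor.map_comp, equalizer.lift_ι]
    exact ⟨equalizer g g', c ≫ Pro.const.map (equalizer.lift t w),
      mono_mem (equalizer.ι g g') (equalizer.ι g g') (fun _ _ _ a _ => equalizer.hom_ext a) _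
        (by rw [e₁, h]) (by rw [e₁, h]), equalizer.ι g g', e₁, equalizer.condition g g'⟩
  · obtain ⟨I, U₀, ψ₀, hI⟩ := Pro.exists_small_family M.V
    let mkQ (i : I) (K : Submodule k (U₀ i)) : U₀ i ⟶ ModuleCat.of k (U₀ i ⧸ K) :=
      ModuleCat.ofHom K.mkQ
    refine ⟨Σ i, {K : Submodule k (U₀ i) // M.ρ.toFun _ (ψ₀ i ≫ Pro.const.map (mkQ i K)) =
      .ofHom H.X (ψ₀ i ≫ Pro.const.map (mkQ i K))}, fun j => ModuleCat.of k (U₀ j.1 ⧸ j.2.1),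
      fun j => ψ₀ j.1 ≫ Pro.const.map (mkQ j.1 j.2.1), fun j => j.2.2, fun U ψ hψ => ?_⟩
    obtain ⟨i, g, rfl⟩ := hI U ψ
    let K := LinearMap.ker g.hom
    let g' : ModuleCat.of k (U₀ i ⧸ K) ⟶ U := ModuleCat.ofHom (K.liftQ g.hom le_rfl)
    have hg' : mkQ i K ≫ g' = g := by ext x; rfl
    have hmono : Mono g' := by
      rw [ModuleCat.mono_iff_ker_eq_bot]
      exact Submodule.ker_liftQ_eq_bot _ _ _ le_rfl
    have e : (ψ₀ i ≫ Pro.const.map (mkQ i K)) ≫ Pro.const.map g' = ψ₀ i ≫ Pro.const.map g := by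
      rw [Category.assoc, ← Functor.map_comp, hg']
    exact ⟨⟨i, K, mono_mem g' g' (fun _ _ _ a _ => (cancel_mono g').1 a) _ (by rw [e, hψ])
      (by rw [e, hψ])⟩, g', e⟩
  · rintro Y ⟨u, hu, h⟩
    refine ⟨Y, ⟨u, (comm_iff u).2 hu⟩, fun W f => ?_⟩
    obtain ⟨g, hg, hg'⟩ := h W f.hom ((comm_iff _).1 f.comm)
    exact ⟨g, Hom.ext hg, fun g' h' => hg' g' (congrArg Hom.hom h')⟩

instance : (triv k H).IsRightAdjoint := by
  have (M : ProRep k H) : HasInitial (StructuredArrow M (triv k H)) := by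
    obtain ⟨Y, u, h⟩ := exists_coinvariants M
    refine IsInitial.hasInitial (X := StructuredArrow.mk u) (IsInitial.ofUniqueHom
      (fun A => StructuredArrow.homMk (h _ A.hom).choose (h _ A.hom).choose_spec.1) fun A m => ?_)
    ext
    exact (h _ A.hom).choose_spec.2 _ (StructuredArrow.w m)
  exact isRightAdjointOfStructuredArrowInitials _

variable (k H) in
/-- The functor of coinvariants `M ↦ M_H`, where `Hom(M_H, W) = Hom_H(M, W)` for every pro-vector
space `W` with the trivial action of `H`. -/
def coinv : ProRep k H ⥤ ProVect k := (triv k H).leftAdjoint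

variable (k H) in
/-- The universal property of coinvariants. -/
def coinvAdjunction : coinv k H ⊣ triv k H := Adjunction.ofIsRightAdjoint (triv k H)

end ProRep

end Act

/-! ### Quasi pro-unipotent groups -/

/-- A map `X → Y` in `Ind(Pro(Set₀))` is weakly surjective if a map from `Y` to a finite set is
determined by its composition with `X → Y`, i.e. if the pullback of locally constant functions is
injective. (For locally compact `X`, `Y`: the image of `X` in `Y` is dense.) -/
def WeaklySurjective {X Y : IndProFin} (f : X ⟶ Y) : Prop :=
  ∀ (A : FintypeCat.{0}) (g g' : Y ⟶ Ind.yoneda.obj (Pro.const.obj A)), f ≫ g = f ≫ g' → g = g'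

/-- A group object `H` of `Ind(Pro(Set₀))` is quasi-unipotent if it is a formal filtered colimit of
group objects of `Pro(Set₀)` along homomorphisms. -/
def IsQuasiUnipotent (H : Grp IndProFin) : Prop :=
  ∃ (I : Type) (_ : SmallCategory I) (_ : IsFiltered I) (F : I ⥤ Grp ProFin)
    (c : F ⋙ Ind.yoneda.mapGrp ⟶ (Functor.const I).obj H),
    Nonempty (IsColimit ((Grp.forget IndProFin).mapCocone ⟨H, c⟩))

/-- A group object `H` of `Pro(Ind(Pro(Set₀)))` is quasi pro-unipotent if it is a formal cofiltered
limit of quasi-unipotent group objects of `Ind(Pro(Set₀))` along weakly surjective homomorphisms. -/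
def IsQuasiProUnipotent (H : Grp ProIndProFin) : Prop :=
  ∃ (L : Type) (_ : SmallCategory L) (_ : IsCofiltered L) (F : L ⥤ Grp IndProFin)
    (π : (Functor.const L).obj H ⟶ F ⋙ Pro.const.mapGrp),
    (∀ l, IsQuasiUnipotent (F.obj l)) ∧ (∀ l l' (f : l ⟶ l'), WeaklySurjective (F.map f).hom.hom) ∧
    Nonempty (IsLimit ((Grp.forget ProIndProFin).mapCone ⟨H, π⟩))

end

noncomputable section

open MonoidalCategory CartesianMonoidalCategory MonObj

universe v u

/-! ### Filtered colimits of ind-objects and cofiltered limits of pro-objects -/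

section FilteredColimits

variable {C : Type u} [Category.{v} C] {J : Type v} [SmallCategory J]

/-! `coinv` is a left adjoint, so it preserves colimits; once it also has a left adjoint, it
preserves limits. Everything thus reduces to finding, for each pro-vector space `Y`, a universal map
from `Y` to the coinvariants of a representation `Inf Y`.

Let `H` be the limit of quasi-unipotent groups `S_l`. A form of Frobenius reciprocity holds: a map
from a representation `V` to a vector space `U` is the same as an equivariant map from `V` to the
space of `U`-valued smooth functions on some `S_l`, up to refining `l` (`exists_isCoind`,
`IsCoind.unique`). If `Inf Y` exists, then `Hom(Inf Y, U)` must be `colim_l Hom(Y, (Smooth S_l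
U)_{S_l})`. This formula is taken as the definition. Its transition maps exist because weakly
surjective homomorphisms have dense image, so that pulling back smooth functions sends orbits to
orbits (`mapsOrbits_pull`).

A functor of `U` is corepresented by a pro-vector space when its elements form a cofiltered category
with a small initial family. The hard point is equalizers, which need left exactness of coinvariants
on smooth functions. Finitely many points of a quasi-unipotent group lie in the image of one
profinite group, whose orbits on smooth functions are finite, so averaging over a finite quotient
works in characteristic zero (`Representation.exists_mem_coinvariantsKer`). The same averaging shows
that constants embed in the coinvariants and are cut out there by the coaction; this identifies
invariant maps `Inf Y → U` with maps `Y → U` and yields the unit.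

The action on `Inf Y` comes from the coaction `f ↦ (g ↦ g f)` on smooth functions. Universality
(`exists_universal`) follows because an equivariant `V → Smooth S_l U`, projected to coinvariants,
factors through `coinv V`. -/

instance [IsFiltered J] : PreservesColimitsOfShape J (Pro.indNerve C) :=
  preservesColimitsOfShape_of_natIso (Pro.indNerveIso C).symm

/-- Objects of `C` are compact in `Ind C`: filtered colimits of ind-objects are computed on the
underlying presheaves, hence pointwise. -/
theorem Ind.exists_factor [IsFiltered J] {K : J ⥤ Ind C} {c : Cocone K} (hc : IsColimit c) {d : C}
    (f : Ind.yoneda.obj d ⟶ c.pt) : ∃ j, ∃ g : Ind.yoneda.obj d ⟶ K.obj j, g ≫ c.ι.app j = f :=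
  Types.jointly_surjective_of_isColimit (isColimitOfPreserves
    (Pro.indNerve C ⋙ (evaluation Cᵒᵖ (Type v)).obj (Opposite.op d)) hc) (show _ from f)

theorem Ind.exists_eq [IsFiltered J] {K : J ⥤ Ind C} {c : Cocone K} (hc : IsColimit c) {d : C}
    {j : J} (f g : Ind.yoneda.obj d ⟶ K.obj j) (h : f ≫ c.ι.app j = g ≫ c.ι.app j) :
    ∃ j', ∃ t : j ⟶ j', f ≫ K.map t = g ≫ K.map t :=
  (Types.FilteredColimit.isColimit_eq_iff' (isColimitOfPreserves
    (Pro.indNerve C ⋙ (evaluation Cᵒᵖ (Type v)).obj (Opposite.op d)) hc)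
    (show _ from f) (show _ from g)).1 h

namespace Pro

theorem exists_factor [IsCofiltered J] {K : J ⥤ Pro C} {c : Cone K} (hc : IsLimit c) {S : C}
    (a : c.pt ⟶ const.obj S) : ∃ j, ∃ g : K.obj j ⟶ const.obj S, c.π.app j ≫ g = a := by
  obtain ⟨j, g, h⟩ := Ind.exists_factor (C := Cᵒᵖ)
    (isColimitCoconeLeftOpOfCone (C := Ind Cᵒᵖ) K hc) (d := .op S) (Quiver.Hom.unop a)
  exact ⟨j.unop, Quiver.Hom.op g, congrArg Quiver.Hom.op h⟩

theorem exists_eq [IsCofiltered J] {K : J ⥤ Pro C} {c : Cone K} (hc : IsLimit c) {S : C} {j : J}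
    (a b : K.obj j ⟶ const.obj S) (h : c.π.app j ≫ a = c.π.app j ≫ b) :
    ∃ j', ∃ t : j' ⟶ j, K.map t ≫ a = K.map t ≫ b := by
  obtain ⟨j', t, h⟩ := Ind.exists_eq (C := Cᵒᵖ)
    (isColimitCoconeLeftOpOfCone (C := Ind Cᵒᵖ) K hc) (d := .op S) (j := .op j)
    (Quiver.Hom.unop a) (Quiver.Hom.unop b) (congrArg Quiver.Hom.unop h)
  exact ⟨j'.unop, t.unop, congrArg Quiver.Hom.op h⟩

variable {D : J ⥤ C} {c : Cone (D ⋙ const)}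

theorem exists_factor_const [IsCofiltered J] (hc : IsLimit c) {S : C} (a : c.pt ⟶ const.obj S) :
    ∃ j, ∃ g : D.obj j ⟶ S, c.π.app j ≫ const.map g = a := by
  obtain ⟨j, g, h⟩ := exists_factor hc a
  obtain ⟨g, rfl⟩ := const.map_surjective g
  exact ⟨j, g, h⟩

theorem exists_eq_const [IsCofiltered J] (hc : IsLimit c) {S : C} {j : J}
    (a b : D.obj j ⟶ S) (h : c.π.app j ≫ const.map a = c.π.app j ≫ const.map b) :
    ∃ j', ∃ t : j' ⟶ j, D.map t ≫ a = D.map t ≫ b := by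
  obtain ⟨j', t, h⟩ := exists_eq hc _ _ h
  exact ⟨j', t, const.map_injective (by simpa using h)⟩

/-- A map of pro-objects is a natural transformation of the functors they corepresent. -/
theorem existsUnique_hom {V W : Pro C} (θ : ∀ U, (V ⟶ const.obj U) → (W ⟶ const.obj U))
    (hθ : ∀ U U' (q : V ⟶ const.obj U) (g : U ⟶ U'), θ _ (q ≫ const.map g) = θ _ q ≫ const.map g) :
    ∃! f : W ⟶ V, ∀ U q, f ≫ q = θ U q := by
  let τ : (indNerve Cᵒᵖ).obj V.unop ⟶ (indNerve Cᵒᵖ).obj W.unop :=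
    { app := fun d => ↾fun z => Quiver.Hom.unop (θ d.unop.unop (Quiver.Hom.op z))
      naturality := fun d d' t => by
        ext z
        exact congrArg Quiver.Hom.unop (hθ _ _ (Quiver.Hom.op z) t.unop.unop) }
  have hτ := (indNerveFullyFaithful Cᵒᵖ).map_preimage τ
  refine ⟨Quiver.Hom.op ((indNerveFullyFaithful Cᵒᵖ).preimage τ), fun U q => ?_, fun f hf => ?_⟩
  · let z : Ind.yoneda.obj (Opposite.op U) ⟶ V.unop := Quiver.Hom.unop q
    exact congrArg Quiver.Hom.op
      (ConcreteCategory.congr_hom (NatTrans.congr_app hτ (.op (.op U))) z)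
  · refine congrArg Quiver.Hom.op (a₁ := f.unop) ((indNerveFullyFaithful Cᵒᵖ).map_injective ?_)
    rw [hτ]
    ext d z
    exact congrArg Quiver.Hom.unop (hf d.unop.unop (Quiver.Hom.op z))

theorem hom_ext {V W : Pro C} {f g : W ⟶ V} (h : ∀ U (q : V ⟶ const.obj U), f ≫ q = g ≫ q) :
    f = g :=
  (existsUnique_hom (fun _ q => g ≫ q) (by simp)).unique h (fun _ _ => rfl)

/-- The hypotheses say that the category of elements of `F` is cofiltered with a small weakly
initial family. Its opposite is the category of representables over the presheaf on `Cᵒᵖ`, and being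
filtered and finally small characterises ind-objects. -/
theorem isIndObject_unopUnop (F : C ⥤ Type v) (h₁ : ∃ U, Nonempty (F.obj U))
    (h₂ : ∀ U₁ (x₁ : F.obj U₁) U₂ (x₂ : F.obj U₂), ∃ U, ∃ x : F.obj U,
      ∃ (g₁ : U ⟶ U₁) (g₂ : U ⟶ U₂), F.map g₁ x = x₁ ∧ F.map g₂ x = x₂)
    (h₃ : ∀ U U' (x : F.obj U) (g g' : U ⟶ U'), F.map g x = F.map g' x →
      ∃ U₀, ∃ x₀ : F.obj U₀, ∃ f : U₀ ⟶ U, F.map f x₀ = x ∧ f ≫ g = f ≫ g')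
    (h₄ : ∃ (I : Type v) (U₀ : I → C) (x₀ : ∀ i, F.obj (U₀ i)), ∀ U (x : F.obj U),
      ∃ i, ∃ g : U₀ i ⟶ U, F.map g (x₀ i) = x) :
    IsIndObject (unopUnop C ⋙ F) := by
  set F' : Cᵒᵖᵒᵖ ⥤ Type v := unopUnop C ⋙ F
  let el : ∀ U, F.obj U → CostructuredArrow CategoryTheory.yoneda F' :=
    fun U x => CostructuredArrow.mk (Y := Opposite.op U)
      (yonedaEquiv.symm (show F'.obj (.op (.op U)) from x))
  have el_surj : ∀ A : CostructuredArrow CategoryTheory.yoneda F', ∃ U x, A = el U x := by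
    intro A
    refine ⟨A.left.unop, yonedaEquiv A.hom, ?_⟩
    change A = CostructuredArrow.mk (yonedaEquiv.symm (yonedaEquiv A.hom))
    rw [Equiv.symm_apply_apply]
    rfl
  have el_hom : ∀ U x U' x' (g : U' ⟶ U), F.map g x' = x →
      ∃ t : el U x ⟶ el U' x', t.left = g.op := by
    intro U x U' x' g hg
    refine ⟨CostructuredArrow.homMk g.op ?_, rfl⟩
    change CategoryTheory.yoneda.map g.op ≫ yonedaEquiv.symm _ = yonedaEquiv.symm _
    apply yonedaEquiv.injective
    rw [← yonedaEquiv_naturality, Equiv.apply_symm_apply, Equiv.apply_symm_apply]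
    exact hg
  have hom_el : ∀ U x U' x' (t : el U x ⟶ el U' x'), F.map t.left.unop x' = x := by
    intro U x U' x' t
    have := congrArg yonedaEquiv (CostructuredArrow.w t)
    change yonedaEquiv (CategoryTheory.yoneda.map t.left ≫ yonedaEquiv.symm _) =
      yonedaEquiv (yonedaEquiv.symm _) at this
    rw [← yonedaEquiv_naturality, Equiv.apply_symm_apply, Equiv.apply_symm_apply] at this
    exact this
  have hne : Nonempty (CostructuredArrow CategoryTheory.yoneda F') := by
    obtain ⟨U, ⟨x⟩⟩ := h₁
    exact ⟨el U x⟩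
  have hfilt : IsFilteredOrEmpty (CostructuredArrow CategoryTheory.yoneda F') := by
    refine ⟨fun A B => ?_, fun A B t t' => ?_⟩
    · obtain ⟨U₁, x₁, rfl⟩ := el_surj A
      obtain ⟨U₂, x₂, rfl⟩ := el_surj B
      obtain ⟨U, x, g₁, g₂, e₁, e₂⟩ := h₂ _ x₁ _ x₂
      obtain ⟨t₁, -⟩ := el_hom _ _ _ _ g₁ e₁
      obtain ⟨t₂, -⟩ := el_hom _ _ _ _ g₂ e₂
      exact ⟨el U x, t₁, t₂, trivial⟩
    · obtain ⟨U₁, x₁, rfl⟩ := el_surj A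
      obtain ⟨U₂, x₂, rfl⟩ := el_surj B
      have e₁ := hom_el _ _ _ _ t
      have e₂ := hom_el _ _ _ _ t'
      obtain ⟨U, x, f, hf, hf'⟩ := h₃ _ _ x₂ _ _ (e₁.trans e₂.symm)
      obtain ⟨r, hr⟩ := el_hom _ _ _ _ f hf
      refine ⟨el U x, r, CostructuredArrow.hom_ext _ _ ?_⟩
      simp only [CostructuredArrow.comp_left, hr]
      exact congrArg Quiver.Hom.op hf'
  have hfilt' : IsFiltered (CostructuredArrow CategoryTheory.yoneda F') := { }
  have hsmall : FinallySmall.{v} (CostructuredArrow CategoryTheory.yoneda F') := by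
    obtain ⟨I, U₀, x₀, hI⟩ := h₄
    refine finallySmall_of_small_weakly_terminal_set
      (Set.range fun i => el (U₀ i) (x₀ i)) fun A => ?_
    obtain ⟨U, x, rfl⟩ := el_surj A
    obtain ⟨i, g, hg⟩ := hI U x
    exact ⟨_, ⟨i, rfl⟩, ⟨(el_hom _ _ _ _ g hg).choose⟩⟩
  exact isIndObject_of_isFiltered_of_finallySmall F'

theorem exists_corepresentation_of_isIndObject (F : Cᵒᵖᵒᵖ ⥤ Type v) (hF : IsIndObject F) :
    ∃ (Y : Pro C) (e : ∀ U, (Y ⟶ const.obj U) ≃ F.obj (.op (.op U))), ∀ U U' (q : Y ⟶ const.obj U)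
      (g : U ⟶ U'), e _ (q ≫ const.map g) = F.map g.op.op (e _ q) := by
  obtain ⟨Y₀, ⟨e⟩⟩ : ∃ Y₀ : Ind Cᵒᵖ, Nonempty ((indNerve Cᵒᵖ).obj Y₀ ≅ F) :=
    ⟨(Ind.equivalence _).inverse.obj ⟨F, hF⟩, ⟨(indNerveIso Cᵒᵖ).app _ ≪≫
      (ObjectProperty.ι _).mapIso ((Ind.equivalence _).counitIso.app ⟨F, hF⟩)⟩⟩
  obtain ⟨e', he'⟩ : ∃ e' : ∀ U, (Ind.yoneda.obj (Opposite.op U) ⟶ Y₀) ≃ F.obj (.op (.op U)),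
      ∀ U U' (z : Ind.yoneda.obj (Opposite.op U) ⟶ Y₀) (g : U ⟶ U'),
        e' _ (Ind.yoneda.map g.op ≫ z) = F.map g.op.op (e' _ z) := by
    refine ⟨fun U => (e.app (.op (.op U))).toEquiv, fun U U' z g => ?_⟩
    exact ConcreteCategory.congr_hom (e.hom.naturality (X := .op (.op U)) (Y := .op (.op U')) g.op.op) z
  exact ⟨.op Y₀, fun U => (opEquiv (Opposite.op Y₀) (Opposite.op _)).trans (e' U),
    fun U U' q g => he' U U' (Quiver.Hom.unop q) g⟩

/-- A functor whose elements form a cofiltered category with a small initial subcategory is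
corepresented by a pro-object. -/
theorem exists_corepresentation (F : C ⥤ Type v) (h₁ : ∃ U, Nonempty (F.obj U))
    (h₂ : ∀ U₁ (x₁ : F.obj U₁) U₂ (x₂ : F.obj U₂), ∃ U, ∃ x : F.obj U,
      ∃ (g₁ : U ⟶ U₁) (g₂ : U ⟶ U₂), F.map g₁ x = x₁ ∧ F.map g₂ x = x₂)
    (h₃ : ∀ U U' (x : F.obj U) (g g' : U ⟶ U'), F.map g x = F.map g' x →
      ∃ U₀, ∃ x₀ : F.obj U₀, ∃ f : U₀ ⟶ U, F.map f x₀ = x ∧ f ≫ g = f ≫ g')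
    (h₄ : ∃ (I : Type v) (U₀ : I → C) (x₀ : ∀ i, F.obj (U₀ i)), ∀ U (x : F.obj U),
      ∃ i, ∃ g : U₀ i ⟶ U, F.map g (x₀ i) = x) :
    ∃ (Y : Pro C) (e : ∀ U, (Y ⟶ const.obj U) ≃ F.obj U), ∀ U U' (q : Y ⟶ const.obj U)
      (g : U ⟶ U'), e _ (q ≫ const.map g) = F.map g (e _ q) :=
  exists_corepresentation_of_isIndObject _ (isIndObject_unopUnop F h₁ h₂ h₃ h₄)

end Pro

end FilteredColimits

/-! ### Points of profinite and ind-profinite sets -/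

namespace Pro

theorem exists_presentation {C : Type u} [Category.{v} C] (P : Pro C) :
    ∃ (J : Type v) (_ : SmallCategory J) (_ : IsCofiltered J) (D : J ⥤ C)
      (π : (Functor.const J).obj P ⟶ D ⋙ const), Nonempty (IsLimit (⟨P, π⟩ : Cone (D ⋙ const))) := by
  let Z : Ind Cᵒᵖ := Opposite.unop P
  let F := Z.presentation.F
  let c : Cocone (F ⋙ Ind.yoneda) :=
    (colimit.cocone _).extend Z.colimitPresentationCompYoneda.hom
  have hc : IsColimit c := IsColimit.extendIso _ (colimit.isColimit _)
  exact ⟨(Z.presentation.I)ᵒᵖ, inferInstance, inferInstance, F.leftOp,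
    { app := fun i => Quiver.Hom.op (c.ι.app i.unop)
      naturality := fun i j f => c.op.π.naturality f }, ⟨hc.op⟩⟩

end Pro

namespace ProFin

/-- Maps from a profinite set to a finite set are determined by their values on points. -/
theorem hom_ext_pt {P : ProFin} {A : FintypeCat.{0}} {f g : P ⟶ Pro.const.obj A}
    (h : ∀ x : P.Pt, x ≫ f = x ≫ g) : f = g := by
  obtain ⟨J, _, _, D, π, ⟨hP⟩⟩ := Pro.exists_presentation P
  obtain ⟨Q, c, t, t', rfl, rfl⟩ := Pro.const_inf f g
  obtain ⟨j, r, rfl⟩ := Pro.exists_factor_const hP c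
  by_contra hne
  have hO := (Functor.Initial.isLimitWhiskerEquiv (Over.forget j) _).symm hP
  -- The elements at each stage above `j` on which the two maps to `A` disagree. If some stage had
  -- none, the two maps would already be equal on `P`.
  let E : Over j ⥤ Type :=
    { obj := fun i => {x : D.obj i.left // (r ≫ t) (D.map i.hom x) ≠ (r ≫ t') (D.map i.hom x)}
      map := fun {i i'} a => ↾fun x => ⟨D.map a.left x.1, by
        have := x.2
        have w (y) : D.map i'.hom (D.map a.left y) = D.map i.hom y := by
          rw [← Over.w a, D.map_comp, FintypeCat.comp_apply]
        rwa [w]⟩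
      map_id := fun i => ConcreteCategory.hom_ext _ _ fun x => Subtype.ext
        (ConcreteCategory.congr_hom (D.map_id i.left) x.1)
      map_comp := fun a b => ConcreteCategory.hom_ext _ _ fun x => Subtype.ext
        (ConcreteCategory.congr_hom (D.map_comp a.left b.left) x.1) }
  have : ∀ i, Finite (E.obj i) := fun i => inferInstanceAs (Finite (Subtype _))
  have : ∀ i, Nonempty (E.obj i) := by
    intro i
    by_contra he
    rw [not_nonempty_iff] at he
    apply hne
    have e : D.map i.hom ≫ r ≫ t = D.map i.hom ≫ r ≫ t' := by
      ext x
      by_contra hx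
      exact he.false ⟨x, hx⟩
    have e' := congrArg (fun m => π.app i.left ≫ Pro.const.map m) e
    have w := π.naturality i.hom
    simp only [Functor.const_obj_map, Category.id_comp, Functor.comp_map, Functor.const_obj_obj] at w
    simp only [Functor.map_comp, ← Category.assoc] at e' ⊢
    rwa [← w] at e'
  -- Compactness: a cofiltered system of nonempty finite sets has a compatible family, which is a
  -- point of `P` where the two maps differ.
  obtain ⟨s, hs⟩ := nonempty_sections_of_finite_cofiltered_system E
  let pt (i : Over j) : FintypeCat.of PUnit ⟶ D.obj i.left := FintypeCat.homMk fun _ => (s i).1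
  let x : P.Pt := hO.lift ⟨onePoint, ⟨fun i => Pro.const.map (pt i), fun i i' a => by
    have : pt i' = pt i ≫ D.map a.left := by
      ext y
      exact congrArg Subtype.val (hs a).symm
    simp [this]⟩⟩
  have hx : x ≫ π.app j = Pro.const.map (pt (Over.mk (𝟙 j))) := hO.fac _ (Over.mk (𝟙 j))
  have e := h x
  dsimp only at e
  rw [Category.assoc, Category.assoc, ← Category.assoc, ← Category.assoc x] at e
  erw [hx] at e
  rw [← Functor.map_comp, ← Functor.map_comp, ← Functor.map_comp, ← Functor.map_comp] at e
  have e' := ConcreteCategory.congr_hom (Pro.const.map_injective e) PUnit.unit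
  have := (s (Over.mk (𝟙 j))).2
  erw [ConcreteCategory.congr_hom (D.map_id j) _] at this
  exact this e'

theorem exists_hom {P : ProFin} {A : FintypeCat.{0}} {χ : P.Pt → Pt (Pro.const.obj A)}
    (hχ : IsLocConst χ) : ∃ m : P ⟶ Pro.const.obj A, ∀ x, x ≫ m = χ x := by
  obtain ⟨F, q, g, hg⟩ := hχ
  let pt (B : FintypeCat.{0}) (y : B) : FintypeCat.of PUnit ⟶ B := FintypeCat.homMk fun _ => y
  let m : F ⟶ A := FintypeCat.homMk fun y =>
    (Pro.const.preimage (g (Pro.const.map (pt F y)))) PUnit.unit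
  refine ⟨q ≫ Pro.const.map m, fun x => ?_⟩
  obtain ⟨y, hy⟩ := Pro.const.map_surjective (x ≫ q)
  rw [hg, ← Category.assoc, ← hy, ← Functor.map_comp]
  have : pt F (y PUnit.unit) = y := rfl
  rw [← Functor.map_preimage Pro.const (g _)]
  congr 1

end ProFin

namespace IndProFin

theorem hom_ext_pt {S : IndProFin} {A : FintypeCat.{0}}
    {f g : S ⟶ Ind.yoneda.obj (Pro.const.obj A)} (h : ∀ x : S.Pt, x ≫ f = x ≫ g) : f = g := by
  apply (Pro.indNerveFullyFaithful ProFin).map_injective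
  ext P z
  change Ind.yoneda.obj P.unop ⟶ S at z
  change z ≫ f = z ≫ g
  obtain ⟨f', hf⟩ := Ind.yoneda.map_surjective (z ≫ f)
  obtain ⟨g', hg⟩ := Ind.yoneda.map_surjective (z ≫ g)
  rw [← hf, ← hg]
  congr 1
  refine ProFin.hom_ext_pt fun x => Ind.yoneda.map_injective ?_
  rw [Functor.map_comp, Functor.map_comp, hf, hg, ← Category.assoc, ← Category.assoc, h]

/-- On each profinite piece the function comes from a morphism. These morphisms are compatible
because they are determined by their values on points, so they glue to a map out of the ind-object.
-/
theorem exists_hom {S : IndProFin} {A : FintypeCat.{0}} {χ : S.Pt → ProFin.Pt (Pro.const.obj A)}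
    (hχ : IsLocConst χ) :
    ∃ m : S ⟶ Ind.yoneda.obj (Pro.const.obj A), ∀ x, x ≫ m = Ind.yoneda.map (χ x) := by
  choose m hm using fun (P : ProFin) (p : Ind.yoneda.obj P ⟶ S) => ProFin.exists_hom (hχ P p)
  let τ : (Pro.indNerve ProFin).obj S ⟶
      (Pro.indNerve ProFin).obj (Ind.yoneda.obj (Pro.const.obj A)) :=
    { app := fun P => ↾fun z => Ind.yoneda.map (m P.unop z)
      naturality := fun P P' t => by
        ext z
        change Ind.yoneda.obj P.unop ⟶ S at z
        change Ind.yoneda.map (m _ (Ind.yoneda.map t.unop ≫ z)) =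
          Ind.yoneda.map t.unop ≫ Ind.yoneda.map (m _ z)
        rw [← Functor.map_comp]
        congr 1
        refine ProFin.hom_ext_pt fun x => ?_
        exact (hm _ _ x).trans (Eq.trans (by rw [Functor.map_comp, Category.assoc])
          ((hm _ z (x ≫ t.unop)).symm.trans (Category.assoc _ _ _))) }
  refine ⟨(Pro.indNerveFullyFaithful ProFin).preimage τ, fun x => ?_⟩
  have h := ConcreteCategory.congr_hom (NatTrans.congr_app
    ((Pro.indNerveFullyFaithful ProFin).map_preimage τ) (Opposite.op onePoint)) x
  refine Eq.trans h (congrArg Ind.yoneda.map ?_)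
  have := hm onePoint x (𝟙 _)
  erw [Category.id_comp, CategoryTheory.Functor.map_id, Category.id_comp] at this
  exact this

theorem IsLocConst.map {S : IndProFin} {A B : Type} {f : S.Pt → A} (hf : IsLocConst f) (h : A → B) :
    IsLocConst fun x => h (f x) := fun P p => by
  obtain ⟨F, q, g, hg⟩ := hf P p
  exact ⟨F, q, fun y => h (g y), fun x => congrArg h (hg x)⟩

theorem IsLocConst.of_injective {S : IndProFin} {A B : Type} [Nonempty A] {f : S.Pt → A} {h : A → B}
    (hh : Function.Injective h) (hf : IsLocConst fun x => h (f x)) : IsLocConst f := by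
  convert hf.map (Function.invFun h) using 2
  exact (Function.leftInverse_invFun hh _).symm

theorem IsLocConst.comp {S S' : IndProFin} {A : Type} {f : S.Pt → A} (hf : IsLocConst f)
    (t : S' ⟶ S) : IsLocConst fun x => f (x ≫ t) := fun P p => by
  obtain ⟨F, q, g, hg⟩ := hf P (p ≫ t)
  exact ⟨F, q, g, fun x => by simp only [← hg, Category.assoc]⟩

/-- A weakly surjective map has dense image. -/
theorem _root_.WeaklySurjective.exists_eq {S S' : IndProFin} {t : S' ⟶ S}
    (ht : WeaklySurjective t) {A : Type} {f : S.Pt → A} (hf : IsLocConst f) (x : S.Pt) :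
    ∃ x' : S'.Pt, f (x' ≫ t) = f x := by
  classical
  by_contra! hx
  let pt (b : Bool) : ProFin.Pt (Pro.const.obj (FintypeCat.of Bool)) :=
    Pro.const.map (FintypeCat.homMk fun _ => b)
  -- If the value `f x` is missed on the image of `S'`, the indicator function of `f = f x` and the
  -- zero function agree there, so weak surjectivity makes them equal, contradicting their values at
  -- `x`.
  obtain ⟨m, hm⟩ := exists_hom (hf.map fun a => pt (decide (a = f x)))
  obtain ⟨m', hm'⟩ := exists_hom (hf.map fun _ => pt false)
  have h : m = m' := ht _ _ _ (hom_ext_pt fun x' => by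
    rw [← Category.assoc, ← Category.assoc, hm, hm', decide_eq_false (hx x')])
  have h' := hm x
  rw [h, hm', decide_eq_true rfl] at h'
  have := ConcreteCategory.congr_hom (Pro.const.map_injective (Ind.yoneda.map_injective h')) PUnit.unit
  exact Bool.false_ne_true this

end IndProFin

/-! ### Averaging -/

section Averaging

variable {k G V W : Type*} [Field k] [Group G] [AddCommGroup V] [Module k V]
  [AddCommGroup W] [Module k W] {ρ : Representation k G V} {τ : Representation k G W}

/-- Finite orbits give stabilizers of finite index; intersect the stabilizers of the vectors in `F`
and pass to the normal core. -/
theorem Representation.exists_normal_fixing (K : Subgroup G)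
    (hK : ∀ v, ((fun g => ρ g v) '' K).Finite) (F : Finset V) :
    ∃ N : Subgroup K, N.Normal ∧ N.FiniteIndex ∧ ∀ g ∈ N, ∀ v ∈ F, ρ g v = v := by
  classical
  obtain ⟨N, h, h'⟩ : ∃ N : Subgroup K, N.FiniteIndex ∧ ∀ g ∈ N, ∀ v ∈ F, ρ g v = v := by
    induction F using Finset.induction_on with
    | empty => exact ⟨⊤, inferInstance, by simp⟩
    | insert v F _ ih =>
      obtain ⟨N, h, h'⟩ := ih
      let _ : MulAction K V := MulAction.compHom V (ρ.comp K.subtype)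
      have hs (g : K) (v : V) : g • v = ρ g v := rfl
      have hfin : (MulAction.orbit K v).Finite := by
        refine (hK v).subset ?_
        rintro _ ⟨g, rfl⟩
        exact ⟨g, g.2, rfl⟩
      have : (MulAction.stabilizer K v).FiniteIndex := by
        refine ⟨?_⟩
        rw [MulAction.index_stabilizer]
        have : Finite (MulAction.orbit K v) := hfin
        exact (Set.ncard_pos hfin).2 ⟨v, MulAction.mem_orbit_self v⟩ |>.ne'
      refine ⟨N ⊓ MulAction.stabilizer K v, inferInstance, fun g hg w hw => ?_⟩
      rcases Finset.mem_insert.1 hw with rfl | hw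
      · exact hg.2
      · exact h' g hg.1 w hw
  exact ⟨N.normalCore, inferInstance, inferInstance, fun g hg => h' g (N.normalCore_le hg)⟩

variable [CharZero k] in
/-- Exactness of coinvariants, for representations of a group all of whose finite subsets are
contained in subgroups acting through finite quotients on every vector. -/
theorem Representation.exists_mem_coinvariantsKer {d : V →ₗ[k] W} (hd : ∀ g v, d (ρ g v) = τ g (d v))
    (hG : ∀ s : Finset G, ∃ K : Subgroup G, ↑s ⊆ (K : Set G) ∧
      (∀ v, ((fun g => ρ g v) '' K).Finite) ∧ ∀ w, ((fun g => τ g w) '' K).Finite)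
    {v : V} (hv : d v ∈ Representation.Coinvariants.ker τ) :
    ∃ v₀, v - v₀ ∈ Representation.Coinvariants.ker ρ ∧ d v₀ = 0 := by
  classical
  -- Only finitely many differences `τ g w - w` are involved in `d v`: `K` is chosen to contain
  -- their `g`, and `N` to fix their `w`.
  obtain ⟨T, hT, hvT⟩ := Submodule.mem_span_finite_of_mem_span hv
  choose! p hp using fun x (hx : x ∈ (T : Set W)) => hT hx
  obtain ⟨K, hsK, hKV, hKW⟩ := hG (T.image fun x => (p x).1)
  obtain ⟨N, _, _, hN⟩ := Representation.exists_normal_fixing K hKW (T.image fun x => (p x).2)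
  have := Fintype.ofFinite (K ⧸ N)
  -- Sums over arbitrary coset representatives. `N` need not fix `v`, so `AV v` may depend on the
  -- representatives; this is harmless, since invariance under `K` is only needed for `AW` on
  -- vectors fixed by `N`.
  let AV : V →ₗ[k] V := ∑ c : K ⧸ N, ρ (c.out : K)
  let AW : W →ₗ[k] W := ∑ c : K ⧸ N, τ (c.out : K)
  have hA : ∀ v, d (AV v) = AW (d v) := fun v => by simp [AV, AW, hd]
  have hfix : ∀ w, (∀ g ∈ N, τ (g : K) w = w) → ∀ g : K, AW (τ g w) = AW w := by
    intro w hw g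
    simp only [AW, LinearMap.sum_apply]
    refine Fintype.sum_equiv (Equiv.mulRight (g : K ⧸ N)) _ _ fun c => ?_
    have hmem : ((c * (g : K ⧸ N)).out)⁻¹ * (c.out * g) ∈ N := by
      rw [← QuotientGroup.eq, QuotientGroup.out_eq', QuotientGroup.mk_mul, QuotientGroup.out_eq']
    have := congrArg (τ ((c * (g : K ⧸ N)).out : K)) (hw _ hmem)
    simp only [← Module.End.mul_apply, ← map_mul, Subgroup.coe_mul, Subgroup.coe_inv] at this
    rw [mul_inv_cancel_left] at this
    simpa [Module.End.mul_apply] using this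
  have hzero : AW (d v) = 0 := by
    have : Submodule.span k (T : Set W) ≤ LinearMap.ker AW := by
      rw [Submodule.span_le]
      intro x hx
      have hg : (p x).1 ∈ K := hsK (Finset.mem_coe.2 (Finset.mem_image_of_mem _ hx))
      have := hfix (p x).2 (fun g hg' => hN g hg' _ (Finset.mem_image_of_mem _ hx)) ⟨_, hg⟩
      rw [SetLike.mem_coe, LinearMap.mem_ker, ← hp x hx]
      simpa [sub_eq_zero] using this
    exact this hvT
  have hcard : (Fintype.card (K ⧸ N) : k) ≠ 0 := by exact_mod_cast Fintype.card_ne_zero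
  -- The average of the translates of `v` has the same class as `v`, and `d` maps it to a multiple
  -- of `AW (d v) = 0`.
  refine ⟨(Fintype.card (K ⧸ N) : k)⁻¹ • AV v, ?_, by rw [map_smul, hA, hzero, smul_zero]⟩
  have e : v - (Fintype.card (K ⧸ N) : k)⁻¹ • AV v =
      -((Fintype.card (K ⧸ N) : k)⁻¹ • ∑ c : K ⧸ N, (ρ (c.out : K) v - v)) := by
    simp only [AV, LinearMap.sum_apply, Finset.sum_sub_distrib, Finset.sum_const, smul_sub,
      Finset.card_univ, neg_sub, ← Nat.cast_smul_eq_nsmul k, smul_smul, inv_mul_cancel₀ hcard,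
      one_smul]
  rw [e]
  exact Submodule.neg_mem _ (Submodule.smul_mem _ _ (Submodule.sum_mem _ fun c _ =>
    Representation.Coinvariants.sub_mem_ker _ _))

end Averaging

/-! ### Points of group objects -/

/-- The one-point set is compact and the index category filtered, so finitely many points come from
a single profinite group in the presentation. Take `K` to be its image: on a profinite set a locally
constant function factors through a finite set. -/
theorem IsQuasiUnipotent.exists_subgroup {S : Grp IndProFin} (hS : IsQuasiUnipotent S)
    (s : Finset S.X.Pt) : ∃ K : Subgroup S.X.Pt, ↑s ⊆ (K : Set S.X.Pt) ∧
      ∀ {A : Type} (f : S.X.Pt → A), IndProFin.IsLocConst f → (f '' K).Finite := by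
  classical
  obtain ⟨I, _, _, F, c, ⟨hc⟩⟩ := hS
  let φ (i : I) : (F.obj i).X.Pt →* S.X.Pt :=
    (IsMonHom.monoidHom (c.app i).hom.hom (Ind.yoneda.obj onePoint)).comp
      (Ind.yoneda.homMonoidHom (X := onePoint) (M := (F.obj i).X))
  have hφ : ∀ {i j : I} (a : i ⟶ j) (x : (F.obj i).X.Pt), ∃ y, φ j y = φ i x := by
    intro i j a x
    have h : Ind.yoneda.map (F.map a).hom.hom ≫ (c.app j).hom.hom = (c.app i).hom.hom :=
      (congrArg (fun t => t.hom.hom) (c.naturality a)).trans (Category.comp_id _)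
    refine ⟨x ≫ (F.map a).hom.hom, ?_⟩
    change Ind.yoneda.map (x ≫ _) ≫ _ = Ind.yoneda.map x ≫ _
    rw [Functor.map_comp, ← h]
    exact Category.assoc _ _ _
  obtain ⟨i, hi⟩ : ∃ i, ∀ g ∈ s, ∃ x, φ i x = g := by
    induction s using Finset.induction_on with
    | empty => exact ⟨IsFiltered.nonempty.some, by simp⟩
    | insert g s _ ih =>
      obtain ⟨i, hi⟩ := ih
      obtain ⟨j, x, hx⟩ := Ind.exists_factor hc g
      obtain ⟨x, rfl⟩ := Ind.yoneda.map_surjective x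
      refine ⟨IsFiltered.max i j, fun g' hg' => ?_⟩
      rcases Finset.mem_insert.1 hg' with rfl | hg'
      · obtain ⟨y, hy⟩ := hφ (IsFiltered.rightToMax i j) x
        exact ⟨y, hy.trans hx⟩
      · obtain ⟨x', rfl⟩ := hi g' hg'
        exact hφ (IsFiltered.leftToMax i j) x'
  refine ⟨(φ i).range, fun g hg => hi g hg, fun f hf => ?_⟩
  obtain ⟨B, q, g, hg⟩ := hf _ (c.app i).hom.hom
  refine (Set.finite_range g).subset ?_
  rintro _ ⟨_, ⟨x, rfl⟩, rfl⟩
  exact ⟨_, (hg x).symm⟩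

/-! ### Smooth functions on a group object of `Ind(Pro(Set₀))` -/

namespace IndProFin

theorem IsLocConst.map₂ {S : IndProFin} {A B E : Type} {f : S.Pt → A} {f' : S.Pt → B}
    (hf : IsLocConst f) (hf' : IsLocConst f') (h : A → B → E) :
    IsLocConst fun x => h (f x) (f' x) := fun P p =>
  (hf P p).bind (h := fun a x => h a (f' (Ind.yoneda.map x ≫ p))) fun a => hf'.map (h a) P p

theorem isLocConst_const (S : IndProFin) {A : Type} (a : A) : IsLocConst fun _ : S.Pt => a :=
  fun _ _ => ⟨⊤_ _, (Limits.terminal.from _) ≫ inv (terminalComparison Pro.const),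
    fun _ => a, fun _ => rfl⟩

theorem exists_toPoint (S : IndProFin) : ∃ m : S ⟶ Ind.yoneda.obj onePoint, ∀ x : S.Pt, x ≫ m = 𝟙 _ := by
  obtain ⟨m, hm⟩ := exists_hom (isLocConst_const S (𝟙 onePoint))
  exact ⟨m, fun x => (hm x).trans (Ind.yoneda.map_id _)⟩

/-- Right translation by a point is induced by an endomorphism of the object `S.X`: the product of
the identity and the constant map at `h`. -/
theorem IsLocConst.comp_mul_right {S : Grp IndProFin} {A : Type} {f : S.X.Pt → A}
    (hf : IsLocConst f) (h : S.X.Pt) : IsLocConst fun x => f (x * h) := by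
  obtain ⟨m, hm⟩ := exists_toPoint S.X
  convert hf.comp (𝟙 S.X * (m ≫ h)) using 3 with x
  rw [MonObj.comp_mul, Category.comp_id, ← Category.assoc, hm, Category.id_comp]

end IndProFin

open IndProFin

section Smooth

variable {k : Type} [Field k] (S : Grp IndProFin) (U : ModuleCat.{0} k)

/-- The functions on the points of `S` which are smooth for the action of `S` by right
translations. -/
def smoothSubmodule : Submodule k (S.X.Pt → U) where
  carrier := {f | IsLocConst fun h : S.X.Pt => fun g : S.X.Pt => f (g * h)}
  add_mem' {f f'} hf hf' := by
    change IsLocConst fun h : S.X.Pt => fun g : S.X.Pt => f (g * h) at hf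
    change IsLocConst fun h : S.X.Pt => fun g : S.X.Pt => f' (g * h) at hf'
    exact hf.map₂ hf' fun r r' => r + r'
  zero_mem' := isLocConst_const _ 0
  smul_mem' c f hf := by
    change IsLocConst fun h : S.X.Pt => fun g : S.X.Pt => f (g * h) at hf
    exact hf.map fun r => c • r

/-- The vector space of smooth functions. -/
abbrev Smooth : ModuleCat.{0} k := ModuleCat.of k (smoothSubmodule S U)

variable {S U}

instance : CoeFun (smoothSubmodule S U) fun _ => S.X.Pt → U := ⟨fun f => Subtype.val f⟩

namespace Smooth

theorem ext {f f' : smoothSubmodule S U} (h : ∀ x, f x = f' x) : f = f' := Subtype.ext (funext h)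

theorem isLocConst_mul (f : smoothSubmodule S U) :
    IsLocConst fun h : S.X.Pt => fun g : S.X.Pt => f (g * h) := f.2

theorem isLocConst (f : smoothSubmodule S U) : IsLocConst fun h : S.X.Pt => f h := by
  convert (isLocConst_mul f).map (fun r => r 1) using 2
  exact congrArg f.1 (_root_.one_mul _).symm

/-- A linear family of smooth functions. -/
def lift {X : ModuleCat.{0} k} (φ : S.X.Pt → (X ⟶ U))
    (h : ∀ v, IsLocConst fun h : S.X.Pt => fun g : S.X.Pt => (φ (g * h)).hom v) :
    X ⟶ Smooth S U :=
  ModuleCat.ofHom (LinearMap.codRestrict (smoothSubmodule S U)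
    (LinearMap.pi fun g => (φ g).hom) h)

variable (S U) in
/-- The action by right translations. -/
def transl : Representation k S.X.Pt (smoothSubmodule S U) where
  toFun h := ((LinearMap.funLeft k U (· * h)).restrict (p := smoothSubmodule S U)
    (q := smoothSubmodule S U) fun f hf => by
      change IsLocConst fun h' : S.X.Pt => fun g : S.X.Pt => f (g * h' * h)
      convert IsLocConst.comp_mul_right (f := fun h g => f (g * h)) hf h using 4
      exact _root_.mul_assoc _ _ _)
  map_one' := by
    refine LinearMap.ext fun f => Smooth.ext fun x => ?_
    exact congrArg f.1 (_root_.mul_one x)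
  map_mul' h h' := by
    refine LinearMap.ext fun f => Smooth.ext fun x => ?_
    exact congrArg f.1 (_root_.mul_assoc x h h').symm

theorem isLocConst_transl (f : smoothSubmodule S U) : IsLocConst fun h => transl S U h f :=
  IsLocConst.of_injective (h := Subtype.val) Subtype.val_injective (isLocConst_mul f)

variable (S U) in
/-- Evaluation at a point. -/
def eval (x : S.X.Pt) : Smooth S U ⟶ U :=
  ModuleCat.ofHom ((LinearMap.proj x).comp (smoothSubmodule S U).subtype)

theorem hom_ext {X : ModuleCat.{0} k} {a b : X ⟶ Smooth S U}
    (h : ∀ x, a ≫ eval S U x = b ≫ eval S U x) : a = b := by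
  refine ModuleCat.hom_ext (LinearMap.ext fun v => Smooth.ext fun x => ?_)
  exact congrArg (fun m => m.hom v) (h x)

variable (S U) in
/-- The evaluation map `S × Smooth S U → U`. -/
def ev : LinFamily S.X (Smooth S U) U where
  toFun x := eval S U x
  locConst f := isLocConst f

variable (S U) in
/-- The action map `S × Smooth S U → Smooth S U` given by right translations. -/
def act : LinFamily S.X (Smooth S U) (Smooth S U) where
  toFun x := ModuleCat.ofHom (transl S U x)
  locConst f := isLocConst_transl f

@[simp] theorem ev_toFun (x : S.X.Pt) : (ev S U).toFun x = eval S U x := rfl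

@[simp] theorem act_toFun (x : S.X.Pt) : (act S U).toFun x = ModuleCat.ofHom (transl S U x) := rfl

theorem ofHom_transl_eval (x y : S.X.Pt) :
    ModuleCat.ofHom (transl S U x) ≫ eval S U y = eval S U (y * x) := rfl

variable {U' U'' : ModuleCat.{0} k}

variable (S) in
/-- Functoriality in the vector space. -/
def map (g : U ⟶ U') : Smooth S U ⟶ Smooth S U' :=
  lift (fun x => eval S U x ≫ g) fun f => (isLocConst_mul f).map fun r y => g.hom (r y)

@[simp]
theorem map_eval (g : U ⟶ U') (x : S.X.Pt) : map S g ≫ eval S U' x = eval S U x ≫ g := rfl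

variable (S U) in
/-- The constant functions. -/
def cst : U ⟶ Smooth S U := lift (fun _ => 𝟙 U) fun v => isLocConst_const _ fun _ => v

@[simp]
theorem cst_eval (x : S.X.Pt) : cst S U ≫ eval S U x = 𝟙 U := rfl

variable (S U) in
/-- The coaction `f ↦ (g ↦ g f)`. -/
def coact : Smooth S U ⟶ Smooth S (Smooth S U) :=
  lift (fun x => ModuleCat.ofHom (transl S U x)) fun f => by
    convert (isLocConst_transl f).map fun r g => transl S U g r using 3
    rw [map_mul]
    rfl

@[simp]
theorem coact_eval (x : S.X.Pt) :
    coact S U ≫ eval S _ x = ModuleCat.ofHom (transl S U x) := rfl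

variable {S' S'' : Grp IndProFin}

theorem mul_comp_hom (t : S' ⟶ S) (x y : S'.X.Pt) :
    (x * y) ≫ t.hom.hom = (x ≫ t.hom.hom) * (y ≫ t.hom.hom) := MonObj.mul_comp _ _ _

variable (U) in
/-- Pullback along a homomorphism. -/
def pull (t : S' ⟶ S) : Smooth S U ⟶ Smooth S' U :=
  lift (fun x => eval S U (x ≫ t.hom.hom)) fun f => by
    convert ((isLocConst_mul f).map fun r (x : S'.X.Pt) => r (x ≫ t.hom.hom)).comp t.hom.hom using 3
    rw [mul_comp_hom]
    rfl

@[simp]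
theorem pull_eval (t : S' ⟶ S) (x : S'.X.Pt) :
    pull U t ≫ eval S' U x = eval S U (x ≫ t.hom.hom) := rfl

theorem transl_pull (t : S' ⟶ S) (h : S'.X.Pt) (f : smoothSubmodule S U) :
    transl S' U h ((pull U t).hom f) = (pull U t).hom (transl S U (h ≫ t.hom.hom) f) :=
  Smooth.ext fun x => congrArg (fun y => (eval S U y).hom f) (mul_comp_hom t x h)

theorem coact_pull (t : S' ⟶ S) :
    coact S U ≫ pull _ t ≫ map S' (pull U t) = pull U t ≫ coact S' U := by
  refine hom_ext fun x => ?_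
  exact ModuleCat.hom_ext (LinearMap.ext fun f => (transl_pull t x f).symm)

theorem coact_map (g : U ⟶ U') : coact S U ≫ map S (map S g) = map S g ≫ coact S U' :=
  rfl

/-- Coassociativity, which later makes the maps `coind` equivariant and hence the action on the
inflation associative. -/
theorem coact_coact : coact S U ≫ coact S _ = coact S U ≫ map S (coact S U) := by
  refine hom_ext fun x => ?_
  refine ModuleCat.hom_ext (LinearMap.ext fun f => Smooth.ext fun y => ?_)
  change transl S U (y * x) f = transl S U y (transl S U x f)
  rw [map_mul]
  rfl

theorem cst_pull (t : S' ⟶ S) : cst S U ≫ pull U t = cst S' U := rfl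

/-! ### Coinvariants of smooth functions -/

/-- A linear map between spaces of smooth functions that maps orbits to orbits. -/
def MapsOrbits (d : Smooth S U ⟶ Smooth S' U') : Prop :=
  ∀ h f, ∃ h', d.hom (transl S U h f) = transl S' U' h' (d.hom f)

theorem mapsOrbits_map (g : U ⟶ U') : MapsOrbits (map S g) := fun h _ => ⟨h, rfl⟩

theorem mapsOrbits_coact : MapsOrbits (coact S U) := fun h f =>
  ⟨h, Smooth.ext fun x => LinearMap.congr_fun (map_mul (transl S U) x h).symm f⟩

/-- The orbit map `h ↦ h f` is locally constant and `S'` has dense image in `S`, so every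
`S`-translate of `f` is already the translate by the image of a point of `S'`. -/
theorem mapsOrbits_pull {t : S' ⟶ S} (ht : WeaklySurjective t.hom.hom) :
    MapsOrbits (pull U t) := fun h f => by
  obtain ⟨h', e⟩ := ht.exists_eq (isLocConst_transl f) h
  exact ⟨h', by rw [transl_pull, e]⟩

theorem MapsOrbits.comp {d : Smooth S U ⟶ Smooth S' U'} {d' : Smooth S' U' ⟶ Smooth S'' U''}
    (hd : MapsOrbits d) (hd' : MapsOrbits d') : MapsOrbits (d ≫ d') := fun h f => by
  obtain ⟨h₁, e₁⟩ := hd h f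
  obtain ⟨h₂, e₂⟩ := hd' h₁ (d.hom f)
  exact ⟨h₂, by simp [e₁, e₂]⟩

variable (S U) in
/-- The coinvariants of the space of smooth functions. -/
def Coinv : ModuleCat.{0} k := ModuleCat.of k (transl S U).Coinvariants

variable (S U) in
/-- The projection to the coinvariants. -/
def proj : Smooth S U ⟶ Coinv S U := ModuleCat.ofHom (Representation.Coinvariants.mk _)

theorem proj_surjective : Function.Surjective (proj S U).hom :=
  Representation.Coinvariants.mk_surjective _

instance : Epi (proj S U) := (ModuleCat.epi_iff_surjective _).2 proj_surjective

theorem proj_eq_zero_iff {f : smoothSubmodule S U} :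
    (proj S U).hom f = 0 ↔ f ∈ Representation.Coinvariants.ker (transl S U) :=
  Representation.Coinvariants.mk_eq_zero _

@[simp]
theorem ofHom_transl_proj (x : S.X.Pt) : ModuleCat.ofHom (transl S U x) ≫ proj S U = proj S U := by
  ext f
  exact Representation.Coinvariants.mk_self_apply _ _ _

/-- The map induced on coinvariants. -/
def coinvMap (d : Smooth S U ⟶ Smooth S' U') (hd : MapsOrbits d) : Coinv S U ⟶ Coinv S' U' :=
  ModuleCat.ofHom (Submodule.mapQ _ _ d.hom (by
    rw [Representation.Coinvariants.ker, Submodule.span_le]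
    rintro _ ⟨⟨h, f⟩, rfl⟩
    obtain ⟨h', e⟩ := hd h f
    simp only [Submodule.comap_coe, Set.mem_preimage, map_sub, SetLike.mem_coe, e]
    exact Representation.Coinvariants.sub_mem_ker _ _))

@[simp]
theorem proj_coinvMap (d : Smooth S U ⟶ Smooth S' U') (hd) :
    proj S U ≫ coinvMap d hd = d ≫ proj S' U' := rfl

theorem coinvMap_comp (d : Smooth S U ⟶ Smooth S' U') (hd) (d' : Smooth S' U' ⟶ Smooth S'' U'')
    (hd') : coinvMap d hd ≫ coinvMap d' hd' = coinvMap (d ≫ d') (hd.comp hd') := by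
  rw [← cancel_epi (proj S U)]
  rfl

theorem coinvMap_id (hd) : coinvMap (𝟙 (Smooth S U)) hd = 𝟙 _ := by
  simp [← cancel_epi (proj S U)]

variable (S U) in
/-- The class of a constant function. -/
def cstCoinv : U ⟶ Coinv S U := cst S U ≫ proj S U

/-- All translates of a function have the same class, so the function `g ↦ [g f]` is constant. This
is used for the uniqueness half of the universal property. -/
theorem coact_map_proj (S : Grp IndProFin) (U : ModuleCat.{0} k) :
    coinvMap (coact S U) mapsOrbits_coact ≫ coinvMap (map S (proj S U)) (mapsOrbits_map _) =
      cstCoinv S (Coinv S U) := by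
  have : coact S U ≫ map S (proj S U) = proj S U ≫ cst S _ :=
    hom_ext fun x => by simp [reassoc_of% coact_eval x, cst_eval]
  rw [coinvMap_comp, ← cancel_epi (proj S U), proj_coinvMap, this]
  rfl

theorem cstCoinv_coinvMap_map (g : U ⟶ U') :
    cstCoinv S U ≫ coinvMap (map S g) (mapsOrbits_map _) = g ≫ cstCoinv S U' := rfl

end Smooth

end Smooth

section

variable {k : Type} [Field k]

/-- Vector spaces are projective: choose preimages of the images of a basis. -/
theorem ModuleCat.exists_lift {A B Q : ModuleCat.{0} k} (p : B ⟶ Q) (y : A ⟶ Q)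
    (h : ∀ a, ∃ b, p.hom b = y.hom a) : ∃ z : A ⟶ B, z ≫ p = y := by
  choose f hf using h
  let b := Module.Basis.ofVectorSpace k A
  refine ⟨ModuleCat.ofHom (b.constr k fun i => f (b i)), ModuleCat.hom_ext (b.ext fun i => ?_)⟩
  simp [hf]

end

namespace Smooth

/-! ### Exactness of coinvariants of smooth functions -/

section Exact

variable {k : Type} [Field k] {S : Grp IndProFin} {U U' : ModuleCat.{0} k}

/-- Used to restrict the target of a smooth function to a subspace containing its values. -/
theorem mem_smoothSubmodule_of_injective {g : U ⟶ U'} (hg : Function.Injective g.hom)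
    {f : S.X.Pt → U} (hf : (fun x => g.hom (f x)) ∈ smoothSubmodule S U') :
    f ∈ smoothSubmodule S U :=
  IsLocConst.of_injective (f := fun (h : S.X.Pt) (x : S.X.Pt) => f (x * h))
    (h := fun (r : S.X.Pt → U) (x : S.X.Pt) => g.hom (r x))
    (fun _ _ e => funext fun x => hg (congrFun e x)) hf

variable [CharZero k]

/-- The averaging lemma applies because the orbit maps of smooth functions are locally constant,
hence take finitely many values on the subgroups supplied by `exists_subgroup`. -/
theorem exists_proj_eq (hS : IsQuasiUnipotent S) (d : Smooth S U ⟶ Smooth S U')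
    (hd : ∀ h f, d.hom (transl S U h f) = transl S U' h (d.hom f)) (f : Smooth S U)
    (hf : (proj S U').hom (d.hom f) = 0) :
    ∃ f₀ : Smooth S U, (proj S U).hom f₀ = (proj S U).hom f ∧ d.hom f₀ = 0 := by
  obtain ⟨f₀, h, h'⟩ := Representation.exists_mem_coinvariantsKer (d := d.hom) hd (fun s => by
    obtain ⟨K, hs, hK⟩ := hS.exists_subgroup s
    exact ⟨K, hs, fun v => hK _ (isLocConst_transl v), fun v => hK _ (isLocConst_transl v)⟩)
    (proj_eq_zero_iff.1 hf)
  refine ⟨f₀, ?_, h'⟩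
  rw [← proj_eq_zero_iff, map_sub, sub_eq_zero] at h
  exact h.symm

/-- Averaging applied to the inclusion of the constants, with trivial action on the source: the
trivial representation equals its own coinvariants, and evaluation at `1` recovers a constant. -/
theorem cstCoinv_injective (hS : IsQuasiUnipotent S) : Function.Injective (cstCoinv S U).hom := by
  rw [← LinearMap.ker_eq_bot, LinearMap.ker_eq_bot']
  intro u hu
  obtain ⟨u₀, h, h'⟩ := Representation.exists_mem_coinvariantsKer
    (ρ := Representation.trivial k S.X.Pt U) (d := (cst S U).hom) (τ := transl S U)
    (fun h v => rfl) (fun s => by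
      obtain ⟨K, hs, hK⟩ := hS.exists_subgroup s
      exact ⟨K, hs, fun v => hK (fun _ => v) (isLocConst_const _ v),
        fun v => hK _ (isLocConst_transl v)⟩)
    (proj_eq_zero_iff.1 hu)
  have h₀ : u₀ = 0 := congrArg (fun f => (eval S U 1).hom f) h'
  have h₁ : Representation.Coinvariants.ker (Representation.trivial k S.X.Pt U) = ⊥ := by
    rw [Representation.Coinvariants.ker, Submodule.span_eq_bot]
    rintro _ ⟨⟨g, x⟩, rfl⟩
    simp
  rw [h₁, h₀] at h
  simpa using h

/-- By exactness the class `w` is represented by a function killed by the difference of the two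
induced maps; such a function takes its values in the equalizer of `g` and `g'`. -/
theorem exists_coinvMap_eq (hS : IsQuasiUnipotent S) (g g' : U ⟶ U') (w : Coinv S U)
    (h : (coinvMap (map S g) (mapsOrbits_map g)).hom w =
      (coinvMap (map S g') (mapsOrbits_map g')).hom w) :
    ∃ w₀ : Coinv S (ModuleCat.of k (LinearMap.eqLocus g.hom g'.hom)), (coinvMap (map S
      (ModuleCat.ofHom (LinearMap.eqLocus g.hom g'.hom).subtype)) (mapsOrbits_map _)).hom w₀ = w := by
  obtain ⟨f, rfl⟩ := proj_surjective w
  obtain ⟨f₀, h₁, h₂⟩ := exists_proj_eq hS (map S g - map S g') (fun h f => by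
    simp only [ModuleCat.hom_sub, LinearMap.sub_apply, map_sub]
    rfl) f (by
      simp only [ModuleCat.hom_sub, LinearMap.sub_apply, map_sub]
      exact sub_eq_zero.2 h)
  rw [← h₁]
  have h₃ : ∀ x, f₀.1 x ∈ LinearMap.eqLocus g.hom g'.hom := fun x => by
    have := congrArg (fun f => (eval S _ x).hom f) h₂
    exact sub_eq_zero.1 this
  refine ⟨(proj S _).hom ⟨fun x => ⟨f₀.1 x, h₃ x⟩, ?_⟩, rfl⟩
  exact mem_smoothSubmodule_of_injective (U' := U)
    (g := ModuleCat.ofHom (LinearMap.eqLocus g.hom g'.hom).subtype) Subtype.val_injective f₀.2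

/-- By exactness `w` is represented by a function on which the coaction agrees with `f ↦ (x ↦ const
(f x))`, i.e. `f (y x) = f x`. Putting `x = 1` shows that it is constant. -/
theorem exists_cstCoinv_eq (hS : IsQuasiUnipotent S) (w : Coinv S U)
    (h : (coinvMap (coact S U) mapsOrbits_coact).hom w =
      (coinvMap (map S (cst S U)) (mapsOrbits_map _)).hom w) : ∃ u, (cstCoinv S U).hom u = w := by
  obtain ⟨f, rfl⟩ := proj_surjective w
  obtain ⟨f₀, h₁, h₂⟩ := exists_proj_eq hS (coact S U - map S (cst S U)) (fun h f => by
    simp only [ModuleCat.hom_sub, LinearMap.sub_apply, map_sub]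
    congr 1
    exact Smooth.ext fun x => LinearMap.congr_fun (map_mul (transl S U) x h).symm f) f (by
      simp only [ModuleCat.hom_sub, LinearMap.sub_apply, map_sub]
      exact sub_eq_zero.2 h)
  rw [← h₁]
  refine ⟨f₀.1 1, congrArg (proj S U).hom (Smooth.ext fun x => ?_)⟩
  have := congrArg (fun F => (eval S U x).hom ((eval S _ 1).hom F)) h₂
  have h₃ : f₀.1 (x * 1) - f₀.1 1 = 0 := this
  rw [_root_.mul_one, sub_eq_zero] at h₃
  exact h₃.symm

end Exact

end Smooth

/-! ### The functor corepresented by the inflation -/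

namespace Inflation

open Smooth

variable {k : Type} [Field k] {L : Type} [SmallCategory L] {D : L ⥤ Grp IndProFin}
  (hD : ∀ l l' (f : l ⟶ l'), WeaklySurjective (D.map f).hom.hom)

/-- The transition map between the coinvariants of the spaces of smooth functions. -/
def tr (U : ModuleCat.{0} k) {l l' : L} (t : l' ⟶ l) : Coinv (D.obj l) U ⟶ Coinv (D.obj l') U :=
  coinvMap (pull U (D.map t)) (mapsOrbits_pull (hD _ _ t))

/-- Functoriality of the coinvariants of smooth functions. -/
abbrev cmap (l : L) {U U' : ModuleCat.{0} k} (g : U ⟶ U') : Coinv (D.obj l) U ⟶ Coinv (D.obj l) U' :=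
  coinvMap (map (D.obj l) g) (mapsOrbits_map g)

theorem coinvMap_congr {S S' : Grp IndProFin} {U U' : ModuleCat.{0} k}
    {d d' : Smooth S U ⟶ Smooth S' U'} (hd : MapsOrbits d) (hd' : MapsOrbits d') (h : d = d') :
    coinvMap d hd = coinvMap d' hd' := by
  subst h
  rfl

theorem pull_id (S : Grp IndProFin) (U : ModuleCat.{0} k) : pull U (𝟙 S) = 𝟙 _ :=
  hom_ext fun x => by
    rw [pull_eval, Category.id_comp]
    exact congrArg _ (Category.comp_id x)

theorem pull_pull {S S' S'' : Grp IndProFin} (U : ModuleCat.{0} k) (t : S' ⟶ S) (t' : S'' ⟶ S') :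
    pull U t ≫ pull U t' = pull U (t' ≫ t) :=
  hom_ext fun x => by
    rw [Category.assoc, pull_eval, pull_eval, pull_eval]
    exact congrArg _ (Category.assoc _ _ _)

theorem tr_id (U : ModuleCat.{0} k) (l : L) : tr hD U (𝟙 l) = 𝟙 _ := by
  rw [← coinvMap_id (fun h f => ⟨h, rfl⟩)]
  exact coinvMap_congr _ _ (by rw [D.map_id, pull_id])

theorem tr_tr (U : ModuleCat.{0} k) {l l' l'' : L} (t : l' ⟶ l) (t' : l'' ⟶ l') :
    tr hD U t ≫ tr hD U t' = tr hD U (t' ≫ t) := by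
  rw [tr, tr, coinvMap_comp]
  exact coinvMap_congr _ _ (by rw [D.map_comp, pull_pull])

theorem cmap_id (U : ModuleCat.{0} k) (l : L) : cmap (D := D) l (𝟙 U) = 𝟙 _ := by
  rw [← coinvMap_id (fun h f => ⟨h, rfl⟩)]
  exact coinvMap_congr _ _ rfl

theorem cmap_cmap {U U' U'' : ModuleCat.{0} k} (l : L) (g : U ⟶ U') (g' : U' ⟶ U'') :
    cmap (D := D) l g ≫ cmap l g' = cmap l (g ≫ g') := by
  rw [cmap, cmap, coinvMap_comp]
  exact coinvMap_congr _ _ rfl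

theorem cmap_tr {U U' : ModuleCat.{0} k} (g : U ⟶ U') {l l' : L} (t : l' ⟶ l) :
    cmap l g ≫ tr hD U' t = tr hD U t ≫ cmap l' g := by
  rw [cmap, cmap, tr, tr, coinvMap_comp, coinvMap_comp]
  exact coinvMap_congr _ _ rfl

variable (Y : ProVect k)

/-- The system of the sets of maps `Y → (Smooth S_l U)_{S_l}`. -/
def system : ModuleCat.{0} k ⥤ Lᵒᵖ ⥤ Type where
  obj U :=
    { obj := fun l => Y ⟶ Pro.const.obj (Coinv (D.obj l.unop) U)
      map := fun t => ↾fun y => y ≫ Pro.const.map (tr hD U t.unop)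
      map_id := fun l => by ext y; simp [tr_id]
      map_comp := fun t t' => by ext y; simp [← tr_tr] }
  map g :=
    { app := fun l => ↾fun y => y ≫ Pro.const.map (cmap l.unop g)
      naturality := fun l l' t => by
        ext y
        change (y ≫ _) ≫ _ = (y ≫ _) ≫ _
        simp only [Category.assoc, ← Functor.map_comp, cmap_tr] }
  map_id U := by ext l y; simp [cmap_id]
  map_comp g g' := by ext l y; simp [← cmap_cmap]

/-- The functor `U ↦ colim_l Hom(Y, (Smooth S_l U)_{S_l})`. -/
def functor : ModuleCat.{0} k ⥤ Type := system hD Y ⋙ colim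

variable {Y} {U U' : ModuleCat.{0} k}

/-- The element given by a map to the coinvariants. -/
def mk (l : L) (y : Y ⟶ Pro.const.obj (Coinv (D.obj l) U)) : (functor hD Y).obj U :=
  colimit.ι ((system hD Y).obj U) (.op l) y

theorem exists_mk (x : (functor hD Y).obj U) : ∃ l y, mk hD l y = x := by
  obtain ⟨l, y, h⟩ := Types.jointly_surjective' (F := (system hD Y).obj U) x
  exact ⟨l.unop, y, h⟩

theorem mk_tr {l l' : L} (t : l' ⟶ l) (y : Y ⟶ Pro.const.obj (Coinv (D.obj l) U)) :
    mk hD l' (y ≫ Pro.const.map (tr hD U t)) = mk hD l y :=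
  ConcreteCategory.congr_hom (colimit.w ((system hD Y).obj U) t.op) y

theorem map_mk (g : U ⟶ U') (l : L) (y : Y ⟶ Pro.const.obj (Coinv (D.obj l) U)) :
    (functor hD Y).map g (mk hD l y) = mk hD l (y ≫ Pro.const.map (cmap l g)) :=
  ConcreteCategory.congr_hom (ι_colimMap ((system hD Y).map g) (.op l)) y

theorem mk_eq_mk [IsCofiltered L] {l l' : L} {y : Y ⟶ Pro.const.obj (Coinv (D.obj l) U)}
    {y' : Y ⟶ Pro.const.obj (Coinv (D.obj l') U)} (h : mk hD l y = mk hD l' y') :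
    ∃ l'', ∃ (t : l'' ⟶ l) (t' : l'' ⟶ l'),
      y ≫ Pro.const.map (tr hD U t) = y' ≫ Pro.const.map (tr hD U t') := by
  obtain ⟨l'', t, t', h⟩ := (Types.FilteredColimit.colimit_eq_iff ((system hD Y).obj U)).1 h
  exact ⟨l''.unop, t.unop, t'.unop, h⟩

theorem mk_eq_mk_same [IsCofiltered L] {l : L} {y y' : Y ⟶ Pro.const.obj (Coinv (D.obj l) U)}
    (h : mk hD l y = mk hD l y') :
    ∃ l', ∃ t : l' ⟶ l, y ≫ Pro.const.map (tr hD U t) = y' ≫ Pro.const.map (tr hD U t) := by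
  obtain ⟨l', t, t', h⟩ := mk_eq_mk hD h
  obtain ⟨l'', s, e⟩ := IsCofilteredOrEmpty.cone_maps t t'
  refine ⟨l'', s ≫ t, ?_⟩
  have h' := congrArg (fun z => z ≫ Pro.const.map (tr hD U s)) h
  simp only [Category.assoc, ← Functor.map_comp, tr_tr] at h'
  rwa [← e] at h'

end Inflation

/-! ### Corepresentability of the inflation functor -/

namespace Inflation

open Smooth

variable {k : Type} [Field k] {L : Type} [SmallCategory L] {D : L ⥤ Grp IndProFin}
  (hD : ∀ l l' (f : l ⟶ l'), WeaklySurjective (D.map f).hom.hom) {Y : ProVect k}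

/-- The equality already holds on some vector space through which `y` factors. There exactness gives
pointwise preimages, and projectivity makes the choice linear. -/
theorem exists_lift_of_equalizer [CharZero k] {l : L} (hS : IsQuasiUnipotent (D.obj l))
    {U U' : ModuleCat.{0} k} (g g' : U ⟶ U') (y : Y ⟶ Pro.const.obj (Coinv (D.obj l) U))
    (h : y ≫ Pro.const.map (cmap l g) = y ≫ Pro.const.map (cmap l g')) :
    ∃ y₀ : Y ⟶ Pro.const.obj (Coinv (D.obj l) (ModuleCat.of k (LinearMap.eqLocus g.hom g'.hom))),
      y₀ ≫ Pro.const.map (cmap l (ModuleCat.ofHom (LinearMap.eqLocus g.hom g'.hom).subtype)) = y := by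
  obtain ⟨A, b, w, rfl, h'⟩ := Pro.const_eq y _ _ h
  obtain ⟨z, hz⟩ := ModuleCat.exists_lift (cmap l (ModuleCat.ofHom
    (LinearMap.eqLocus g.hom g'.hom).subtype)) w fun a =>
      exists_coinvMap_eq hS g g' _ (congrArg (fun m => m.hom a) h')
  exact ⟨b ≫ Pro.const.map z, by rw [Category.assoc, ← Functor.map_comp, hz]⟩

theorem exists_lift_cst [CharZero k] {l : L} (hS : IsQuasiUnipotent (D.obj l))
    {U : ModuleCat.{0} k} (y : Y ⟶ Pro.const.obj (Coinv (D.obj l) U))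
    (h : y ≫ Pro.const.map (coinvMap (coact _ U) mapsOrbits_coact) =
      y ≫ Pro.const.map (cmap l (cst _ U))) :
    ∃ z : Y ⟶ Pro.const.obj U, z ≫ Pro.const.map (cstCoinv _ U) = y := by
  obtain ⟨A, b, w, rfl, h'⟩ := Pro.const_eq y _ _ h
  obtain ⟨z, hz⟩ := ModuleCat.exists_lift (cstCoinv _ U) w fun a =>
      exists_cstCoinv_eq hS _ (congrArg (fun m => m.hom a) h')
  exact ⟨b ≫ Pro.const.map z, by rw [Category.assoc, ← Functor.map_comp, hz]⟩

variable (Y)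

theorem exists_element [IsCofiltered L] : ∃ U, Nonempty ((functor hD Y).obj U) := by
  obtain ⟨A⟩ := IsCofiltered.nonempty (C := StructuredArrow Y Pro.const)
  exact ⟨ModuleCat.of k k, ⟨mk hD IsCofiltered.nonempty.some (A.hom ≫ Pro.const.map 0)⟩⟩

theorem exists_pair [IsCofiltered L] (U₁ : ModuleCat.{0} k) (x₁ : (functor hD Y).obj U₁) (U₂)
    (x₂ : (functor hD Y).obj U₂) : ∃ U, ∃ x : (functor hD Y).obj U, ∃ (g₁ : U ⟶ U₁) (g₂ : U ⟶ U₂),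
      (functor hD Y).map g₁ x = x₁ ∧ (functor hD Y).map g₂ x = x₂ := by
  obtain ⟨l₁, y₁, rfl⟩ := exists_mk hD x₁
  obtain ⟨l₂, y₂, rfl⟩ := exists_mk hD x₂
  obtain ⟨l, t₁, t₂, -⟩ := IsCofilteredOrEmpty.cone_objs l₁ l₂
  rw [← mk_tr hD t₁, ← mk_tr hD t₂]
  obtain ⟨A, b, r₁, r₂, e₁, e₂⟩ := Pro.const_inf (y₁ ≫ Pro.const.map (tr hD U₁ t₁))
    (y₂ ≫ Pro.const.map (tr hD U₂ t₂))
  rw [← e₁, ← e₂]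
  -- With a common level `l` and a common source `A`, the pair is realised on `U₁ × U₂` by the sum
  -- of the two inclusions; `cmap` respects composition and sends zero to zero, so the projections
  -- recover `r₁` and `r₂`.
  let i₁ : U₁ ⟶ ModuleCat.of k (U₁ × U₂) := ModuleCat.ofHom (LinearMap.inl k U₁ U₂)
  let i₂ : U₂ ⟶ ModuleCat.of k (U₁ × U₂) := ModuleCat.ofHom (LinearMap.inr k U₁ U₂)
  let p₁ : ModuleCat.of k (U₁ × U₂) ⟶ U₁ := ModuleCat.ofHom (LinearMap.fst k U₁ U₂)
  let p₂ : ModuleCat.of k (U₁ × U₂) ⟶ U₂ := ModuleCat.ofHom (LinearMap.snd k U₁ U₂)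
  have h0 (V V' : ModuleCat.{0} k) : cmap (D := D) l (0 : V ⟶ V') = 0 := by
    rw [← cancel_epi (proj _ _), proj_coinvMap, comp_zero]
    have : map (D.obj l) (0 : V ⟶ V') = 0 := rfl
    rw [this, zero_comp]
  refine ⟨ModuleCat.of k (U₁ × U₂), mk hD l (b ≫ Pro.const.map (r₁ ≫ cmap l i₁ + r₂ ≫ cmap l i₂)),
    p₁, p₂, ?_, ?_⟩
  · rw [map_mk, Category.assoc, ← Functor.map_comp, Preadditive.add_comp, Category.assoc,
      Category.assoc, cmap_cmap, cmap_cmap, show i₁ ≫ p₁ = 𝟙 _ from rfl,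
      show i₂ ≫ p₁ = 0 from rfl, cmap_id, h0, Category.comp_id, comp_zero, add_zero]
  · rw [map_mk, Category.assoc, ← Functor.map_comp, Preadditive.add_comp, Category.assoc,
      Category.assoc, cmap_cmap, cmap_cmap, show i₁ ≫ p₂ = 0 from rfl,
      show i₂ ≫ p₂ = 𝟙 _ from rfl, cmap_id, h0, Category.comp_id, comp_zero, zero_add]

theorem exists_equalizer [IsCofiltered L] [CharZero k] (hS : ∀ l, IsQuasiUnipotent (D.obj l))
    (U U' : ModuleCat.{0} k) (x : (functor hD Y).obj U) (g g' : U ⟶ U')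
    (h : (functor hD Y).map g x = (functor hD Y).map g' x) :
    ∃ U₀, ∃ x₀ : (functor hD Y).obj U₀, ∃ f : U₀ ⟶ U,
      (functor hD Y).map f x₀ = x ∧ f ≫ g = f ≫ g' := by
  obtain ⟨l, y, rfl⟩ := exists_mk hD x
  rw [map_mk, map_mk] at h
  obtain ⟨l', t, h⟩ := mk_eq_mk_same hD h
  simp only [Category.assoc, ← Functor.map_comp, cmap_tr] at h
  simp only [Functor.map_comp] at h
  rw [← Category.assoc, ← Category.assoc] at h
  obtain ⟨y₀, h₀⟩ := exists_lift_of_equalizer (hS l') g g' _ h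
  refine ⟨_, mk hD l' y₀, ModuleCat.ofHom (LinearMap.eqLocus g.hom g'.hom).subtype, ?_, ?_⟩
  · rw [map_mk, h₀, mk_tr]
  · ext a
    exact a.2

/-- An element lifts to a map from some `A i` to smooth functions. Only the span of the values of
these functions matters, and it is a quotient of the free module on `A i × (D.obj l).X.Pt`, so these
quotients form a small family. -/
theorem exists_small_family : ∃ (I : Type) (U₀ : I → ModuleCat.{0} k)
    (x₀ : ∀ i, (functor hD Y).obj (U₀ i)), ∀ U (x : (functor hD Y).obj U),
      ∃ i, ∃ g : U₀ i ⟶ U, (functor hD Y).map g (x₀ i) = x := by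
  obtain ⟨I, A, b, hI⟩ := Pro.exists_small_family Y
  let M (l : L) (i : I) (K : Submodule k (A i × (D.obj l).X.Pt →₀ k)) : ModuleCat.{0} k :=
    ModuleCat.of k ((A i × (D.obj l).X.Pt →₀ k) ⧸ K)
  refine ⟨Σ (l : L) (i : I) (K : Submodule k (A i × (D.obj l).X.Pt →₀ k)),
    (functor hD Y).obj (M l i K), fun j => M j.1 j.2.1 j.2.2.1, fun j => j.2.2.2, fun U x => ?_⟩
  obtain ⟨l, y, rfl⟩ := exists_mk hD x
  obtain ⟨i, w, rfl⟩ := hI _ y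
  obtain ⟨z, rfl⟩ := ModuleCat.exists_lift (proj (D.obj l) U) w fun a => proj_surjective _
  -- The image of `q` is the span in `U` of all values `z a x`; the quotient by the kernel replaces
  -- that subspace by a member of the small family.
  let q : (A i × (D.obj l).X.Pt →₀ k) →ₗ[k] U :=
    Finsupp.linearCombination k fun a => (z.hom a.1 : smoothSubmodule (D.obj l) U) a.2
  let q' : M l i (LinearMap.ker q) ⟶ U := ModuleCat.ofHom ((LinearMap.ker q).liftQ q le_rfl)
  have hq' : Function.Injective q'.hom := by
    rw [← LinearMap.ker_eq_bot]
    exact Submodule.ker_liftQ_eq_bot _ _ _ le_rfl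
  obtain ⟨z', hz'⟩ := ModuleCat.exists_lift (map (D.obj l) q') z fun a => by
    have h (x) : q'.hom ((LinearMap.ker q).mkQ (Finsupp.single (a, x) 1)) =
        (z.hom a : smoothSubmodule (D.obj l) U) x := by
      change q (Finsupp.single (a, x) 1) = _
      simp [q]
    refine ⟨⟨fun x => (LinearMap.ker q).mkQ (Finsupp.single (a, x) 1), ?_⟩,
      Smooth.ext fun x => h x⟩
    refine mem_smoothSubmodule_of_injective hq' ?_
    convert (z.hom a : smoothSubmodule (D.obj l) U).2 using 2
    exact h _
  refine ⟨⟨l, i, _, mk hD l (b i ≫ Pro.const.map (z' ≫ proj _ _))⟩, q', ?_⟩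
  rw [map_mk, Category.assoc, ← Functor.map_comp, Category.assoc, proj_coinvMap,
    reassoc_of% hz']

theorem exists_corepresentation [IsCofiltered L] [CharZero k] (hS : ∀ l, IsQuasiUnipotent (D.obj l)) :
    ∃ (I : ProVect k) (e : ∀ U, (I ⟶ Pro.const.obj U) ≃ (functor hD Y).obj U),
      ∀ U U' (q : I ⟶ Pro.const.obj U) (g : U ⟶ U'),
        e _ (q ≫ Pro.const.map g) = (functor hD Y).map g (e _ q) :=
  Pro.exists_corepresentation _ (exists_element hD Y) (exists_pair hD Y)
    (exists_equalizer hD Y hS) (exists_small_family hD Y)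

end Inflation

/-! ### Action maps on a cofiltered limit -/

namespace Act₀

open Functor

variable {k : Type} [Field k] {V : ProVect k} {U W W' : ModuleCat.{0} k}

/-- A common refinement witnessing equality after `g` witnesses it before `g`, since the families
are compared point by point. -/
theorem change_injective {T : ProIndProFin} (g : W ⟶ W') [Mono g] {α β : Act₀ T V W}
    (h : α.change (𝟙 T) (𝟙 V) g = β.change (𝟙 T) (𝟙 V) g) : α = β := by
  induction α using ind with
  | h S a X b φ =>
  induction β using ind with
  | h S' a' X' b' φ' =>
  rw [change_mk, change_mk] at h
  obtain ⟨R, c, Z, d, s₁, s₂, f₁, f₂, e₁, e₂, e₃, e₄, e⟩ := exists_common_refinement h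
  simp only [Category.id_comp] at e₁ e₂ e₃ e₄
  trans mk R c Z d (φ.change s₁ f₁ (𝟙 W))
  · exact (sound s₁ f₁ e₁ e₃ (by simp)).symm
  · refine sound s₂ f₂ e₂ e₄ fun x => ?_
    rw [← cancel_mono g]
    simpa using e x

theorem ofHom_unit_injective {f f' : V ⟶ Pro.const.obj W}
    (h : ofHom (𝟙_ ProIndProFin) f = ofHom (𝟙_ ProIndProFin) f') : f = f' := by
  obtain ⟨R, c, Z, d, s₁, s₂, f₁, f₂, e₁, e₂, e₃, e₄, e⟩ := exists_common_refinement h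
  -- The comparison `e` is indexed by points of `R`, so it says something only if `R` has one; the
  -- map `c` from the unit provides it.
  obtain ⟨x, -⟩ := Pro.const.map_surjective (OplaxMonoidal.η Pro.const ≫ c)
  have := e (toUnit _ ≫ x)
  dsimp only [LinFamily.ofHom_toFun] at this e₃ e₄
  rw [Category.comp_id, Category.comp_id] at this
  rw [← e₃, ← e₄, this]

section Limit

variable {L : Type} [SmallCategory L] {K : L ⥤ IndProFin} {c : Cone (K ⋙ Pro.const)}

theorem mk_precomp {T : ProIndProFin} {S S' : IndProFin} (a : T ⟶ Pro.const.obj S) (s : S ⟶ S')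
    {X : ModuleCat.{0} k} (b : V ⟶ Pro.const.obj X) (φ : LinFamily S' X W) :
    mk S' (a ≫ Pro.const.map s) X b φ = mk S a X b (φ.change s (𝟙 X) (𝟙 W)) :=
  (sound s (𝟙 X) rfl (by simp) (by simp)).symm

theorem mk_postcomp {T : ProIndProFin} {S : IndProFin} (a : T ⟶ Pro.const.obj S)
    {X X' : ModuleCat.{0} k} (b : V ⟶ Pro.const.obj X) (f : X ⟶ X') (φ : LinFamily S X' W) :
    mk S a X' (b ≫ Pro.const.map f) φ = mk S a X b (φ.change (𝟙 S) f (𝟙 W)) :=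
  (sound (𝟙 S) f (by simp) rfl (by simp)).symm

theorem _root_.CategoryTheory.Limits.Cone.w_const {l l' : L} (t : l' ⟶ l) :
    c.π.app l' ≫ Pro.const.map (K.map t) = c.π.app l := c.w t

variable [IsCofiltered L] (hc : IsLimit c) in
include hc in
theorem exists_rep (α : Act₀ c.pt V W) : ∃ l, ∃ (X : ModuleCat.{0} k) (b : V ⟶ Pro.const.obj X)
    (φ : LinFamily (K.obj l) X W), α = mk (K.obj l) (c.π.app l) X b φ := by
  induction α using ind with
  | h S a X b φ =>
    obtain ⟨l, g, rfl⟩ := Pro.exists_factor_const hc a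
    exact ⟨l, X, b, φ.change g (𝟙 X) (𝟙 W), mk_precomp _ _ _ _⟩

variable [IsCofiltered L] (hc : IsLimit c) in
include hc in
theorem exists_refinement {l : L} {X X' : ModuleCat.{0} k} {b : V ⟶ Pro.const.obj X}
    {b' : V ⟶ Pro.const.obj X'} {φ : LinFamily (K.obj l) X W} {φ' : LinFamily (K.obj l) X' W}
    (h : mk (K.obj l) (c.π.app l) X b φ = mk (K.obj l) (c.π.app l) X' b' φ') :
    ∃ (l' : L) (t : l' ⟶ l) (Z : ModuleCat.{0} k) (d : V ⟶ Pro.const.obj Z) (f : Z ⟶ X)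
      (f' : Z ⟶ X'), d ≫ Pro.const.map f = b ∧ d ≫ Pro.const.map f' = b' ∧
      ∀ x, f ≫ φ.toFun (x ≫ K.map t) = f' ≫ φ'.toFun (x ≫ K.map t) := by
  obtain ⟨R, a, Z, d, s₁, s₂, f₁, f₂, e₁, e₂, e₃, e₄, e⟩ := exists_common_refinement h
  obtain ⟨l₁, g, rfl⟩ := Pro.exists_factor_const hc a
  obtain ⟨l₂, t, t₁, -⟩ := IsCofilteredOrEmpty.cone_objs l l₁
  -- Both `s₁` and `s₂` become the projection to level `l` on the limit. Far enough along the system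
  -- they therefore coincide with the transition map, and `e` can be read at that level.
  have key : ∀ s : R ⟶ K.obj l, (c.π.app l₁ ≫ Pro.const.map g) ≫ Pro.const.map s = c.π.app l →
      c.π.app l₂ ≫ Pro.const.map (K.map t₁ ≫ g ≫ s) = c.π.app l₂ ≫ Pro.const.map (K.map t) := by
    intro s hs
    rw [c.w_const t, Functor.map_comp, Functor.map_comp, ← Category.assoc, c.w_const t₁, ← hs,
      Category.assoc]
  obtain ⟨l₃, r, hr⟩ := Pro.exists_eq_const hc _ _ (key s₁ e₁)
  obtain ⟨l₄, r', hr'⟩ := Pro.exists_eq_const hc _ _ (key s₂ e₂)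
  obtain ⟨l₅, q, q', hq⟩ := IsCofiltered.cospan r r'
  refine ⟨l₅, q ≫ r ≫ t, Z, d, f₁, f₂, e₃, e₄, fun x => ?_⟩
  have h₁ : K.map (q ≫ r ≫ t) = K.map (q ≫ r ≫ t₁) ≫ g ≫ s₁ := by
    simp only [Functor.map_comp, Category.assoc, hr]
  have h₂ : K.map (q ≫ r ≫ t) = K.map (q ≫ r ≫ t₁) ≫ g ≫ s₂ := by
    rw [← Category.assoc, hq, Category.assoc, ← Category.assoc q, hq, Category.assoc]
    simp only [Functor.map_comp, Category.assoc, hr']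
  have := e (x ≫ K.map (q ≫ r ≫ t₁) ≫ g)
  simp only [Category.assoc, ← h₁, ← h₂] at this
  exact this

theorem constLift_map {T : ProIndProFin} {S S' R R' : IndProFin} (a : T ⟶ Pro.const.obj S)
    (a' : T ⟶ Pro.const.obj S') (s : S ⟶ R) (s' : S' ⟶ R') :
    constLift a a' ≫ Pro.const.map (s ⊗ₘ s') =
      constLift (a ≫ Pro.const.map s) (a' ≫ Pro.const.map s') := by
  rw [MonoidalCategory.tensorHom_def, Functor.map_comp, ← Category.assoc, constLift_whiskerRight,
    constLift_whiskerLeft]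

variable (K) in
/-- The system of squares. -/
abbrev squareFunctor : L ⥤ IndProFin where
  obj l := K.obj l ⊗ K.obj l
  map t := K.map t ⊗ₘ K.map t

variable (c) in
/-- The square of a cone. -/
def squareCone : Cone (squareFunctor K ⋙ Pro.const) where
  pt := c.pt ⊗ c.pt
  π :=
    { app := fun l => constLift (fst _ _ ≫ c.π.app l) (snd _ _ ≫ c.π.app l)
      naturality := fun l l' t => by
        refine (Category.id_comp _).trans (Eq.symm ((constLift_map _ _ _ _).trans ?_))
        rw [Category.assoc, Category.assoc, c.w_const] }

/-- The square of a cofiltered limit. -/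
def isLimitSquareCone (hc : IsLimit c) : IsLimit (squareCone c) := by
  refine IsLimit.ofExistsUnique fun s => ?_
  let p₁ (l : L) : s.pt ⟶ Pro.const.obj (K.obj l) := s.π.app l ≫ Pro.const.map (fst (K.obj l) (K.obj l))
  let p₂ (l : L) : s.pt ⟶ Pro.const.obj (K.obj l) := s.π.app l ≫ Pro.const.map (snd (K.obj l) (K.obj l))
  have w {l l' : L} (t : l ⟶ l') : s.π.app l ≫ Pro.const.map (K.map t ⊗ₘ K.map t) = s.π.app l' := s.w t
  let s₁ : Cone (K ⋙ Pro.const) := ⟨s.pt, ⟨p₁, fun l l' t => by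
    refine (Category.id_comp _).trans ?_
    simp only [p₁]
    rw [← w t, Category.assoc, ← Functor.map_comp, tensorHom_fst, Functor.map_comp, Category.assoc]
    rfl⟩⟩
  let s₂ : Cone (K ⋙ Pro.const) := ⟨s.pt, ⟨p₂, fun l l' t => by
    refine (Category.id_comp _).trans ?_
    simp only [p₂]
    rw [← w t, Category.assoc, ← Functor.map_comp, tensorHom_snd, Functor.map_comp, Category.assoc]
    rfl⟩⟩
  refine ⟨lift (hc.lift s₁) (hc.lift s₂), fun l => ?_, fun m hm => ?_⟩
  · change lift _ _ ≫ constLift _ _ = _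
    rw [comp_constLift]
    apply const_hom_ext
    · rw [constLift_fst, lift_fst_assoc, hc.fac]
    · rw [constLift_snd, lift_snd_assoc, hc.fac]
  · change s.pt ⟶ c.pt ⊗ c.pt at m
    have hm' (l : L) : m ≫ constLift (fst _ _ ≫ c.π.app l) (snd _ _ ≫ c.π.app l) = s.π.app l := hm l
    apply CartesianMonoidalCategory.hom_ext
    · rw [lift_fst]
      refine hc.hom_ext fun l => ?_
      rw [hc.fac]
      change _ = s.π.app l ≫ _
      rw [← hm' l, Category.assoc, Category.assoc, constLift_fst]
    · rw [lift_snd]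
      refine hc.hom_ext fun l => ?_
      rw [hc.fac]
      change _ = s.π.app l ≫ _
      rw [← hm' l, Category.assoc, Category.assoc, constLift_snd]

end Limit

end Act₀

theorem LinFamily.change_id {k : Type} [Field k] {S : IndProFin} {V W : ModuleCat.{0} k}
    (φ : LinFamily S V W) : φ.change (𝟙 S) (𝟙 V) (𝟙 W) = φ :=
  LinFamily.ext (funext fun x => by simp)

/-! ### Maps from representations to spaces of smooth functions -/

namespace ProRep

open Functor Smooth

variable {k : Type} [Field k] {H : Grp ProIndProFin} {L : Type} [SmallCategory L]
  {D : L ⥤ Grp IndProFin} (π : (Functor.const L).obj H ⟶ D ⋙ Pro.const.mapGrp)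

/-- The projection of the underlying objects. -/
def pr (l : L) : H.X ⟶ Pro.const.obj (D.obj l).X := (π.app l).hom.hom

theorem pr_map {l l' : L} (t : l' ⟶ l) : pr π l' ≫ Pro.const.map (D.map t).hom.hom = pr π l :=
  (congrArg (fun m => m.hom.hom) (π.naturality t)).symm.trans (Category.id_comp _)

theorem one_pr (l : L) : η[H.X] ≫ pr π l = LaxMonoidal.ε Pro.const ≫ Pro.const.map η[(D.obj l).X] :=
  IsMonHom.one_hom (π.app l).hom.hom

theorem mul_pr (l : L) : μ[H.X] ≫ pr π l =
    Act₀.constLift (fst _ _ ≫ pr π l) (snd _ _ ≫ pr π l) ≫ Pro.const.map μ[(D.obj l).X] := by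
  refine (IsMonHom.mul_hom (π.app l).hom.hom).trans ?_
  change (pr π l ⊗ₘ pr π l) ≫ LaxMonoidal.μ Pro.const _ _ ≫ Pro.const.map _ = _
  rw [Act₀.constLift, Category.assoc, lift_fst_comp_snd_comp]

/-- The cone of the underlying objects. -/
def baseCone : Cone ((D ⋙ Grp.forget IndProFin) ⋙ Pro.const) :=
  ⟨H.X, { app := fun l => pr π l, naturality := fun _ _ t => (Category.id_comp _).trans (pr_map π t).symm }⟩

variable {π} (hπ : IsLimit (baseCone π))

theorem pull_toFun {V : ProVect k} {W : ModuleCat.{0} k} {l l' : L} (t : l' ⟶ l) {X : ModuleCat.{0} k} (b : V ⟶ Pro.const.obj X)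
    (φ : LinFamily (D.obj l).X X W) : Act₀.mk (D.obj l).X (pr π l) X b φ =
      Act₀.mk (D.obj l').X (pr π l') X b (φ.change (D.map t).hom.hom (𝟙 X) (𝟙 W)) := by
  rw [← pr_map π t]
  exact Act₀.mk_precomp _ _ _ _

variable [IsCofiltered L] in
include hπ in
theorem exists_rep {V : ProVect k} {W : ModuleCat.{0} k} (α : Act₀ H.X V W) :
    ∃ l, ∃ (X : ModuleCat.{0} k) (b : V ⟶ Pro.const.obj X) (φ : LinFamily (D.obj l).X X W),
      α = Act₀.mk (D.obj l).X (pr π l) X b φ :=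
  Act₀.exists_rep hπ α

variable [IsCofiltered L] in
include hπ in
theorem exists_refinement {V : ProVect k} {W : ModuleCat.{0} k} {l : L} {X X' : ModuleCat.{0} k}
    {b : V ⟶ Pro.const.obj X} {b' : V ⟶ Pro.const.obj X'} {φ : LinFamily (D.obj l).X X W}
    {φ' : LinFamily (D.obj l).X X' W} (h : Act₀.mk (D.obj l).X (pr π l) X b φ =
      Act₀.mk (D.obj l).X (pr π l) X' b' φ') :
    ∃ (l' : L) (t : l' ⟶ l) (Z : ModuleCat.{0} k) (d : V ⟶ Pro.const.obj Z) (f : Z ⟶ X)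
      (f' : Z ⟶ X'), d ≫ Pro.const.map f = b ∧ d ≫ Pro.const.map f' = b' ∧
      ∀ x, f ≫ φ.toFun (x ≫ (D.map t).hom.hom) = f' ≫ φ'.toFun (x ≫ (D.map t).hom.hom) :=
  Act₀.exists_refinement hπ h

variable [IsCofiltered L] in
include hπ in
-- Associativity of a representation is an identity over `H × H`, which is the limit of the squares
-- of the `D.obj l`; the general refinement statement is applied to that limit.
theorem exists_refinement_mul {V : ProVect k} {W : ModuleCat.{0} k} {l : L} {X X' : ModuleCat.{0} k}
    {b : V ⟶ Pro.const.obj X} {b' : V ⟶ Pro.const.obj X'} {φ : LinFamily ((D.obj l).X ⊗ (D.obj l).X) X W}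
    {φ' : LinFamily ((D.obj l).X ⊗ (D.obj l).X) X' W}
    (h : Act₀.mk _ (Act₀.constLift (fst _ _ ≫ pr π l) (snd _ _ ≫ pr π l)) X b φ =
      Act₀.mk _ (Act₀.constLift (fst _ _ ≫ pr π l) (snd _ _ ≫ pr π l)) X' b' φ') :
    ∃ (l' : L) (t : l' ⟶ l) (Z : ModuleCat.{0} k) (d : V ⟶ Pro.const.obj Z) (f : Z ⟶ X)
      (f' : Z ⟶ X'), d ≫ Pro.const.map f = b ∧ d ≫ Pro.const.map f' = b' ∧
      ∀ x y : (D.obj l').X.Pt,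
        f ≫ φ.toFun (lift (x ≫ (D.map t).hom.hom) (y ≫ (D.map t).hom.hom)) =
        f' ≫ φ'.toFun (lift (x ≫ (D.map t).hom.hom) (y ≫ (D.map t).hom.hom)) := by
  obtain ⟨l', t, Z, d, f, f', e, e', i⟩ := Act₀.exists_refinement (Act₀.isLimitSquareCone hπ) h
  refine ⟨l', t, Z, d, f, f', e, e', fun x y => ?_⟩
  have := i (lift x y)
  change f ≫ φ.toFun (lift x y ≫ ((D.map t).hom.hom ⊗ₘ (D.map t).hom.hom)) =
    f' ≫ φ'.toFun (lift x y ≫ ((D.map t).hom.hom ⊗ₘ (D.map t).hom.hom)) at this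
  rwa [lift_map] at this

variable (V : ProRep k H) {U U' : ModuleCat.{0} k}

variable (π) in
/-- An equivariant map `b` from `V` to the space of smooth functions on the group with values in
`U` whose composition with the evaluation at the unit is `ψ`. -/
structure IsCoind (l : L) (b : V.V ⟶ Pro.const.obj (Smooth (D.obj l) U)) (ψ : V.V ⟶ Pro.const.obj U) :
    Prop where
  equivariant : V.ρ.toFun _ b = Act₀.mk (D.obj l).X (pr π l) _ b (act (D.obj l) U)
  eval_one : b ≫ Pro.const.map (Smooth.eval (D.obj l) U 1) = ψ

namespace IsCoind

variable {V} {l : L} {b : V.V ⟶ Pro.const.obj (Smooth (D.obj l) U)} {ψ : V.V ⟶ Pro.const.obj U}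

/-- Equivariance forces `b(v)(h) = ψ(h v)`: evaluate the translate of `b(v)` by `h` at `1`. -/
theorem toFun_eq (h : IsCoind π V l b ψ) :
    V.ρ.toFun U ψ = Act₀.mk (D.obj l).X (pr π l) _ b (ev (D.obj l) U) := by
  rw [← h.eval_one, V.ρ.naturality, h.equivariant, Act₀.change_mk]
  refine Act₀.sound (𝟙 _) (𝟙 _) (by simp) (by simp) fun x => ?_
  simp [ofHom_transl_eval]

theorem toFun_comp (h : IsCoind π V l b ψ) {W : ModuleCat.{0} k} (g : Smooth (D.obj l) U ⟶ W) :
    V.ρ.toFun _ (b ≫ Pro.const.map g) = Act₀.mk (D.obj l).X (pr π l) _ b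
      ((act (D.obj l) U).change (𝟙 _) (𝟙 _) g) := by
  rw [V.ρ.naturality, h.equivariant, Act₀.change_mk]
  simp

/-- The common form of change of level and change of `U`: `g` has to be equivariant along the
transition map `t` and compatible with evaluation at `1`. -/
theorem postcomp (h : IsCoind π V l b ψ) {l' : L} {g : Smooth (D.obj l) U ⟶ Smooth (D.obj l') U'}
    {g₀ : U ⟶ U'} (t : l' ⟶ l)
    (hg : ∀ x, ModuleCat.ofHom (transl (D.obj l) U (x ≫ (D.map t).hom.hom)) ≫ g =
      g ≫ ModuleCat.ofHom (transl (D.obj l') U' x))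
    (hg₀ : g ≫ Smooth.eval _ _ 1 = Smooth.eval _ _ 1 ≫ g₀) :
    IsCoind π V l' (b ≫ Pro.const.map g) (ψ ≫ Pro.const.map g₀) where
  equivariant := by
    rw [h.toFun_comp, pull_toFun t]
    refine Act₀.sound (𝟙 _) g (by simp) rfl fun x => ?_
    simpa using hg x
  eval_one := by
    rw [Category.assoc, ← Functor.map_comp, hg₀, Functor.map_comp, ← Category.assoc, h.eval_one]

theorem pull (h : IsCoind π V l b ψ) {l' : L} (t : l' ⟶ l) :
    IsCoind π V l' (b ≫ Pro.const.map (pull U (D.map t))) ψ := by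
  have := h.postcomp (g := Smooth.pull U (D.map t)) (g₀ := 𝟙 U) t
    (fun x => ModuleCat.hom_ext (LinearMap.ext fun f => (transl_pull _ _ _).symm)) (by
      rw [pull_eval, Category.comp_id]
      exact congrArg _ (MonObj.one_comp (D.map t).hom.hom))
  simpa using this

theorem comp_map (h : IsCoind π V l b ψ) (g : U ⟶ U') :
    IsCoind π V l (b ≫ Pro.const.map (map _ g)) (ψ ≫ Pro.const.map g) :=
  h.postcomp (𝟙 l) (fun x => by
    have : x ≫ (D.map (𝟙 l)).hom.hom = x := by rw [D.map_id]; exact Category.comp_id x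
    rw [this]
    rfl) (by simp)

theorem precomp (h : IsCoind π V l b ψ) {V' : ProRep k H} (f : V' ⟶ V) :
    IsCoind π V' l (f.hom ≫ b) (f.hom ≫ ψ) where
  equivariant := by
    have e := congrFun (congrFun (congrArg Act.toFun f.comm) _) b
    simp only [Act.change_toFun, Category.id_comp, Act₀.change_id, h.equivariant, Act₀.change_mk] at e
    rw [e]
    exact Act₀.sound (𝟙 _) (𝟙 _) (by simp) (by simp) (by simp)
  eval_one := by rw [Category.assoc, h.eval_one]

theorem invariant (h : IsCoind π V l b ψ) :
    V.ρ.toFun _ (b ≫ Pro.const.map (proj _ _)) = Act₀.ofHom H.X (b ≫ Pro.const.map (proj _ _)) := by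
  rw [h.toFun_comp, ← Act₀.mk_ofHom (D.obj l).X (pr π l) _ b (proj _ _)]
  exact Act₀.sound (𝟙 _) (𝟙 _) (by simp) (by simp) (by simp)

theorem of_invariant (l : L) (h : V.ρ.toFun U ψ = Act₀.ofHom H.X ψ) :
    IsCoind π V l (ψ ≫ Pro.const.map (cst _ U)) ψ where
  equivariant := by
    rw [V.ρ.naturality, h, Act₀.change_ofHom, Category.id_comp,
      ← Act₀.mk_ofHom (D.obj l).X (pr π l) _ ψ (cst _ U)]
    exact Act₀.sound (𝟙 _) (cst _ U) (by simp) (by simp) fun x => rfl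
  eval_one := by rw [Category.assoc, ← Functor.map_comp, cst_eval]; simp

variable [IsCofiltered L] in
include hπ in
-- By `toFun_eq` both `b` and `b'` are given by `v ↦ (h ↦ ψ(h v))`. Equality of these action maps is
-- witnessed at a finer level, where smooth functions are compared by their values.
theorem unique (h : IsCoind π V l b ψ) {l' : L} {b' : V.V ⟶ Pro.const.obj (Smooth (D.obj l') U)}
    (h' : IsCoind π V l' b' ψ) : ∃ l'', ∃ (t : l'' ⟶ l) (t' : l'' ⟶ l'),
      b ≫ Pro.const.map (Smooth.pull U (D.map t)) = b' ≫ Pro.const.map (Smooth.pull U (D.map t')) := by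
  obtain ⟨l₁, t, t', -⟩ := IsCofilteredOrEmpty.cone_objs l l'
  obtain ⟨l₂, r, Z, d, f, f', e, e', i⟩ :=
    exists_refinement hπ ((h.pull t).toFun_eq.symm.trans (h'.pull t').toFun_eq)
  refine ⟨l₂, r ≫ t, r ≫ t', ?_⟩
  rw [D.map_comp, D.map_comp, ← Inflation.pull_pull, ← Inflation.pull_pull, Functor.map_comp,
    Functor.map_comp, ← Category.assoc, ← Category.assoc, ← e, ← e', Category.assoc, Category.assoc,
    ← Functor.map_comp, ← Functor.map_comp]
  congr 2
  exact hom_ext i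

end IsCoind

variable [IsCofiltered L] in
include hπ in
-- The map is `v ↦ (x ↦ ψ(x v))`. Let `φ` represent `ψ(x v)` and `φ'` represent the action followed
-- by the map `b` on which `φ` is defined. Associativity gives `φ(x y, v) = φ(x, φ'(y, v))` at a
-- finer level; thus the translate by `y` depends only on `φ'(y, v)`, which is locally constant in
-- `y`, and the function is smooth.
theorem exists_isCoind (ψ : V.V ⟶ Pro.const.obj U) :
    ∃ (l : L) (b : V.V ⟶ Pro.const.obj (Smooth (D.obj l) U)), IsCoind π V l b ψ := by
  obtain ⟨l₁, X, b, φ, h⟩ := exists_rep hπ (V.ρ.toFun U ψ)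
  obtain ⟨l₂, X', b', φ', h'⟩ := exists_rep hπ (V.ρ.toFun X b)
  obtain ⟨l, t₁, t₂, -⟩ := IsCofilteredOrEmpty.cone_objs l₁ l₂
  rw [pull_toFun t₁] at h
  rw [pull_toFun t₂] at h'
  generalize φ.change (D.map t₁).hom.hom (𝟙 X) (𝟙 U) = φ at h
  generalize φ'.change (D.map t₂).hom.hom (𝟙 X') (𝟙 X) = φ' at h'
  have key := congrFun (congrFun (congrArg Act.toFun V.mul_act) U) ψ
  have key' : Act₀.mk _ (Act₀.constLift (fst _ _ ≫ pr π l) (snd _ _ ≫ pr π l)) X b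
      (φ.change μ[(D.obj l).X] (𝟙 X) (𝟙 U)) =
      Act₀.mk _ (Act₀.constLift (fst _ _ ≫ pr π l) (snd _ _ ≫ pr π l)) X' b'
        ((φ.change (fst _ _) (𝟙 _) (𝟙 _)).comp (φ'.change (snd _ _) (𝟙 _) (𝟙 _))) := by
    simp only [Act.change_toFun, Category.id_comp, h, Act₀.change_mk, mul_pr, Act.comp,
      Act.comp₀_mk, h', Act₀.compRep_mk] at key
    rwa [Act₀.mk_precomp, LinFamily.change_id, LinFamily.change_id] at key
  obtain ⟨l', t, Z, d, f, f', rfl, rfl, i⟩ := exists_refinement_mul hπ key'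
  have i' : ∀ x y : (D.obj l').X.Pt, f ≫ φ.toFun ((x * y) ≫ (D.map t).hom.hom) =
      f' ≫ φ'.toFun (y ≫ (D.map t).hom.hom) ≫ φ.toFun (x ≫ (D.map t).hom.hom) := fun x y => by
    have := i x y
    simp only [LinFamily.change_toFun, LinFamily.comp_toFun, Category.id_comp, Category.comp_id,
      lift_fst, lift_snd] at this
    rw [← this, mul_comp_hom]
    rfl
  let F : Z ⟶ Smooth (D.obj l') U := Smooth.lift (fun x => f ≫ φ.toFun (x ≫ (D.map t).hom.hom))
    fun v => by
      convert ((show IsLocConst _ from φ'.locConst (f'.hom v)).comp (D.map t).hom.hom).map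
        fun w (g : (D.obj l').X.Pt) => (φ.toFun (g ≫ (D.map t).hom.hom)).hom w using 3 with y x
      exact congrArg (fun m => m.hom v) (i' x y)
  refine ⟨l', d ≫ Pro.const.map F, ?_, ?_⟩
  -- Equivariance is tested inside the space of all functions. There the map factors as `Φ` after
  -- the original `X`-valued map, whose behaviour under the action is known from `φ'`; `Φ` itself
  -- need not land in smooth functions.
  · let E : ModuleCat.{0} k := ModuleCat.of k ((D.obj l').X.Pt → U)
    let inc : Smooth (D.obj l') U ⟶ E := ModuleCat.ofHom (smoothSubmodule _ U).subtype
    let Φ : X ⟶ E := ModuleCat.ofHom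
      (LinearMap.pi fun x => (φ.toFun (x ≫ (D.map t).hom.hom)).hom)
    have : Mono inc := (ModuleCat.mono_iff_injective _).2 Subtype.val_injective
    refine Act₀.change_injective inc ?_
    have hF : F ≫ inc = f ≫ Φ := rfl
    rw [← V.ρ.naturality, Category.assoc, ← Functor.map_comp, hF, Functor.map_comp,
      ← Category.assoc, V.ρ.naturality, h', Act₀.change_mk, Act₀.change_mk,
      Category.id_comp, Category.id_comp, Category.id_comp, Category.id_comp, pull_toFun t]
    trans Act₀.mk (D.obj l').X (pr π l') Z d (φ'.change (D.map t).hom.hom f' Φ)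
    · exact (Act₀.sound (𝟙 _) f' (by simp) rfl (by simp)).symm
    · refine Act₀.sound (𝟙 _) F (by simp) rfl fun y => ?_
      refine ModuleCat.hom_ext (LinearMap.ext fun v => funext fun x => ?_)
      have := congrArg (fun m => m.hom v) (i' x y).symm
      simp only [LinFamily.change_toFun, Category.comp_id, ModuleCat.hom_comp,
        LinearMap.comp_apply] at this ⊢
      exact this
  -- Evaluation at `1` is compared as action maps of the one-point group element, where the unit
  -- axiom of `V` applies.
  · refine Act₀.ofHom_unit_injective ?_
    have key₁ := congrFun (congrFun (congrArg Act.toFun V.one_act) U) ψ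
    simp only [Act.change_toFun, Act.ofHom_toFun, Category.id_comp, h, Act₀.change_mk, one_pr,
      Act₀.mk_precomp] at key₁
    rw [← key₁, Category.assoc, ← Functor.map_comp,
      ← Act₀.mk_ofHom (𝟙_ IndProFin) (LaxMonoidal.ε Pro.const)]
    refine Act₀.sound (𝟙 _) f (by simp) rfl fun x => ?_
    have e₁ : (1 : (D.obj l').X.Pt) ≫ (D.map t).hom.hom = x ≫ η[(D.obj l).X] :=
      (MonObj.one_comp (D.map t).hom.hom).trans
        (congrArg (· ≫ η[(D.obj l).X]) (toUnit_unique _ _))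
    change f ≫ φ.toFun ((1 : (D.obj l').X.Pt) ≫ (D.map t).hom.hom) = _
    rw [e₁]
    simp

end ProRep

/-! ### The representation on the corepresenting object -/

namespace Inflation

open Functor Smooth ProRep

variable {k : Type} [Field k] {H : Grp ProIndProFin} {L : Type} [SmallCategory L]
  {D : L ⥤ Grp IndProFin} (hD : ∀ l l' (f : l ⟶ l'), WeaklySurjective (D.map f).hom.hom)
  (π : (Functor.const L).obj H ⟶ D ⋙ Pro.const.mapGrp)

/-- The coaction on the coinvariants of smooth functions. -/
abbrev ccoact (l : L) (U : ModuleCat.{0} k) : Coinv (D.obj l) U ⟶ Coinv (D.obj l) (Smooth (D.obj l) U) :=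
  coinvMap (coact _ U) mapsOrbits_coact

theorem ccoact_tr (U : ModuleCat.{0} k) {l l' : L} (t : l' ⟶ l) :
    ccoact l U ≫ tr hD _ t ≫ cmap l' (pull U (D.map t)) = tr hD U t ≫ ccoact l' U := by
  rw [tr, tr, coinvMap_comp, coinvMap_comp, coinvMap_comp]
  exact coinvMap_congr _ _ (coact_pull _)

theorem ccoact_cmap {U U' : ModuleCat.{0} k} (l : L) (g : U ⟶ U') :
    ccoact (D := D) l U ≫ cmap l (map _ g) = cmap l g ≫ ccoact l U' := by
  rw [coinvMap_comp, coinvMap_comp]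
  exact coinvMap_congr _ _ (coact_map g)

theorem ccoact_ccoact (l : L) (U : ModuleCat.{0} k) :
    ccoact (D := D) l U ≫ ccoact l _ = ccoact l U ≫ cmap l (coact _ U) := by
  rw [coinvMap_comp, coinvMap_comp]
  exact coinvMap_congr _ _ coact_coact

theorem ccoact_eval (l : L) (U : ModuleCat.{0} k) :
    ccoact (D := D) l U ≫ cmap l (eval _ U 1) = 𝟙 _ := by
  rw [← coinvMap_id (fun h f => ⟨h, rfl⟩), coinvMap_comp]
  exact coinvMap_congr _ _ (ModuleCat.hom_ext (LinearMap.ext fun f => Smooth.ext fun x =>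
    congrArg f.1 (_root_.one_mul x)))

/-- An object corepresenting the functor `U ↦ colim_l Hom(Y, (Smooth S_l U)_{S_l})`. -/
structure Corepresentation (Y : ProVect k) where
  obj : ProVect k
  equiv : ∀ U, (obj ⟶ Pro.const.obj U) ≃ (functor hD Y).obj U
  equiv_comp : ∀ {U U'} (q : obj ⟶ Pro.const.obj U) (g : U ⟶ U'),
    equiv _ (q ≫ Pro.const.map g) = (functor hD Y).map g (equiv _ q)

namespace Corepresentation

variable {hD} {Y : ProVect k} (R : Corepresentation hD Y) {U U' : ModuleCat.{0} k}

/-- The equivariant map to the space of smooth functions defined by `y`. -/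
def coind {l : L} (y : Y ⟶ Pro.const.obj (Coinv (D.obj l) U)) :
    R.obj ⟶ Pro.const.obj (Smooth (D.obj l) U) :=
  -- Maps from `R.obj` to `Smooth S_l U` are classes of maps from `Y` to coinvariants of functions
  -- with values in `Smooth S_l U`; the coaction turns `y` into one of these.
  (R.equiv _).symm (Inflation.mk hD l (y ≫ Pro.const.map (ccoact l U)))

variable {l : L} (y : Y ⟶ Pro.const.obj (Coinv (D.obj l) U))

@[simp] theorem equiv_coind : R.equiv _ (R.coind y) = Inflation.mk hD l (y ≫ Pro.const.map (ccoact l U)) :=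
  (R.equiv _).apply_symm_apply _

theorem equiv_coind_comp {W : ModuleCat.{0} k} (g : Smooth (D.obj l) U ⟶ W) :
    R.equiv _ (R.coind y ≫ Pro.const.map g) = Inflation.mk hD l (y ≫ Pro.const.map (ccoact l U ≫ cmap l g)) := by
  rw [R.equiv_comp, equiv_coind, map_mk, Category.assoc, ← Functor.map_comp]

theorem coind_tr {l' : L} (t : l' ⟶ l) :
    R.coind (y ≫ Pro.const.map (tr hD U t)) = R.coind y ≫ Pro.const.map (pull U (D.map t)) := by
  apply (R.equiv _).injective
  rw [equiv_coind_comp, equiv_coind, Category.assoc, ← Functor.map_comp, ← ccoact_tr, ← mk_tr hD t,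
    Category.assoc, ← Functor.map_comp, Category.assoc, ← cmap_tr]

theorem coind_comp_map (g : U ⟶ U') :
    R.coind y ≫ Pro.const.map (map _ g) = R.coind (y ≫ Pro.const.map (cmap l g)) := by
  apply (R.equiv _).injective
  rw [equiv_coind_comp, equiv_coind, Category.assoc, ← Functor.map_comp, ccoact_cmap]

theorem coind_comp_coact :
    R.coind y ≫ Pro.const.map (coact _ U) = R.coind (y ≫ Pro.const.map (ccoact l U)) := by
  apply (R.equiv _).injective
  rw [equiv_coind_comp, equiv_coind, Category.assoc, ← Functor.map_comp, ccoact_ccoact]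

theorem equiv_coind_comp_eval :
    R.equiv _ (R.coind y ≫ Pro.const.map (eval _ U 1)) = Inflation.mk hD l y := by
  rw [equiv_coind_comp, ccoact_eval, CategoryTheory.Functor.map_id, Category.comp_id]

/-- The action map `H × R → U` defined by `y`. -/
def action₀ : Act₀ H.X R.obj U := Act₀.mk (D.obj l).X (pr π l) _ (R.coind y) (ev (D.obj l) U)

theorem action₀_tr {l' : L} (t : l' ⟶ l) :
    R.action₀ π (y ≫ Pro.const.map (tr hD U t)) = R.action₀ π y := by
  rw [action₀, action₀, coind_tr, pull_toFun t, Act₀.mk_postcomp]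
  congr 1
  exact LinFamily.ext (funext fun x => by simp)

theorem exists_equiv_eq (q : R.obj ⟶ Pro.const.obj U) : ∃ (l : L)
    (y : Y ⟶ Pro.const.obj (Coinv (D.obj l) U)), R.equiv _ q = Inflation.mk hD l y := by
  obtain ⟨l, y, h⟩ := exists_mk hD (R.equiv _ q)
  exact ⟨l, y, h.symm⟩

variable [IsCofiltered L]

variable {y} in
theorem action₀_eq {l' : L} {y' : Y ⟶ Pro.const.obj (Coinv (D.obj l') U)} (h : Inflation.mk hD l y = Inflation.mk hD l' y') :
    R.action₀ π y = R.action₀ π y' := by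
  obtain ⟨l'', t, t', h⟩ := mk_eq_mk hD h
  rw [← R.action₀_tr π y t, h, action₀_tr]

/-- The action of `H`. -/
def action : Act H.X R.obj R.obj where
  -- The representative chosen for the class of `q` does not matter, by `action₀_eq`.
  toFun U q := R.action₀ π (exists_mk hD (R.equiv _ q)).choose_spec.choose
  naturality U U' q g := by
    have h := (exists_mk hD (R.equiv _ q)).choose_spec.choose_spec
    have h' := (exists_mk hD (R.equiv _ (q ≫ Pro.const.map g))).choose_spec.choose_spec
    refine (R.action₀_eq π (h'.trans ((R.equiv_comp q g).trans
      ((congrArg _ h.symm).trans (map_mk hD g _ _))))).trans ?_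
    rw [action₀, action₀, ← coind_comp_map, Act₀.mk_postcomp, Act₀.change_mk]
    exact Act₀.sound (𝟙 _) (𝟙 _) (by simp) (by simp) (by simp)

variable {y} in
theorem action_toFun {q : R.obj ⟶ Pro.const.obj U} (h : R.equiv _ q = Inflation.mk hD l y) :
    (R.action π).toFun U q = R.action₀ π y :=
  R.action₀_eq π ((exists_mk hD (R.equiv _ q)).choose_spec.choose_spec.trans h)

/-- Equivariance of `coind`. The action on `coind y` is evaluation of `coind` of the coaction of
`y`; coassociativity rewrites the latter as the coaction applied to `coind y`, and evaluating a
coaction at `x` is translation by `x`. -/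
theorem action_coind :
    (R.action π).toFun _ (R.coind y) = Act₀.mk (D.obj l).X (pr π l) _ (R.coind y) (act (D.obj l) U) := by
  rw [R.action_toFun π (R.equiv_coind y), action₀, ← coind_comp_coact, Act₀.mk_postcomp]
  congr 1
  exact LinFamily.ext (funext fun x => by simp)

/-- The representation of `H`. -/
def rep : ProRep k H where
  V := R.obj
  ρ := R.action π
  one_act := by
    ext U q
    obtain ⟨l, y, h⟩ := R.exists_equiv_eq q
    obtain rfl : R.coind y ≫ Pro.const.map (eval _ U 1) = q :=
      (R.equiv _).injective ((R.equiv_coind_comp_eval y).trans h.symm)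
    simp only [Act.change_toFun, Act.ofHom_toFun, Category.id_comp, R.action_toFun π h, action₀,
      Act₀.change_mk, one_pr, Act₀.mk_precomp]
    rw [← Act₀.mk_ofHom (𝟙_ IndProFin) (LaxMonoidal.ε Pro.const)]
    refine Act₀.sound (𝟙 _) (𝟙 _) (by simp) (by simp) fun x => ?_
    have e₁ : (1 : (D.obj l).X.Pt) = x ≫ η[(D.obj l).X] :=
      congrArg (· ≫ η[(D.obj l).X]) (toUnit_unique _ _)
    simp [e₁]
  mul_act := by
    ext U q
    obtain ⟨l, y, h⟩ := R.exists_equiv_eq q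
    simp only [Act.change_toFun, Act.comp, Category.id_comp, R.action_toFun π h, action₀,
      Act₀.change_mk, mul_pr, Act₀.mk_precomp, Act.comp₀_mk]
    -- The inner action is now translation of functions, and evaluating at `x` the translate by `y`
    -- gives the value at `x y`.
    rw [R.action_coind, Act₀.change_mk, Act₀.compRep_mk]
    refine Act₀.sound (𝟙 _) (𝟙 _) (by simp) (by simp) fun x => ?_
    have e₁ : x ≫ μ[(D.obj l).X] = (x ≫ fst _ _) * (x ≫ snd _ _) :=
      congrArg (· ≫ μ[(D.obj l).X]) (lift_comp_fst_snd x).symm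
    simp [e₁, ofHom_transl_eval]

theorem isCoind_coind {q : R.obj ⟶ Pro.const.obj U} (h : R.equiv _ q = Inflation.mk hD l y) :
    IsCoind π (R.rep π) l (R.coind y) q where
  equivariant := R.action_coind π y
  eval_one := (R.equiv _).injective ((R.equiv_coind_comp_eval y).trans h.symm)

end Corepresentation

end Inflation

/-! ### The universal property of the inflation -/

namespace ProRep

variable {k : Type} [Field k] {H : Grp ProIndProFin} (V : ProRep k H)

/-- The projection to the coinvariants. -/
def toCoinv : V.V ⟶ (coinv k H).obj V := ((coinvAdjunction k H).unit.app V).hom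

variable {V} in
theorem toCoinv_comp_map_comp {V' : ProRep k H} (f : V ⟶ V') {W : ProVect k}
    (r : (coinv k H).obj V' ⟶ W) : V.toCoinv ≫ (coinv k H).map f ≫ r = f.hom ≫ V'.toCoinv ≫ r := by
  rw [← Category.assoc, ← Category.assoc]
  exact congrArg (· ≫ r) (congrArg Hom.hom ((coinvAdjunction k H).unit.naturality f)).symm

variable {V}

theorem toCoinv_comp_injective {W : ProVect k} {f f' : (coinv k H).obj V ⟶ W}
    (h : V.toCoinv ≫ f = V.toCoinv ≫ f') : f = f' := by
  apply ((coinvAdjunction k H).homEquiv V W).injective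
  rw [Adjunction.homEquiv_unit, Adjunction.homEquiv_unit]
  exact Hom.ext h

theorem toFun_toCoinv_comp {U : ModuleCat.{0} k} (r : (coinv k H).obj V ⟶ Pro.const.obj U) :
    V.ρ.toFun U (V.toCoinv ≫ r) = Act₀.ofHom H.X (V.toCoinv ≫ r) := by
  have h := congrFun (congrFun (congrArg Act.toFun ((coinvAdjunction k H).unit.app V).comm) U) r
  change (V.ρ.toFun U (V.toCoinv ≫ r)).change _ _ _ = (Act₀.ofHom H.X (𝟙 _ ≫ 𝟙 _ ≫ r)).change _ V.toCoinv _ at h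
  simpa using h

theorem exists_toCoinv_comp_eq {U : ModuleCat.{0} k} {ψ : V.V ⟶ Pro.const.obj U}
    (h : V.ρ.toFun U ψ = Act₀.ofHom H.X ψ) : ∃ r, V.toCoinv ≫ r = ψ := by
  let f : V ⟶ (triv k H).obj (Pro.const.obj U) := ⟨ψ, Act.ext (funext fun U' => funext fun q => by
    obtain ⟨g, rfl⟩ := Pro.const.map_surjective q
    change (V.ρ.toFun U' (ψ ≫ Pro.const.map g)).change _ _ _ =
      (Act₀.ofHom H.X (𝟙 _ ≫ 𝟙 _ ≫ Pro.const.map g)).change _ ψ _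
    rw [V.ρ.naturality, h]
    simp)⟩
  refine ⟨((coinvAdjunction k H).homEquiv V _).symm f, ?_⟩
  have := ((coinvAdjunction k H).homEquiv V _).apply_symm_apply f
  rw [Adjunction.homEquiv_unit] at this
  exact congrArg Hom.hom this

open Smooth in
-- The equivariant map attached to `b` itself is `v ↦ (x ↦ x b(v))`, because `b` is equivariant.
theorem IsCoind.coact {L : Type} [SmallCategory L] {D : L ⥤ Grp IndProFin}
    {π : (Functor.const L).obj H ⟶ D ⋙ Pro.const.mapGrp} {l : L} {U : ModuleCat.{0} k}
    {b : V.V ⟶ Pro.const.obj (Smooth (D.obj l) U)} {ψ : V.V ⟶ Pro.const.obj U}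
    (h : IsCoind π V l b ψ) : IsCoind π V l (b ≫ Pro.const.map (Smooth.coact _ U)) b where
  equivariant := by
    rw [h.toFun_comp, Act₀.mk_postcomp]
    congr 1
    refine LinFamily.ext (funext fun x => ?_)
    simp only [LinFamily.change_toFun, Category.comp_id, Category.id_comp]
    refine ModuleCat.hom_ext (LinearMap.ext fun f => Smooth.ext fun y => ?_)
    exact LinearMap.congr_fun (map_mul (transl _ U) y x).symm f
  eval_one := by
    have : Smooth.coact (D.obj l) U ≫ Smooth.eval _ _ 1 = 𝟙 _ :=
      ModuleCat.hom_ext (LinearMap.ext fun f => LinearMap.congr_fun (map_one (transl _ U)) f)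
    rw [Category.assoc, ← Functor.map_comp, this, CategoryTheory.Functor.map_id, Category.comp_id]

end ProRep

namespace Inflation

open Functor Smooth ProRep

variable {k : Type} [Field k] [CharZero k] {H : Grp ProIndProFin} {L : Type} [SmallCategory L]
  [IsCofiltered L] {D : L ⥤ Grp IndProFin}
  {hD : ∀ l l' (f : l ⟶ l'), WeaklySurjective (D.map f).hom.hom}
  {π : (Functor.const L).obj H ⟶ D ⋙ Pro.const.mapGrp} {Y : ProVect k} {U U' : ModuleCat.{0} k}

omit [CharZero k] in
theorem mk_cstCoinv (z : Y ⟶ Pro.const.obj U) (l l' : L) :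
    mk hD l (z ≫ Pro.const.map (cstCoinv _ U)) = mk hD l' (z ≫ Pro.const.map (cstCoinv _ U)) := by
  have key {l l' : L} (t : l' ⟶ l) :
      mk hD l (z ≫ Pro.const.map (cstCoinv _ U)) = mk hD l' (z ≫ Pro.const.map (cstCoinv _ U)) := by
    rw [← mk_tr hD t, Category.assoc, ← Functor.map_comp]
    rfl
  obtain ⟨l'', t, t', -⟩ := IsCofilteredOrEmpty.cone_objs l l'
  exact (key t).trans (key t').symm

variable (hS : ∀ l, IsQuasiUnipotent (D.obj l))

include hS in
-- Constants pull back to constants and embed in the coinvariants at every level, so nothing is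
-- identified in the colimit.
theorem mk_cstCoinv_injective {z z' : Y ⟶ Pro.const.obj U} {l : L}
    (h : mk hD l (z ≫ Pro.const.map (cstCoinv _ U)) = mk hD l (z' ≫ Pro.const.map (cstCoinv _ U))) :
    z = z' := by
  obtain ⟨l', t, h⟩ := mk_eq_mk_same hD h
  rw [Category.assoc, Category.assoc, ← Functor.map_comp] at h
  have : Mono (cstCoinv (D.obj l') U) :=
    (ModuleCat.mono_iff_injective _).2 (cstCoinv_injective (hS l'))
  exact (cancel_mono (Pro.const.map (cstCoinv (D.obj l') U))).1 h

namespace Corepresentation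

variable (R : Corepresentation hD Y)

variable (hπ : IsLimit (baseCone π))

include hS hπ in
-- For invariant `q`, both `coind y` and the constant-function map `q ≫ cst` are equivariant lifts
-- of `q`, hence equal at a finer level. Read through `R.equiv`, this says that the coaction fixes
-- `y` in the sense of `exists_lift_cst`, so `y` is the class of a constant.
theorem exists_equiv_eq_of_invariant (q : R.obj ⟶ Pro.const.obj U)
    (h : (R.rep π).ρ.toFun U q = Act₀.ofHom H.X q) :
    ∃ z : Y ⟶ Pro.const.obj U, ∀ l,
      R.equiv _ q = Inflation.mk hD l (z ≫ Pro.const.map (cstCoinv _ U)) := by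
  obtain ⟨l, y, hy⟩ := R.exists_equiv_eq q
  obtain ⟨l₁, t, t', e⟩ := (R.isCoind_coind π _ hy).unique hπ (IsCoind.of_invariant l h)
  replace e : R.coind y ≫ Pro.const.map (pull U (D.map t)) =
      (q ≫ Pro.const.map (cst (D.obj l) U)) ≫ Pro.const.map (pull U (D.map t')) := e
  rw [← R.coind_tr, Category.assoc, ← Functor.map_comp, cst_pull] at e
  rw [← mk_tr hD t] at hy
  generalize y ≫ Pro.const.map (tr hD U t) = y at hy e
  have e' := congrArg (R.equiv _) e
  rw [R.equiv_comp, hy, equiv_coind, map_mk] at e'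
  obtain ⟨l₂, s, e'⟩ := mk_eq_mk_same hD e'
  have key : (y ≫ Pro.const.map (tr hD U s)) ≫ Pro.const.map (ccoact l₂ U) =
      (y ≫ Pro.const.map (tr hD U s)) ≫ Pro.const.map (cmap l₂ (cst _ U)) := by
    -- In `e'` only the outer group has been moved to level `l₂`; this pulls the inner space of
    -- smooth functions back to the same level.
    have := congrArg (fun m => m ≫ Pro.const.map (cmap l₂ (pull U (D.map s)))) e'
    simp only [Category.assoc, ← Functor.map_comp, ccoact_tr] at this ⊢
    rw [this, ← Category.assoc, cmap_tr, Category.assoc, coinvMap_comp]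
    rfl
  obtain ⟨z, hz⟩ := exists_lift_cst (hS l₂) _ key
  refine ⟨z, fun l' => ?_⟩
  rw [hy, ← mk_tr hD s, ← hz]
  exact mk_cstCoinv _ _ _

include hS hπ in
/-- The unit of the adjunction. -/
theorem exists_unit : ∃ u : Y ⟶ (coinv k H).obj (R.rep π), ∀ (U : ModuleCat.{0} k)
    (r : (coinv k H).obj (R.rep π) ⟶ Pro.const.obj U) (l : L),
      R.equiv _ ((R.rep π).toCoinv ≫ r) = Inflation.mk hD l ((u ≫ r) ≫ Pro.const.map (cstCoinv _ U)) := by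
  choose z hz using fun (U : ModuleCat.{0} k) (r : (coinv k H).obj (R.rep π) ⟶ Pro.const.obj U) =>
    R.exists_equiv_eq_of_invariant hS hπ _ (toFun_toCoinv_comp r)
  obtain ⟨u, hu, -⟩ := Pro.existsUnique_hom z fun U U' q g => by
    obtain ⟨l⟩ := IsCofiltered.nonempty (C := L)
    refine mk_cstCoinv_injective (hD := hD) hS (l := l) ?_
    rw [← hz, ← Category.assoc]
    refine (R.equiv_comp _ g).trans ?_
    rw [hz _ _ l, map_mk, Category.assoc, Category.assoc, ← Functor.map_comp, ← Functor.map_comp,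
      cstCoinv_coinvMap_map]
  exact ⟨u, fun U r l => (hz U r l).trans (by rw [hu])⟩

include hS hπ in
theorem exists_universal : ∃ u : Y ⟶ (coinv k H).obj (R.rep π), ∀ (V : ProRep k H)
    (y : Y ⟶ (coinv k H).obj V), ∃! f : R.rep π ⟶ V, u ≫ (coinv k H).map f = y := by
  obtain ⟨u, hu⟩ := R.exists_unit hS hπ
  obtain ⟨l₀⟩ := IsCofiltered.nonempty (C := L)
  refine ⟨u, fun V y => ?_⟩
  have exists_desc {U : ModuleCat.{0} k} {l : L} {b : V.V ⟶ Pro.const.obj (Smooth (D.obj l) U)}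
      {ψ : V.V ⟶ Pro.const.obj U} (h : IsCoind π V l b ψ) :
      ∃ w, V.toCoinv ≫ w = b ≫ Pro.const.map (proj _ U) := exists_toCoinv_comp_eq h.invariant
  choose l b h using fun (U : ModuleCat.{0} k) (ψ : V.V ⟶ Pro.const.obj U) => V.exists_isCoind hπ ψ
  choose w hw using fun (U : ModuleCat.{0} k) (ψ : V.V ⟶ Pro.const.obj U) => exists_desc (h U ψ)
  -- Lift `ψ` equivariantly to smooth functions, project to coinvariants, factor this through `coinv
  -- V` and precompose with `y`. By `equiv_θ` any other lift gives the same map.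
  let θ (U : ModuleCat.{0} k) (ψ : V.V ⟶ Pro.const.obj U) : R.obj ⟶ Pro.const.obj U :=
    (R.equiv U).symm (Inflation.mk hD (l U ψ) (y ≫ w U ψ))
  have equiv_θ {U : ModuleCat.{0} k} {l' : L} {b' : V.V ⟶ Pro.const.obj (Smooth (D.obj l') U)}
      {ψ : V.V ⟶ Pro.const.obj U} (h' : IsCoind π V l' b' ψ)
      {w' : (coinv k H).obj V ⟶ Pro.const.obj (Coinv (D.obj l') U)}
      (hw' : V.toCoinv ≫ w' = b' ≫ Pro.const.map (proj _ U)) :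
      R.equiv U (θ U ψ) = Inflation.mk hD l' (y ≫ w') := by
    obtain ⟨l'', t, t', e⟩ := (h U ψ).unique hπ h'
    refine ((R.equiv U).apply_symm_apply _).trans ?_
    rw [← mk_tr hD t, ← mk_tr hD t', Category.assoc, Category.assoc]
    congr 2
    apply toCoinv_comp_injective
    rw [← Category.assoc, ← Category.assoc, hw, hw', Category.assoc, Category.assoc,
      ← Functor.map_comp, ← Functor.map_comp, tr, tr, proj_coinvMap, proj_coinvMap,
      Functor.map_comp, Functor.map_comp, ← Category.assoc, e, Category.assoc]
  obtain ⟨f, hf, hf'⟩ := Pro.existsUnique_hom θ fun U U' ψ g => by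
    apply (R.equiv _).injective
    rw [R.equiv_comp, equiv_θ (h U ψ) (hw U ψ), map_mk, Category.assoc]
    refine equiv_θ ((h U ψ).comp_map g) ?_
    rw [← Category.assoc, hw, Category.assoc, Category.assoc, ← Functor.map_comp,
      ← Functor.map_comp, proj_coinvMap]
  have comp_coind {U : ModuleCat.{0} k} (ψ : V.V ⟶ Pro.const.obj U) :
      f ≫ b U ψ = R.coind (y ≫ w U ψ) := by
    apply (R.equiv _).injective
    rw [hf, equiv_coind, Category.assoc]
    refine equiv_θ (h U ψ).coact ?_
    rw [← Category.assoc, hw, Category.assoc, Category.assoc, ← Functor.map_comp,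
      ← Functor.map_comp, proj_coinvMap]
  -- Both actions followed by `ψ` are evaluations of the equivariant lifts, and `f` carries the lift
  -- for `V` to the one for `R`.
  have comm : (R.rep π).ρ.change (𝟙 _) (𝟙 _) f = V.ρ.change (𝟙 _) f (𝟙 _) := by
    refine Act.ext (funext fun U => funext fun ψ => ?_)
    change ((R.action π).toFun U (f ≫ ψ)).change _ _ _ = (V.ρ.toFun U (𝟙 _ ≫ ψ)).change _ f _
    refine (Act₀.change_id _).trans ?_
    rw [Category.id_comp, hf, R.action_toFun π (equiv_θ (h U ψ) (hw U ψ)),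
      (h U ψ).toFun_eq, Act₀.change_mk, Category.id_comp, comp_coind, LinFamily.change_id]
    rfl
  obtain ⟨F, hF⟩ : ∃ F : R.rep π ⟶ V, F.hom = f := ⟨⟨f, comm⟩, rfl⟩
  refine ⟨F, ?_, fun f' e => ?_⟩
  -- Test on maps `r` from `coinv V` to `U`. The pullback of `r` to `V` is invariant, so its lift
  -- may be taken with values in the constants, whose class factors through `r ≫ cstCoinv`.
  · refine Pro.hom_ext fun U r => mk_cstCoinv_injective (hD := hD) hS (l := l₀) ?_
    rw [Category.assoc u, ← hu]
    have e : (R.rep π).toCoinv ≫ (coinv k H).map F ≫ r = θ U (V.toCoinv ≫ r) := by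
      rw [toCoinv_comp_map_comp, hF]
      exact hf _ _
    refine (congrArg (R.equiv _) e).trans ?_
    rw [Category.assoc]
    refine equiv_θ (IsCoind.of_invariant l₀ (toFun_toCoinv_comp r)) ?_
    simp only [Category.assoc, cstCoinv, Functor.map_comp]
  -- For another solution `f'`, the lift of `ψ` precomposed with `f'` and the map `coind y₁` both
  -- lift `f' ≫ ψ`, so they agree at a finer level. Their projections to coinvariants are read
  -- through the unit `u`; `coact_map_proj` turns the `coind` side back into `y₂`.
  · refine Hom.ext (Eq.trans (hf' _ fun U ψ => (R.equiv _).injective ?_) hF.symm)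
    obtain ⟨l₁, y₁, hy₁⟩ := R.exists_equiv_eq (f'.hom ≫ ψ)
    obtain ⟨l₂, t, t', i⟩ := (R.isCoind_coind π _ hy₁).unique hπ ((h U ψ).precomp f')
    obtain ⟨w₂, hw₂⟩ := exists_desc ((h U ψ).pull t')
    rw [equiv_θ ((h U ψ).pull t') hw₂, hy₁, ← mk_tr hD t]
    congr 1
    replace i : R.coind y₁ ≫ Pro.const.map (pull U (D.map t)) =
      (f'.hom ≫ b U ψ) ≫ Pro.const.map (pull U (D.map t')) := i
    rw [← R.coind_tr, Category.assoc] at i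
    generalize y₁ ≫ Pro.const.map (tr hD U t) = y₂ at i
    rw [← e, Category.assoc]
    refine mk_cstCoinv_injective (hD := hD) hS (l := l₀) ?_
    have i' : R.coind y₂ ≫ Pro.const.map (proj _ U) =
        (R.rep π).toCoinv ≫ (coinv k H).map f' ≫ w₂ := by
      rw [toCoinv_comp_map_comp, hw₂, i]
      exact Category.assoc _ _ _
    rw [← hu]
    refine Eq.trans ?_ (congrArg (R.equiv _) i')
    rw [R.equiv_coind_comp, coact_map_proj]
    exact mk_cstCoinv _ _ _

end Corepresentation

include hS in
theorem isRightAdjoint_coinv (hD : ∀ l l' (f : l ⟶ l'), WeaklySurjective (D.map f).hom.hom)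
    (hπ : IsLimit (baseCone π)) : (coinv k H).IsRightAdjoint := by
  have (Y : ProVect k) : HasInitial (StructuredArrow Y (coinv k H)) := by
    obtain ⟨I, e, he⟩ := exists_corepresentation hD Y hS
    obtain ⟨u, h⟩ := Corepresentation.exists_universal (hD := hD) hS ⟨I, e, he _ _⟩ hπ
    refine IsInitial.hasInitial (X := StructuredArrow.mk u) (IsInitial.ofUniqueHom
      (fun A => StructuredArrow.homMk (h _ A.hom).choose (h _ A.hom).choose_spec.1) fun A m => ?_)
    ext1
    exact (h _ A.hom).choose_spec.2 _ (StructuredArrow.w m)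
  exact isRightAdjointOfStructuredArrowInitials _

end Inflation

end

/-! ### The proposition over the complex numbers -/

theorem mainTheorem10 (H : Grp ProIndProFin) (hH : IsQuasiProUnipotent H) :
    (ProRep.coinv ℂ H).IsRightAdjoint ∧
      PreservesFiniteLimits (ProRep.coinv ℂ H) ∧ PreservesFiniteColimits (ProRep.coinv ℂ H) := by
  obtain ⟨L, _, _, F, π, hS, hF, ⟨hπ⟩⟩ := hH
  have h : (ProRep.coinv ℂ H).IsRightAdjoint := Inflation.isRightAdjoint_coinv hS hF hπ
  -- Colimits are preserved because `coinv` is left adjoint to `triv`; limits, because it is a right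
  -- adjoint by `h`.
  have := (ProRep.coinvAdjunction ℂ H).leftAdjoint_preservesColimits
  exact ⟨h, inferInstance, inferInstance⟩
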